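/- **Setting.** Let $V,H,U$ be separable real Hilbert spaces, with a continuous, dense, injective embedding $\iota:V\hookrightarrow H$, suppressed in the notation. Let $V^*$ be the dual of $V$ and identify $x\in H$ with $(x,\iota\,\cdot)_H\in V^*$, so that $V\subset H\subset V^*$; no compactness of these embeddings is assumed. Write $\langle\cdot,\cdot\rangle$ for the pairing of $V^*$ and $V$, $\mathcal L_2(U,H)$ for the Hilbert–Schmidt operators with norm $|\!|\!|\cdot|\!|\!|_H$, and $\|\cdot\|_\beta$ for the norm of the complex interpolation space $[V^*,V]_\beta$ (of the complexified spaces), $\beta\in(0,1)$. Put $\mathbb R_+=[0,\infty)$ and $$MR(0,T)=C([0,T];H)\cap L^2(0,T;V),\qquad \|u\|_{MR(0,T)}=\|u\|_{C([0,T];H)}+\|u\|_{L^2(0,T;V)}.$$ **Assumptions.** Let $A(t,v)=A_0(t,v)v-F(t,v)-f(t)$ and $B(t,v)=B_0(t,v)v+G(t,v)+g(t)$ for $t\in\mathbb R_+$, $v\in V$, where: 1. $A_0:\mathbb R_+\times H\to\mathcal L(V,V^*)$ and $B_0:\mathbb R_+\times H\to\mathcal L(V,\mathcal L_2(U,H))$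 are such that $(t,u)\mapsto A_0(t,u)v$ and $(t,u)\mapsto B_0(t,u)v$ are Borel measurable for every $v\in V$; $F:\mathbb R_+\times V\to V^*$ and $G:\mathbb R_+\times V\to\mathcal L_2(U,H)$ are Borel measurable; $f:\mathbb R_+\to V^*$ and $g:\mathbb R_+\to\mathcal L_2(U,H)$ are Borel measurable and belong to $L^2(0,T)$ (with values in the respective space) for every $T>0$. 2. For all $T>0$, $n\ge0$ there are $\theta_{n,T},M_{n,T}>0$ such that for all $t\in[0,T]$, $v\in V$ and $u\in H$ with $\|u\|_H\le n$, $$\langle A_0(t,u)v,v\rangle-\tfrac12|\!|\!|B_0(t,u)v|\!|\!|_H^2\ge\theta_{n,T}\|v\|_V^2-M_{n,T}\|v\|_H^2 .$$ 3. There are $m_F,m_G\in\mathbb N_0$ and, for $1\le j\le m_F+m_G$, numbers $\rho_j\ge0$, $\beta_j\in(\frac12,1)$ with $2\beta_j\le1+\frac1{1+\rho_j}$, and for all $T>0$, $n\ge0$ there is a constant $C=C_{n,T}$ such that for all $t\in[0,T]$ and $u,v,w\in V$ with $\|u\|_H,\|v\|_H\le n$: $$\|A_0(t,u)w\|_{V^*}\le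 C(1+\|u\|_H)\|w\|_V,\qquad \|A_0(t,u)w-A_0(t,v)w\|_{V^*}\le C\|u-v\|_H\|w\|_V,$$ $$\|F(t,u)\|_{V^*}\le C\sum_{j=1}^{m_F}(1+\|u\|_{\beta_j}^{\rho_j+1}),\qquad \|F(t,u)-F(t,v)\|_{V^*}\le C\sum_{j=1}^{m_F}(1+\|u\|_{\beta_j}^{\rho_j}+\|v\|_{\beta_j}^{\rho_j})\|u-v\|_{\beta_j},$$ and the same four bounds hold with $(A_0,F,\|\cdot\|_{V^*})$ replaced by $(B_0,G,|\!|\!|\cdot|\!|\!|_H)$ and the sums taken over $m_F+1\le j\le m_F+m_G$. 4. (Coercivity) For all $T>0$ there are $\theta,M>0$ and $\phi\in L^2(0,T)$ such that for all $v\in V$, $t\in[0,T]$, $$\langle A(t,v),v\rangle-\tfrac12|\!|\!|B(t,v)|\!|\!|_H^2\ge\theta\|v\|_V^2-M\|v\|_H^2-|\phi(t)|^2 .$$ Let $x\in H$ and $T>0$. For $\psi\in L^2(0,T;U)$, a strong solution of the skeleton equation $$u'(t)=-A(t,u(t))+B(t,u(t))\psi(t)\quad(t\in[0,T]),\qquad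 u(0)=x,$$ is a $u\in MR(0,T)$ such that $A(\cdot,u)-B(\cdot,u)\psi\in L^2(0,T;V^*)+L^1(0,T;H)$ and $u(t)=x-\int_0^t\big(A(s,u(s))-B(s,u(s))\psi(s)\big)\,ds$ in $V^*$ for all $t\in[0,T]$. **Proposition.** For every $\psi\in L^2(0,T;U)$ there is exactly one strong solution $u^\psi\in MR(0,T)$ of the skeleton equation. For every $K\ge0$, the map $\psi\mapsto u^\psi$ is continuous from $S_K=\{\psi\in L^2(0,T;U):\|\psi\|_{L^2(0,T;U)}\le K\}$, with the weak topology of $L^2(0,T;U)$, to $MR(0,T)$ with its norm. Consequently, the rate function $$I(z)=\tfrac12\inf\Big\{\int_0^T\|\psi(s)\|_U^2\,ds:\psi\in L^2(0,T;U),\ z=u^\psi\Big\},\qquad z\in MR(0,T),\quad\inf\varnothing=\infty,$$ has compact sublevel sets: $\{z\in MR(0,T):I(z)\le r\}$ is compact for every $r\in[0,\infty)$. -/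

import Mathlib

open MeasureTheory Set
open scoped ENNReal NNReal

noncomputable section

namespace SkeletonEq

/-! ### Hilbert-Schmidt operators -/

section HilbertSchmidt

variable (U H : Type*) [NormedAddCommGroup U] [InnerProductSpace ℝ U] [CompleteSpace U]
  [NormedAddCommGroup H] [InnerProductSpace ℝ H]

/-- The index set of a fixed orthonormal (Hilbert) basis of `U`. -/
def hsIndex : Set U := (exists_hilbertBasis ℝ U).choose

/-- A fixed orthonormal (Hilbert) basis of `U`. -/
def hsBasis : HilbertBasis (hsIndex U) ℝ U := (exists_hilbertBasis ℝ U).choose_spec.choose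

/-- The subspace of those bounded operators `T : U → H` with `∑ᵢ ‖T eᵢ‖² < ∞`. -/
def hsSubmodule : Submodule ℝ (U →L[ℝ] H) where
  carrier := {T | Memℓp (fun i => T (hsBasis U i)) 2}
  add_mem' := fun hS hT => hS.add hT
  zero_mem' := zero_memℓp
  smul_mem' := fun a _ hT => hT.const_smul a

/-- The space `L₂(U, H)` of Hilbert-Schmidt operators. It is a type of its own, so that it carries
the Hilbert-Schmidt norm and not the operator norm. -/
def HilbertSchmidt : Type _ := ↥(hsSubmodule U H)

variable {U H}

instance : AddCommGroup (HilbertSchmidt U H) := inferInstanceAs (AddCommGroup ↥(hsSubmodule U H))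

instance : Module ℝ (HilbertSchmidt U H) := inferInstanceAs (Module ℝ ↥(hsSubmodule U H))

/-- A Hilbert-Schmidt operator as a bounded operator. -/
def HilbertSchmidt.toCLM : HilbertSchmidt U H →ₗ[ℝ] (U →L[ℝ] H) := (hsSubmodule U H).subtype

/-- The family `(T eᵢ)ᵢ` of a Hilbert-Schmidt operator, as an element of `ℓ²(H)`. -/
def HilbertSchmidt.toLp : HilbertSchmidt U H →ₗ[ℝ] lp (fun _ : hsIndex U => H) 2 where
  toFun T := ⟨fun i => T.toCLM (hsBasis U i), T.2⟩
  map_add' _ _ := rfl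
  map_smul' _ _ := rfl

theorem HilbertSchmidt.toLp_injective :
    Function.Injective (HilbertSchmidt.toLp : HilbertSchmidt U H →ₗ[ℝ] _) := by
  intro S T h
  apply Subtype.ext
  refine ContinuousLinearMap.ext_on (s := Set.range (hsBasis U)) ?_ ?_
  · exact (Submodule.dense_iff_topologicalClosure_eq_top).2 (hsBasis U).dense_span
  · rintro _ ⟨i, rfl⟩
    exact congrFun (congrArg Subtype.val h) i

/-- The Hilbert-Schmidt norm `‖T‖ = (∑ᵢ ‖T eᵢ‖²)^(1/2)`. -/
instance : NormedAddCommGroup (HilbertSchmidt U H) :=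
  NormedAddCommGroup.induced _ _ (HilbertSchmidt.toLp (U := U) (H := H))
    HilbertSchmidt.toLp_injective

instance : NormedSpace ℝ (HilbertSchmidt U H) :=
  NormedSpace.induced ℝ (HilbertSchmidt U H) _ (HilbertSchmidt.toLp (U := U) (H := H))

instance : MeasurableSpace (HilbertSchmidt U H) := borel _

instance : BorelSpace (HilbertSchmidt U H) := ⟨rfl⟩

theorem HilbertSchmidt.hasSum_norm_sq (T : HilbertSchmidt U H) :
    HasSum (fun i => ‖T.toCLM (hsBasis U i)‖ ^ 2) (‖T‖ ^ 2) := by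
  have h := lp.hasSum_norm (p := 2) (by norm_num) (HilbertSchmidt.toLp T)
  simp only [ENNReal.toReal_ofNat, Real.rpow_ofNat] at h
  exact h

theorem enorm_sq_eq_tsum {I E : Type*} [NormedAddCommGroup E] [InnerProductSpace ℝ E]
    (b : HilbertBasis I ℝ E) (x : E) :
    ‖x‖ₑ ^ 2 = ∑' i, ‖inner ℝ (b i) x‖ₑ ^ 2 := by
  have h := b.hasSum_inner_mul_inner x x
  rw [real_inner_self_eq_norm_sq] at h
  have h2 : (fun i => inner ℝ x (b i) * inner ℝ (b i) x)
      = fun i => ‖inner ℝ (b i) x‖ ^ 2 := by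
    funext i
    rw [real_inner_comm, Real.norm_eq_abs, sq_abs, sq]
  rw [h2] at h
  have h3 := ENNReal.ofReal_tsum_of_nonneg (fun i => sq_nonneg _) h.summable
  rw [h.tsum_eq] at h3
  rw [ENNReal.ofReal_pow (norm_nonneg _), ofReal_norm] at h3
  rw [h3]
  refine tsum_congr fun i => ?_
  rw [ENNReal.ofReal_pow (norm_nonneg _), ofReal_norm]

theorem tsum_enorm_sq_eq {I J : Type*} [CompleteSpace H] (b : HilbertBasis I ℝ U)
    (c : HilbertBasis J ℝ H) (T : U →L[ℝ] H) :
    ∑' i, ‖T (b i)‖ₑ ^ 2 = ∑' j, ‖T.adjoint (c j)‖ₑ ^ 2 := by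
  simp_rw [enorm_sq_eq_tsum c, enorm_sq_eq_tsum b]
  rw [ENNReal.tsum_comm]
  refine tsum_congr fun j => tsum_congr fun i => ?_
  rw [ContinuousLinearMap.adjoint_inner_right, real_inner_comm]

/-- The sum `∑ᵢ ‖T eᵢ‖²` does not depend on the orthonormal basis: neither the space of
Hilbert-Schmidt operators nor its norm depends on the basis fixed above. -/
theorem tsum_enorm_sq_basis {I : Type*} [CompleteSpace H] (b : HilbertBasis I ℝ U)
    (T : U →L[ℝ] H) :
    ∑' i, ‖T (b i)‖ₑ ^ 2 = ∑' i, ‖T (hsBasis U i)‖ₑ ^ 2 := by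
  rw [tsum_enorm_sq_eq b (hsBasis H), tsum_enorm_sq_eq (hsBasis U) (hsBasis H)]

end HilbertSchmidt

/-! ### Complex interpolation -/

section Interpolation

variable {X₀ X₁ : Type*} [NormedAddCommGroup X₀] [NormedSpace ℝ X₀]
  [NormedAddCommGroup X₁] [NormedSpace ℝ X₁]

/-- The norm of `x + i y` in the complexification of a real Hilbert space. -/
def complexNorm {X : Type*} [NormedAddCommGroup X] (x y : X) : ℝ := √(‖x‖ ^ 2 + ‖y‖ ^ 2)

/-- The function `F₁ + i F₂`, with values in the complexification of `X`, has the complex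
derivative `d₁ + i d₂` at `z`: its increment in the direction `w = a + i b` is
`(a + i b) (d₁ + i d₂)` to first order. -/
def HasComplexDerivAt {X : Type*} [NormedAddCommGroup X] [NormedSpace ℝ X]
    (F₁ F₂ : ℂ → X) (d₁ d₂ : X) (z : ℂ) : Prop :=
  HasFDerivAt F₁ (Complex.reCLM.smulRight d₁ - Complex.imCLM.smulRight d₂) z ∧
  HasFDerivAt F₂ (Complex.reCLM.smulRight d₂ + Complex.imCLM.smulRight d₁) z

/-- `F = F₁ + i F₂` is an admissible function, of norm at most `M`, for the complex interpolation
of the couple `(X₀, X₁)`, where `X₁` is continuously embedded into `X₀` by `k`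
(so that `X₀ + X₁ = X₀`) and both spaces are complexified: `F` is continuous and bounded on the
closed strip `0 ≤ re z ≤ 1` with values in `X₀`, holomorphic in the open strip, bounded by `M` in
`X₀` on the line `re z = 0`, and on the line `re z = 1` it equals `G₁ + i G₂`, which is continuous
with values in `X₁` and bounded by `M` in `X₁`. -/
structure IsAdmissible (k : X₁ →L[ℝ] X₀) (F₁ F₂ : ℂ → X₀) (G₁ G₂ : ℝ → X₁) (M : ℝ) :
    Prop where
  continuousOn₁ : ContinuousOn F₁ {z | 0 ≤ z.re ∧ z.re ≤ 1}
  continuousOn₂ : ContinuousOn F₂ {z | 0 ≤ z.re ∧ z.re ≤ 1}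
  bounded : ∃ R : ℝ, ∀ z : ℂ, 0 ≤ z.re → z.re ≤ 1 → complexNorm (F₁ z) (F₂ z) ≤ R
  holomorphic : ∀ z : ℂ, 0 < z.re → z.re < 1 → ∃ d₁ d₂ : X₀, HasComplexDerivAt F₁ F₂ d₁ d₂ z
  left_le : ∀ t : ℝ, complexNorm (F₁ (t * Complex.I)) (F₂ (t * Complex.I)) ≤ M
  right_eq₁ : ∀ t : ℝ, F₁ (1 + t * Complex.I) = k (G₁ t)
  right_eq₂ : ∀ t : ℝ, F₂ (1 + t * Complex.I) = k (G₂ t)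
  right_continuous₁ : Continuous G₁
  right_continuous₂ : Continuous G₂
  right_le : ∀ t : ℝ, complexNorm (G₁ t) (G₂ t) ≤ M

/-- The norm of `x ∈ X₁` in the complex interpolation space `[X₀, X₁]_θ`: the infimum of the norms
of the admissible functions `F` with `F(θ) = x`. -/
def interpNorm (k : X₁ →L[ℝ] X₀) (θ : ℝ) (x : X₁) : ℝ :=
  sInf {M : ℝ | ∃ (F₁ F₂ : ℂ → X₀) (G₁ G₂ : ℝ → X₁),
    IsAdmissible k F₁ F₂ G₁ G₂ M ∧ F₁ θ = k x ∧ F₂ θ = 0}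

/-- Every `x ∈ X₁` has an admissible function (the constant one), so the infimum is proper. -/
theorem interpNorm_nonempty (k : X₁ →L[ℝ] X₀) (θ : ℝ) (x : X₁) :
    {M : ℝ | ∃ (F₁ F₂ : ℂ → X₀) (G₁ G₂ : ℝ → X₁),
      IsAdmissible k F₁ F₂ G₁ G₂ M ∧ F₁ θ = k x ∧ F₂ θ = 0}.Nonempty := by
  refine ⟨max ‖k x‖ ‖x‖, fun _ => k x, fun _ => 0, fun _ => x, fun _ => 0, ?_, rfl, rfl⟩
  refine ⟨continuousOn_const, continuousOn_const, ⟨‖k x‖, ?_⟩, ?_, ?_, fun _ => rfl, by simp,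
    continuous_const, continuous_const, ?_⟩
  · simp [complexNorm]
  · exact fun z _ _ => ⟨0, 0, by simpa using hasFDerivAt_const (k x) z,
      by simpa using hasFDerivAt_const (0 : X₀) z⟩
  · simp [complexNorm]
  · simp [complexNorm]

end Interpolation

/-! ### Gelfand triple and maximal regularity space -/

section Gelfand

variable {V H : Type*} [NormedAddCommGroup V] [InnerProductSpace ℝ V]
  [NormedAddCommGroup H] [InnerProductSpace ℝ H]

/-- The embedding `j : H → V*`, `j x = (x, ι ·)_H`, given by `ι : V → H`. -/
def toDualV (ι : V →L[ℝ] H) : H →L[ℝ] StrongDual ℝ V :=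
  ((ContinuousLinearMap.compL ℝ V H ℝ).flip ι).comp (innerSL ℝ)

theorem toDualV_apply (ι : V →L[ℝ] H) (x : H) (v : V) : toDualV ι x v = inner ℝ x (ι v) := rfl

/-- The norm of `v ∈ V` in the complex interpolation space `V_β = [V*, V]_β`. -/
def normβ (ι : V →L[ℝ] H) (β : ℝ) (v : V) : ℝ := interpNorm ((toDualV ι).comp ι) β v

/-- Lebesgue measure on `[0, T]`. -/
abbrev timeMeasure (T : ℝ) : Measure ℝ := volume.restrict (Icc 0 T)

/-- The maximal regularity space `MR(0, T) = C([0, T]; H) ∩ L²(0, T; V)`, with the norm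
`‖u‖ = ‖u‖_{C([0, T]; H)} + ‖u‖_{L²(0, T; V)}`: an element is a pair consisting of a continuous
function into `H` and a class in `L²(0, T; V)` that agree almost everywhere. -/
def MR (ι : V →L[ℝ] H) (T : ℝ) :
    Submodule ℝ (WithLp 1 (C(Icc (0 : ℝ) T, H) × Lp V 2 (timeMeasure T))) where
  carrier := {p | ∀ᵐ t ∂timeMeasure T, ∀ ht : t ∈ Icc (0 : ℝ) T, ι (p.snd t) = p.fst ⟨t, ht⟩}
  add_mem' := by
    intro p q hp hq
    filter_upwards [hp, hq, Lp.coeFn_add p.snd q.snd] with t h1 h2 h3 ht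
    have h4 : (p + q).snd t = p.snd t + q.snd t := h3
    rw [h4, map_add, h1 ht, h2 ht]
    rfl
  zero_mem' := by
    filter_upwards [Lp.coeFn_zero V 2 (timeMeasure T)] with t h3 ht
    have h4 : (0 : WithLp 1 (C(Icc (0 : ℝ) T, H) × Lp V 2 (timeMeasure T))).snd t = 0 := h3
    rw [h4, map_zero]
    rfl
  smul_mem' := by
    intro a p hp
    filter_upwards [hp, Lp.coeFn_smul a p.snd] with t h1 h3 ht
    have h4 : (a • p).snd t = a • p.snd t := h3
    rw [h4, map_smul, h1 ht]
    rfl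

variable {ι : V →L[ℝ] H} {T : ℝ}

/-- The continuous `H`-valued function of an element of `MR(0, T)`. -/
def contPart (u : MR ι T) : C(Icc (0 : ℝ) T, H) := u.1.fst

/-- The `V`-valued function of an element of `MR(0, T)`, defined for almost every time. -/
def l2Part (u : MR ι T) : Lp V 2 (timeMeasure T) := u.1.snd

theorem mr_norm_eq (u : MR ι T) : ‖u‖ = ‖contPart u‖ + ‖l2Part u‖ := by
  have h := WithLp.prod_norm_eq_of_nat (p := 1) 1 (by norm_num) u.1
  rw [pow_one, pow_one, Nat.cast_one, div_one, Real.rpow_one] at h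
  exact h

/-- `u ∈ MR(0, T)` is a strong solution to `u'(t) = -𝒜(t, u(t))`, `u(0) = x`: the function
`𝒜(·, u(·))` lies in `L²(0, T; V*) + L¹(0, T; H)` and
`u(t) = x - ∫₀ᵗ 𝒜(s, u(s)) ds` in `V*` for all `t ∈ [0, T]`. -/
structure IsStrongSolution (𝒜 : ℝ → V → StrongDual ℝ V) (x : H) (u : MR ι T) : Prop where
  mem_sum : ∃ (a : ℝ → StrongDual ℝ V) (b : ℝ → H),
    MemLp a 2 (timeMeasure T) ∧ MemLp b 1 (timeMeasure T) ∧
      ∀ᵐ s ∂timeMeasure T, 𝒜 s (l2Part u s) = a s + toDualV ι (b s)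
  eq_integral : ∀ t : Icc (0 : ℝ) T,
    toDualV ι (contPart u t) = toDualV ι x - ∫ s in (0 : ℝ)..t, 𝒜 s (l2Part u s)

end Gelfand

/-! ### The critical variational setting -/

section Setting

variable {V H U : Type*} [NormedAddCommGroup V] [InnerProductSpace ℝ V]
  [NormedAddCommGroup H] [InnerProductSpace ℝ H]
  [NormedAddCommGroup U] [InnerProductSpace ℝ U] [CompleteSpace U]

variable (V H U) in
/-- The data `A₀, B₀, F, G, f, g` of which the coefficients `A` and `B` consist. Only the values at
times `t ≥ 0` matter. -/
structure Coefficients where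
  A₀ : ℝ → H → V →L[ℝ] StrongDual ℝ V
  B₀ : ℝ → H → V →L[ℝ] HilbertSchmidt U H
  F : ℝ → V → StrongDual ℝ V
  G : ℝ → V → HilbertSchmidt U H
  f : ℝ → StrongDual ℝ V
  g : ℝ → HilbertSchmidt U H

namespace Coefficients

variable (c : Coefficients V H U) (ι : V →L[ℝ] H)

/-- `A(t, v) = A₀(t, v) v - F(t, v) - f(t)`. -/
def A (t : ℝ) (v : V) : StrongDual ℝ V := c.A₀ t (ι v) v - c.F t v - c.f t

/-- `B(t, v) = B₀(t, v) v + G(t, v) + g(t)`. -/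
def B (t : ℝ) (v : V) : HilbertSchmidt U H := c.B₀ t (ι v) v + c.G t v + c.g t

/-- The assumptions of the critical variational setting. The operator-valued maps `A₀` and `B₀` are
only required to be measurable after evaluation at each `v ∈ V`; this follows from Borel
measurability with respect to the operator norm. -/
structure IsCritical [MeasurableSpace V] [MeasurableSpace H] : Prop where
  measurable_A₀ : ∀ v : V, Measurable fun p : ℝ≥0 × H => c.A₀ p.1 p.2 v
  measurable_B₀ : ∀ v : V, Measurable fun p : ℝ≥0 × H => c.B₀ p.1 p.2 v
  measurable_F : Measurable fun p : ℝ≥0 × V => c.F p.1 p.2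
  measurable_G : Measurable fun p : ℝ≥0 × V => c.G p.1 p.2
  measurable_f : Measurable fun t : ℝ≥0 => c.f t
  measurable_g : Measurable fun t : ℝ≥0 => c.g t
  memLp_f : ∀ T : ℝ, 0 < T → MemLp c.f 2 (timeMeasure T)
  memLp_g : ∀ T : ℝ, 0 < T → MemLp c.g 2 (timeMeasure T)
  coercive₀ : ∀ T : ℝ, 0 < T → ∀ n : ℝ, 0 ≤ n → ∃ θ M : ℝ, 0 < θ ∧ 0 < M ∧
    ∀ t ∈ Icc (0 : ℝ) T, ∀ (u : H) (v : V), ‖u‖ ≤ n →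
      θ * ‖v‖ ^ 2 - M * ‖ι v‖ ^ 2 ≤ c.A₀ t u v v - 1 / 2 * ‖c.B₀ t u v‖ ^ 2
  growth : ∃ (mF mG : ℕ) (ρ β : ℕ → ℝ),
    (∀ j ∈ Finset.Icc 1 (mF + mG),
      0 ≤ ρ j ∧ 1 / 2 < β j ∧ β j < 1 ∧ 2 * β j ≤ 1 + 1 / (1 + ρ j)) ∧
    ∀ T : ℝ, 0 < T → ∀ n : ℝ, 0 ≤ n → ∃ C : ℝ,
      ∀ t ∈ Icc (0 : ℝ) T, ∀ u v w : V, ‖ι u‖ ≤ n → ‖ι v‖ ≤ n →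
        ‖c.A₀ t (ι u) w‖ ≤ C * (1 + ‖ι u‖) * ‖w‖ ∧
        ‖c.A₀ t (ι u) w - c.A₀ t (ι v) w‖ ≤ C * ‖ι u - ι v‖ * ‖w‖ ∧
        ‖c.B₀ t (ι u) w‖ ≤ C * (1 + ‖ι u‖) * ‖w‖ ∧
        ‖c.B₀ t (ι u) w - c.B₀ t (ι v) w‖ ≤ C * ‖ι u - ι v‖ * ‖w‖ ∧
        ‖c.F t u‖ ≤ C * ∑ j ∈ Finset.Icc 1 mF, (1 + normβ ι (β j) u ^ (ρ j + 1)) ∧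
        ‖c.F t u - c.F t v‖ ≤ C * ∑ j ∈ Finset.Icc 1 mF,
          (1 + normβ ι (β j) u ^ ρ j + normβ ι (β j) v ^ ρ j) * normβ ι (β j) (u - v) ∧
        ‖c.G t u‖ ≤ C * ∑ j ∈ Finset.Icc (mF + 1) (mF + mG),
          (1 + normβ ι (β j) u ^ (ρ j + 1)) ∧
        ‖c.G t u - c.G t v‖ ≤ C * ∑ j ∈ Finset.Icc (mF + 1) (mF + mG),
          (1 + normβ ι (β j) u ^ ρ j + normβ ι (β j) v ^ ρ j) * normβ ι (β j) (u - v)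

/-- Coercivity of the pair `(A, B)`. -/
def IsCoercive : Prop :=
  ∀ T : ℝ, 0 < T → ∃ (θ M : ℝ) (φ : ℝ → ℝ), 0 < θ ∧ 0 < M ∧ MemLp φ 2 (timeMeasure T) ∧
    ∀ (v : V), ∀ t ∈ Icc (0 : ℝ) T,
      θ * ‖v‖ ^ 2 - M * ‖ι v‖ ^ 2 - |φ t| ^ 2 ≤ c.A ι t v v - 1 / 2 * ‖c.B ι t v‖ ^ 2

variable {ι} {T : ℝ}

/-- `u` is a strong solution to the skeleton equation
`u'(t) = -A(t, u(t)) + B(t, u(t)) ψ(t)`, `u(0) = x`. -/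
def IsSkeletonSolution (x : H) (ψ : Lp U 2 (timeMeasure T)) (u : MR ι T) : Prop :=
  IsStrongSolution (fun t v => c.A ι t v - toDualV ι ((c.B ι t v).toCLM (ψ t))) x u

/-- The rate function `I(z) = 1/2 inf {∫₀ᵀ ‖ψ(s)‖² ds : z = u^ψ}`, with `inf ∅ = ∞`. -/
def rate (x : H) (z : MR ι T) : ℝ≥0∞ :=
  2⁻¹ * ⨅ (ψ : Lp U 2 (timeMeasure T)) (_ : c.IsSkeletonSolution x ψ z),
    ∫⁻ s, ‖ψ s‖ₑ ^ 2 ∂timeMeasure T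

end Coefficients

end Setting

end SkeletonEq

end

/-!
The space `V` is identified with its dual by Riesz, so that `V*` disappears: the embedding `H → V*`
becomes the adjoint `ι†` of `ι` (`emb`), the embedding `V → V*` becomes `ι† ι` (`gram`), and the
resolvents `(ι† ι + ε)⁻¹` regularize elements of `H` to elements of `V`. Elements of `MR(0, T)` are
represented by functions `ℝ → H` that are almost everywhere in the range of `ι`.

*The nonlinearities.* Interpolation enters only through
`‖v‖_β ≤ C ‖v‖_H ^ (2 - 2β) ‖v‖_V ^ (2β - 1)` (`exists_normβ_le`), which follows by decomposing `v`
with resolvents into pieces of dyadic frequency. With `2β ≤ 1 + 1 / (1 + ρ)` and Young's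
inequality it shows that, on balls of `H`, the nonlinearities `F` and `G` grow at most linearly in
`V`, and that their increments are bounded by
`ε ‖u - v‖_V + C_ε (1 + ‖u‖_V + ‖v‖_V) ‖u - v‖_H` for every `ε > 0` (`exists_coefficientBounds`).
For `u`, `v` in `L²(0, T; V)` the weight `1 + ‖u‖_V + ‖v‖_V` is square integrable, which is just
what Gronwall's inequality and the contraction argument need.

*Existence and uniqueness.* The energy identity (`energy_eq`) and Gronwall's inequality give the
maximal regularity estimate for linear equations (`IsLinSol.pnorm_le`). Linear equations are
solvable by duality: the data of primitives of functions in `L²(a, b; V)` are dense since the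
adjoint backward problem has only the zero solution (`eq_zero_of_orthogonal`), and the solvable
data form a closed set. For the skeleton equation, freezing `A₀` at a point of `V` close to the
initial value in `H` leaves a nonlinearity with a small Lipschitz constant in `V`, so that Banach's
theorem yields local solutions (`Nonlinearity.exists_local`). Two solutions with the same initial
value coincide by local monotonicity (`Nonlinearity.unique`). Coercivity bounds `‖u‖_{MR(0, T)}` by
a constant that depends on `ψ` only through its norm (`exists_apriori`), hence solutions are global
(`Nonlinearity.exists_global`, `exists_solutionMap`).

*Continuity.* Let `ψ_n → ψ` weakly in a ball, with solutions `u_n` and `u`. By local monotonicity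
`u_n - u` tends to zero in `MR(0, T)` as soon as `∫₀ᵗ (B(u)(ψ_n - ψ), u_n - u)` does so uniformly
in `t` (`exists_stability`). No compactness of `ι` is needed for this, since `B(s, u(s))` is
Hilbert-Schmidt: up to a small error in `L²(0, T)` it is of finite rank with values in `V`. The
integral then becomes a finite sum of integrals of products `a_n' q_n`, where
`a_n(t) = ∫₀ᵗ (h, B(u)(ψ_n - ψ))` tends to zero uniformly, and `q_n = (v, u_n - u)` with `v ∈ V` is
bounded and has derivatives bounded in `L¹(0, T)`; one integrates by parts
(`eventually_abs_integral_le`, `tendsto_solutionMap`).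

*The rate function.* The sublevel sets of `I` are intersections of images of balls of
`L²(0, T; U)` (`rate_le_iff`). The balls are weakly compact, so their images are compact
(`isCompact_rate_le`).
-/

set_option linter.unusedSectionVars false

noncomputable section

namespace SkeletonEq

/-! ### Resolvents of the Gelfand triple -/

section Resolvent

variable {V H : Type*} [NormedAddCommGroup V] [InnerProductSpace ℝ V] [CompleteSpace V]
  [NormedAddCommGroup H] [InnerProductSpace ℝ H] [CompleteSpace H] (ι : V →L[ℝ] H)

/-- The embedding `H → V*` read through the Riesz isomorphism `V* ≃ V`: the adjoint of `ι`. -/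
def emb : H →L[ℝ] V := ContinuousLinearMap.adjoint ι

/-- The embedding `V → V*` read through the Riesz isomorphism, i.e. `ι† ι`. Its inverse is the
operator `Λ` on `H` whose form is the inner product of `V`. -/
def gram : V →L[ℝ] V := (emb ι).comp ι

theorem inner_emb_left (h : H) (v : V) : inner ℝ (emb ι h) v = inner ℝ h (ι v) :=
  ContinuousLinearMap.adjoint_inner_left ι v h

theorem inner_emb_right (h : H) (v : V) : inner ℝ v (emb ι h) = inner ℝ (ι v) h :=
  ContinuousLinearMap.adjoint_inner_right ι v h

theorem gram_apply (v : V) : gram ι v = emb ι (ι v) := rfl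

theorem inner_gram_left (v w : V) : inner ℝ (gram ι v) w = inner ℝ (ι v) (ι w) :=
  inner_emb_left ι _ _

theorem inner_gram_right (v w : V) : inner ℝ v (gram ι w) = inner ℝ (ι v) (ι w) :=
  inner_emb_right ι _ _

theorem toDualV_eq_toDual_emb (h : H) :
    toDualV ι h = InnerProductSpace.toDual ℝ V (emb ι h) := by
  ext v
  rw [toDualV_apply, InnerProductSpace.toDual_apply_apply, inner_emb_left]

theorem emb_injective (hι' : DenseRange ι) : Function.Injective (emb ι) := by
  rw [injective_iff_map_eq_zero]
  intro h hh
  refine hι'.eq_zero_of_inner_left ℝ ?_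
  intro v
  rw [← inner_emb_left, hh, inner_zero_left]

theorem denseRange_gram (hι : Function.Injective ι) : DenseRange (gram ι) := by
  have h : (gram ι).range.topologicalClosure = ⊤ := by
    rw [Submodule.topologicalClosure_eq_top_iff, Submodule.eq_bot_iff]
    intro v hv
    have h1 := hv (gram ι v) ⟨v, rfl⟩
    rw [inner_gram_left, inner_self_eq_zero] at h1
    exact hι (by rw [h1, map_zero])
  exact (Submodule.dense_iff_topologicalClosure_eq_top.2 h)

/-- The resolvent `(ι† ι + ε)⁻¹` on `V`, for `ε > 0`; in general `Ring.inverse` takes the junk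
value `0` at operators that are not invertible. -/
def resolv (ε : ℝ) : V →L[ℝ] V := Ring.inverse (gram ι + ε • 1)

/-- The operator `ι† ι + ε` is coercive, hence invertible by the Lax-Milgram theorem. -/
theorem isUnit_gram_add {ε : ℝ} (hε : 0 < ε) : IsUnit (gram ι + ε • (1 : V →L[ℝ] V)) := by
  set B : V →L[ℝ] V →L[ℝ] ℝ := (innerSL ℝ).comp (gram ι + ε • (1 : V →L[ℝ] V)) with hB
  have hBa : ∀ v w, B v w = inner ℝ (gram ι v + ε • v) w := fun v w => rfl
  have hc : IsCoercive B := by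
    refine ⟨ε, hε, fun v => ?_⟩
    rw [hBa, inner_add_left, inner_gram_left, real_inner_smul_left, mul_assoc,
      ← real_inner_self_eq_norm_mul_norm]
    linarith [real_inner_self_nonneg (x := ι v)]
  have : gram ι + ε • (1 : V →L[ℝ] V) = (hc.continuousLinearEquivOfBilin : V →L[ℝ] V) := by
    ext v
    refine (hc.unique_continuousLinearEquivOfBilin (v := v) fun w => ?_)
    rfl
  rw [this]
  exact ⟨ContinuousLinearEquiv.toUnit hc.continuousLinearEquivOfBilin, rfl⟩

variable {ε : ℝ} (hε : 0 < ε)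
include hε

theorem gram_resolv_add (v : V) : gram ι (resolv ι ε v) + ε • resolv ι ε v = v := by
  have := Ring.mul_inverse_cancel _ (isUnit_gram_add ι hε)
  exact DFunLike.congr_fun this v

theorem resolv_gram_add (v : V) : resolv ι ε (gram ι v) + ε • resolv ι ε v = v := by
  have := DFunLike.congr_fun (Ring.inverse_mul_cancel _ (isUnit_gram_add ι hε)) v
  rw [← map_smul, ← map_add]
  exact this

theorem inner_resolv_comm (v w : V) :
    inner ℝ (resolv ι ε v) w = inner ℝ v (resolv ι ε w) := by
  conv_lhs => rw [← gram_resolv_add ι hε w]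
  conv_rhs => rw [← gram_resolv_add ι hε v]
  rw [inner_add_left, inner_add_right, inner_gram_left, inner_gram_right, real_inner_smul_left,
    real_inner_smul_right]

theorem norm_iota_resolv_emb_sq_add (h : H) :
    ‖ι (resolv ι ε (emb ι h))‖ ^ 2 + ε * ‖resolv ι ε (emb ι h)‖ ^ 2
      = inner ℝ h (ι (resolv ι ε (emb ι h))) := by
  rw [← inner_emb_left]
  set w := resolv ι ε (emb ι h)
  have : gram ι w + ε • w = emb ι h := gram_resolv_add ι hε (emb ι h)
  rw [← this, inner_add_left, inner_gram_left, real_inner_smul_left, real_inner_self_eq_norm_sq,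
    real_inner_self_eq_norm_sq]

theorem norm_iota_resolv_emb_le (h : H) : ‖ι (resolv ι ε (emb ι h))‖ ≤ ‖h‖ := by
  have h1 := norm_iota_resolv_emb_sq_add ι hε h
  have h2 := real_inner_le_norm h (ι (resolv ι ε (emb ι h)))
  by_contra! h3
  have h4 : 0 ≤ ε * ‖resolv ι ε (emb ι h)‖ ^ 2 := by positivity
  nlinarith [norm_nonneg h]

/-- The smoothing property of the resolvent: it maps `H` to `V` with norm at most `ε ^ (-1/2)`. -/
theorem norm_resolv_emb_le (h : H) : ε * ‖resolv ι ε (emb ι h)‖ ≤ √ε * ‖h‖ := by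
  have h1 := norm_iota_resolv_emb_sq_add ι hε h
  have h2 := real_inner_le_norm h (ι (resolv ι ε (emb ι h)))
  have h3 := norm_iota_resolv_emb_le ι hε h
  have h4 : ε * ‖resolv ι ε (emb ι h)‖ ^ 2 ≤ ‖h‖ ^ 2 := by nlinarith [norm_nonneg h]
  refine le_of_sq_le_sq ?_ (by positivity)
  rw [mul_pow, mul_pow, Real.sq_sqrt hε.le]
  nlinarith

theorem gram_sub_resolv_gram (v : V) :
    gram ι (v - resolv ι ε (gram ι v)) = ε • resolv ι ε (gram ι v) := by
  rw [map_sub, sub_eq_iff_eq_add', gram_resolv_add ι hε]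

theorem inner_resolv_gram_sub_nonneg (v : V) :
    0 ≤ inner ℝ (resolv ι ε (gram ι v)) (v - resolv ι ε (gram ι v)) := by
  have h := gram_sub_resolv_gram ι hε v
  have h1 : 0 ≤ inner ℝ (gram ι (v - resolv ι ε (gram ι v))) (v - resolv ι ε (gram ι v)) := by
    rw [inner_gram_left]; exact real_inner_self_nonneg
  rw [h, real_inner_smul_left] at h1
  exact nonneg_of_mul_nonneg_right h1 hε

theorem norm_resolv_gram_le (v : V) : ‖resolv ι ε (gram ι v)‖ ≤ ‖v‖ := by
  have h := inner_resolv_gram_sub_nonneg ι hε v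
  rw [inner_sub_right, real_inner_self_eq_norm_sq] at h
  have h7 := real_inner_le_norm (resolv ι ε (gram ι v)) v
  by_contra! h8
  nlinarith [norm_nonneg v]

theorem norm_sub_resolv_gram_le (v : V) : ‖v - resolv ι ε (gram ι v)‖ ≤ ‖v‖ := by
  have h := inner_resolv_gram_sub_nonneg ι hε v
  set d := v - resolv ι ε (gram ι v) with hd
  have h1 : resolv ι ε (gram ι v) = v - d := by rw [hd]; abel
  rw [h1, inner_sub_left, real_inner_self_eq_norm_sq] at h
  have h7 := real_inner_le_norm v d
  by_contra! h8
  nlinarith [norm_nonneg v]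

omit hε in
/-- Uniformly bounded operators that converge on a dense set converge everywhere. -/
theorem tendsto_of_dense_of_norm_le {E F : Type*} [NormedAddCommGroup E] [NormedSpace ℝ E]
    [NormedAddCommGroup F] [NormedSpace ℝ F] {A : ℕ → E →L[ℝ] F} {B : E →L[ℝ] F} {s : Set E}
    (hs : Dense s) {C : ℝ} (hA : ∀ n x, ‖A n x‖ ≤ C * ‖x‖)
    (h : ∀ x ∈ s, Filter.Tendsto (fun n => A n x) Filter.atTop (nhds (B x))) (x : E) :
    Filter.Tendsto (fun n => A n x) Filter.atTop (nhds (B x)) := by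
  rw [Metric.tendsto_atTop]
  intro δ hδ
  set K := max C 0 + ‖B‖ + 1 with hK
  have hK0 : 0 < K := by positivity
  obtain ⟨y, hy, hxy⟩ := hs.exists_dist_lt x (show 0 < δ / (2 * K) by positivity)
  obtain ⟨N, hN⟩ := Metric.tendsto_atTop.1 (h y hy) (δ / 2) (by positivity)
  refine ⟨N, fun n hn => ?_⟩
  rw [dist_eq_norm] at hxy ⊢
  have h1 := hN n hn
  rw [dist_eq_norm] at h1
  have h2 : A n x - B x = A n (x - y) - B (x - y) + (A n y - B y) := by
    simp only [map_sub]; abel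
  have h3 : ‖A n (x - y)‖ ≤ max C 0 * ‖x - y‖ :=
    (hA n _).trans (mul_le_mul_of_nonneg_right (le_max_left _ _) (norm_nonneg _))
  have h4 := B.le_opNorm (x - y)
  have h5 : ‖A n (x - y) - B (x - y)‖ ≤ K * ‖x - y‖ := by
    refine (norm_sub_le _ _).trans ?_
    rw [hK]
    nlinarith [norm_nonneg (x - y)]
  have h6 : K * ‖x - y‖ < δ / 2 := by
    calc K * ‖x - y‖ < K * (δ / (2 * K)) := by gcongr
      _ = δ / 2 := by field_simp
  rw [h2]
  linarith [norm_add_le (A n (x - y) - B (x - y)) (A n y - B y)]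

/-- A sequence of positive numbers that tends to `0`. -/
def epsSeq (n : ℕ) : ℝ := 1 / ((n : ℝ) + 1)

omit hε in
theorem epsSeq_pos (n : ℕ) : 0 < epsSeq n := by unfold epsSeq; positivity

omit hε in
theorem tendsto_resolv_gram (hι : Function.Injective ι) (v : V) :
    Filter.Tendsto (fun n => resolv ι (epsSeq n) (gram ι v)) Filter.atTop (nhds v) := by
  refine tendsto_of_dense_of_norm_le (A := fun n => (resolv ι (epsSeq n)).comp (gram ι)) (B := 1)
    (C := 1) (denseRange_gram ι hι) (fun n x => ?_) ?_ v
  · rw [one_mul]; exact norm_resolv_gram_le ι (epsSeq_pos n) x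
  rintro _ ⟨y, rfl⟩
  rw [tendsto_iff_norm_sub_tendsto_zero]
  have hlim : Filter.Tendsto (fun n => epsSeq n * ‖y‖) Filter.atTop (nhds 0) := by
    simpa [epsSeq] using (tendsto_one_div_add_atTop_nhds_zero_nat (𝕜 := ℝ)).mul_const ‖y‖
  refine squeeze_zero (fun _ => norm_nonneg _) (fun n => ?_) hlim
  have h := resolv_gram_add ι (epsSeq_pos n) (gram ι y)
  have h2 : resolv ι (epsSeq n) (gram ι (gram ι y)) - gram ι y
      = - (epsSeq n • resolv ι (epsSeq n) (gram ι y)) := by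
    rw [sub_eq_iff_eq_add, neg_add_eq_sub]
    exact eq_sub_of_add_eq h
  change ‖resolv ι (epsSeq n) (gram ι (gram ι y)) - gram ι y‖ ≤ _
  rw [h2, norm_neg, norm_smul, Real.norm_of_nonneg (epsSeq_pos n).le]
  exact mul_le_mul_of_nonneg_left (norm_resolv_gram_le ι (epsSeq_pos n) y) (epsSeq_pos n).le

omit hε in
theorem tendsto_iota_resolv_emb (hι : Function.Injective ι) (hι' : DenseRange ι) (h : H) :
    Filter.Tendsto (fun n => ι (resolv ι (epsSeq n) (emb ι h))) Filter.atTop (nhds h) := by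
  refine tendsto_of_dense_of_norm_le
    (A := fun n => ι.comp ((resolv ι (epsSeq n)).comp (emb ι))) (B := 1)
    (C := 1) hι' (fun n x => ?_) ?_ h
  · rw [one_mul]; exact norm_iota_resolv_emb_le ι (epsSeq_pos n) x
  rintro _ ⟨v, rfl⟩
  exact (ι.continuous.tendsto v).comp (tendsto_resolv_gram ι hι v)

end Resolvent

/-! ### The interpolation inequality -/

section InterpolationInequality

variable {X₀ X₁ : Type*} [NormedAddCommGroup X₀] [NormedSpace ℝ X₀]
  [NormedAddCommGroup X₁] [NormedSpace ℝ X₁]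

/-- `x` is the value at `θ` of an admissible function of norm at most `M`. -/
def HasAdmissible (k : X₁ →L[ℝ] X₀) (θ : ℝ) (x : X₁) (M : ℝ) : Prop :=
  ∃ (F₁ F₂ : ℂ → X₀) (G₁ G₂ : ℝ → X₁), IsAdmissible k F₁ F₂ G₁ G₂ M ∧ F₁ θ = k x ∧ F₂ θ = 0

theorem complexNorm_nonneg {X : Type*} [NormedAddCommGroup X] (x y : X) : 0 ≤ complexNorm x y :=
  Real.sqrt_nonneg _

theorem complexNorm_add_le {X : Type*} [NormedAddCommGroup X] (x y x' y' : X) :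
    complexNorm (x + x') (y + y') ≤ complexNorm x y + complexNorm x' y' := by
  have h : ∀ x y : X, complexNorm x y = ‖WithLp.toLp 2 (x, y)‖ := fun x y => by
    rw [WithLp.prod_norm_eq_of_L2]; rfl
  rw [h, h, h]
  exact norm_add_le (WithLp.toLp 2 (x, y)) (WithLp.toLp 2 (x', y'))

theorem complexNorm_smul {X : Type*} [NormedAddCommGroup X] [NormedSpace ℝ X] (c : ℂ) (x : X) :
    complexNorm (c.re • x) (c.im • x) = ‖c‖ * ‖x‖ := by
  rw [complexNorm, norm_smul, norm_smul, mul_pow, mul_pow, ← add_mul, Real.norm_eq_abs,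
    Real.norm_eq_abs, sq_abs, sq_abs, Real.sqrt_mul (by positivity), Real.sqrt_sq (norm_nonneg x),
    Complex.norm_eq_sqrt_sq_add_sq]

variable {k : X₁ →L[ℝ] X₀} {θ : ℝ}

theorem HasAdmissible.nonneg {x : X₁} {M : ℝ} (h : HasAdmissible k θ x M) : 0 ≤ M := by
  obtain ⟨F₁, F₂, G₁, G₂, h, -, -⟩ := h
  exact (complexNorm_nonneg _ _).trans (h.left_le 0)

theorem interpNorm_nonneg (x : X₁) : 0 ≤ interpNorm k θ x :=
  Real.sInf_nonneg fun _ h => HasAdmissible.nonneg h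

theorem HasAdmissible.interpNorm_le {x : X₁} {M : ℝ} (h : HasAdmissible k θ x M) :
    interpNorm k θ x ≤ M :=
  csInf_le ⟨0, fun _ h => HasAdmissible.nonneg h⟩ h

theorem HasAdmissible.mono {x : X₁} {M N : ℝ} (h : HasAdmissible k θ x M) (hMN : M ≤ N) :
    HasAdmissible k θ x N := by
  obtain ⟨F₁, F₂, G₁, G₂, h, h1, h2⟩ := h
  exact ⟨F₁, F₂, G₁, G₂, { h with
    left_le := fun t => (h.left_le t).trans hMN
    right_le := fun t => (h.right_le t).trans hMN }, h1, h2⟩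

theorem HasAdmissible.add {x y : X₁} {M N : ℝ} (hx : HasAdmissible k θ x M)
    (hy : HasAdmissible k θ y N) : HasAdmissible k θ (x + y) (M + N) := by
  obtain ⟨F₁, F₂, G₁, G₂, h, h1, h2⟩ := hx
  obtain ⟨F₁', F₂', G₁', G₂', h', h1', h2'⟩ := hy
  refine ⟨F₁ + F₁', F₂ + F₂', G₁ + G₁', G₂ + G₂', ⟨h.continuousOn₁.add h'.continuousOn₁,
    h.continuousOn₂.add h'.continuousOn₂, ?_, ?_, ?_, ?_, ?_,
    h.right_continuous₁.add h'.right_continuous₁, h.right_continuous₂.add h'.right_continuous₂,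
    ?_⟩, ?_, ?_⟩
  · obtain ⟨R, hR⟩ := h.bounded
    obtain ⟨R', hR'⟩ := h'.bounded
    exact ⟨R + R', fun z hz hz' =>
      (complexNorm_add_le _ _ _ _).trans (add_le_add (hR z hz hz') (hR' z hz hz'))⟩
  · intro z hz hz'
    obtain ⟨d₁, d₂, hd, hd'⟩ := h.holomorphic z hz hz'
    obtain ⟨e₁, e₂, he, he'⟩ := h'.holomorphic z hz hz'
    refine ⟨d₁ + e₁, d₂ + e₂, ?_, ?_⟩
    · convert! hd.add he using 1
      ext w; simp; abel
    · convert! hd'.add he' using 1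
      ext w; simp; abel
  · exact fun t => (complexNorm_add_le _ _ _ _).trans (add_le_add (h.left_le t) (h'.left_le t))
  · intro t
    simp only [Pi.add_apply, h.right_eq₁, h'.right_eq₁, map_add]
  · intro t
    simp only [Pi.add_apply, h.right_eq₂, h'.right_eq₂, map_add]
  · exact fun t => (complexNorm_add_le _ _ _ _).trans (add_le_add (h.right_le t) (h'.right_le t))
  · simp [h1, h1']
  · simp [h2, h2']

/-- The entire function `z ↦ s ^ (z - θ) k x` is admissible. -/
theorem hasAdmissible_single (hθ₀ : 0 ≤ θ) (hθ₁ : θ ≤ 1) {s : ℝ} (hs : 0 < s) {x : X₁} {m : ℝ}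
    (h₀ : ‖k x‖ ≤ m) (h₁ : s * ‖x‖ ≤ m) : HasAdmissible k θ x (s ^ (-θ) * m) := by
  set e : ℂ → ℂ := fun z => Complex.exp ((z - θ) * (Real.log s : ℝ)) with he
  have hec : Continuous e := by fun_prop
  have hen : ∀ z : ℂ, ‖e z‖ = Real.exp ((z.re - θ) * Real.log s) := by
    intro z
    rw [he]
    simp only [Complex.norm_exp, Complex.mul_re, Complex.sub_re, Complex.ofReal_re, Complex.sub_im,
      Complex.ofReal_im, mul_zero, sub_zero]
  have hed : ∀ z : ℂ, HasDerivAt e (e z * (Real.log s : ℝ)) z := by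
    intro z
    have := (((hasDerivAt_id z).sub_const (θ : ℂ)).mul_const ((Real.log s : ℝ) : ℂ)).cexp
    simpa [he] using this
  refine ⟨fun z => (e z).re • k x, fun z => (e z).im • k x, fun t => (e (1 + t * Complex.I)).re • x,
    fun t => (e (1 + t * Complex.I)).im • x, ⟨?_, ?_, ?_, ?_, ?_, ?_, ?_, ?_, ?_, ?_⟩, ?_, ?_⟩
  · exact Continuous.continuousOn (by fun_prop)
  · exact Continuous.continuousOn (by fun_prop)
  · refine ⟨Real.exp |Real.log s| * ‖k x‖, fun z hz hz' => ?_⟩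
    rw [complexNorm_smul, hen]
    refine mul_le_mul_of_nonneg_right (Real.exp_le_exp.2 ?_) (norm_nonneg _)
    refine (le_abs_self _).trans ?_
    rw [abs_mul]
    refine mul_le_of_le_one_left (abs_nonneg _) ?_
    rw [abs_le]
    constructor <;> linarith
  · intro z _ _
    refine ⟨(e z * (Real.log s : ℝ)).re • k x, (e z * (Real.log s : ℝ)).im • k x, ?_, ?_⟩
    · have h := (Complex.reCLM.hasFDerivAt.comp z
        ((hed z).hasFDerivAt.restrictScalars ℝ)).smul_const (k x)
      convert! h using 1
      ext w
      simp [smul_smul, ← sub_smul]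
    · have h := (Complex.imCLM.hasFDerivAt.comp z
        ((hed z).hasFDerivAt.restrictScalars ℝ)).smul_const (k x)
      convert! h using 1
      ext w
      simp [smul_smul, ← add_smul]
  · intro t
    rw [complexNorm_smul, hen]
    refine mul_le_mul (le_of_eq ?_) h₀ (norm_nonneg _) (by positivity)
    rw [Real.rpow_def_of_pos hs]
    simp [mul_comm]
  · intro t; simp
  · intro t; simp
  · fun_prop
  · fun_prop
  · intro t
    rw [complexNorm_smul, hen]
    have : Real.exp ((((1 : ℂ) + t * Complex.I).re - θ) * Real.log s) = s ^ (-θ) * s := by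
      rw [Real.rpow_def_of_pos hs]
      nth_rewrite 3 [← Real.exp_log hs]
      rw [← Real.exp_add]
      simp
      ring
    rw [this, mul_assoc]
    exact mul_le_mul_of_nonneg_left h₁ (by positivity)
  · simp [he]
  · simp [he]

end InterpolationInequality

section GelfandInterpolation

variable {V H : Type*} [NormedAddCommGroup V] [InnerProductSpace ℝ V] [CompleteSpace V]
  [NormedAddCommGroup H] [InnerProductSpace ℝ H] [CompleteSpace H] (ι : V →L[ℝ] H)

theorem norm_toDualV_iota (v : V) : ‖((toDualV ι).comp ι) v‖ = ‖gram ι v‖ := by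
  rw [ContinuousLinearMap.comp_apply, toDualV_eq_toDual_emb, LinearIsometryEquiv.norm_map]
  rfl

theorem normβ_nonneg (β : ℝ) (v : V) : 0 ≤ normβ ι β v := interpNorm_nonneg v

theorem norm_gram_resolv_gram {s : ℝ} (hs : 0 < s) (v : V) :
    s * ‖resolv ι s (gram ι v)‖ ≤ √s * ‖ι v‖ := norm_resolv_emb_le ι hs (ι v)

/-- The piece of `v` of frequency about `1 / s`. -/
theorem hasAdmissible_dyadic {β s : ℝ} (hβ : 1 / 2 < β) (hβ' : β < 1) (hs : 0 < s) (v : V) :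
    HasAdmissible ((toDualV ι).comp ι) β
      (resolv ι s (gram ι v) - resolv ι (2 * s) (gram ι v)) (s ^ (-β) * (3 * (√s * ‖ι v‖))) := by
  have h1 := norm_gram_resolv_gram ι hs v
  have h2 := norm_gram_resolv_gram ι (show 0 < 2 * s by positivity) v
  have h3 : √(2 * s) ≤ 2 * √s := by
    rw [Real.sqrt_le_left (by positivity), mul_pow, Real.sq_sqrt hs.le]
    linarith
  have h4 : √(2 * s) * ‖ι v‖ ≤ 2 * (√s * ‖ι v‖) := by
    rw [← mul_assoc]; exact mul_le_mul_of_nonneg_right h3 (norm_nonneg _)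
  refine hasAdmissible_single (by linarith) hβ'.le hs ?_ ?_
  · rw [norm_toDualV_iota, map_sub]
    have e1 : gram ι (resolv ι s (gram ι v)) = gram ι v - s • resolv ι s (gram ι v) :=
      eq_sub_of_add_eq (gram_resolv_add ι hs _)
    have e2 : gram ι (resolv ι (2 * s) (gram ι v))
        = gram ι v - (2 * s) • resolv ι (2 * s) (gram ι v) :=
      eq_sub_of_add_eq (gram_resolv_add ι (by positivity) _)
    rw [e1, e2, sub_sub_sub_cancel_left]
    refine (norm_sub_le _ _).trans ?_
    rw [norm_smul, norm_smul, Real.norm_of_nonneg hs.le, Real.norm_of_nonneg (by positivity)]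
    linarith
  · have h5 := norm_sub_le (resolv ι s (gram ι v)) (resolv ι (2 * s) (gram ι v))
    nlinarith [norm_nonneg (ι v), Real.sqrt_nonneg s]

/-- The interpolation inequality `‖v‖_β ≤ C ‖v‖_H ^ (2 - 2β) ‖v‖_V ^ (2β - 1)`. The vector `v` is
decomposed into pieces of dyadic frequency by means of the resolvents `J_s = (1 + s Λ)⁻¹`, starting
at the scale `s = ‖v‖_H² / ‖v‖_V²`. Each piece is estimated by a single exponential function. -/
theorem exists_normβ_le (hι : Function.Injective ι) {β : ℝ} (hβ : 1 / 2 < β) (hβ' : β < 1) :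
    ∃ C : ℝ, 0 ≤ C ∧ ∀ v : V,
      normβ ι β v ≤ C * (‖ι v‖ ^ (2 - 2 * β) * ‖v‖ ^ (2 * β - 1)) := by
  set q : ℝ := 2 ^ (1 / 2 - β) with hq
  have hq0 : 0 < q := by positivity
  have hq1 : q < 1 := Real.rpow_lt_one_of_one_lt_of_neg (by norm_num) (by linarith)
  refine ⟨1 + 3 * (1 - q)⁻¹ + 1, by have := sub_pos.2 hq1; positivity, fun v => ?_⟩
  have hβ0 : 0 ≤ β := by linarith
  rcases eq_or_ne v 0 with rfl | hv
  · refine (HasAdmissible.interpNorm_le (hasAdmissible_single (s := 1) (m := 0) hβ0 hβ'.le one_pos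
      (by simp) (by simp))).trans ?_
    rw [mul_zero]
    have := sub_pos.2 hq1; positivity
  set a := ‖ι v‖ with ha
  set b := ‖v‖ with hb
  have hb0 : 0 < b := norm_pos_iff.2 hv
  have ha0 : 0 < a := norm_pos_iff.2 fun h => hv (hι (by rw [h, map_zero]))
  set t : ℝ := a ^ 2 / b ^ 2 with ht
  have ht0 : 0 < t := by positivity
  -- `s ^ (-β) √s = s ^ (1/2 - β)`
  have hrp : ∀ s : ℝ, 0 < s → s ^ (-β) * √s = s ^ (1 / 2 - β) := by
    intro s hs
    rw [Real.sqrt_eq_rpow, ← Real.rpow_add hs]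
    congr 1; ring
  have hlow : ∀ N : ℕ, HasAdmissible ((toDualV ι).comp ι) β
      (resolv ι t (gram ι v) - resolv ι (2 ^ N * t) (gram ι v))
      (3 * a * t ^ (1 / 2 - β) * ∑ n ∈ Finset.range N, q ^ n) := by
    intro N
    induction N with
    | zero =>
      simp only [pow_zero, one_mul, sub_self, Finset.range_zero, Finset.sum_empty, mul_zero]
      have := hasAdmissible_single (k := (toDualV ι).comp ι) (x := 0) (s := 1) (m := 0) hβ0 hβ'.le
        one_pos (by simp) (by simp)
      simpa using this
    | succ N ih =>
      have hs : 0 < 2 ^ N * t := by positivity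
      have h := ih.add (hasAdmissible_dyadic ι hβ hβ' hs v)
      rw [sub_add_sub_cancel] at h
      have e1 : 2 * (2 ^ N * t) = 2 ^ (N + 1) * t := by ring
      rw [e1] at h
      refine h.mono (le_of_eq ?_)
      rw [Finset.sum_range_succ, mul_add]
      congr 1
      have e2 : (2 ^ N * t : ℝ) ^ (1 / 2 - β) = q ^ N * t ^ (1 / 2 - β) := by
        rw [Real.mul_rpow (by positivity) ht0.le, hq, ← Real.rpow_natCast, ← Real.rpow_natCast,
          ← Real.rpow_mul (by norm_num), ← Real.rpow_mul (by norm_num), mul_comm (N : ℝ)]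
      calc _ = 3 * a * ((2 ^ N * t : ℝ) ^ (-β) * √(2 ^ N * t)) := by ring
        _ = _ := by rw [hrp _ hs, e2]; ring
  -- the pieces of frequency below `1 / s` need not be separated once `‖emb ι‖² ≤ s`
  obtain ⟨N, hN⟩ : ∃ N : ℕ, ‖emb ι‖ ^ 2 / t < 2 ^ N := pow_unbounded_of_one_lt _ (by norm_num)
  set s : ℝ := 2 ^ N * t with hs
  have hs0 : 0 < s := by positivity
  have hle : ‖emb ι‖ ≤ √s := by
    refine Real.le_sqrt_of_sq_le ?_
    rw [div_lt_iff₀ ht0] at hN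
    exact hN.le
  have hlast : HasAdmissible ((toDualV ι).comp ι) β (resolv ι s (gram ι v))
      (s ^ (-β) * (√s * a)) := by
    refine hasAdmissible_single hβ0 hβ'.le hs0 ?_ (norm_gram_resolv_gram ι hs0 v)
    rw [norm_toDualV_iota, gram_apply]
    refine ((emb ι).le_opNorm _).trans ?_
    exact mul_le_mul hle (norm_iota_resolv_emb_le ι hs0 (ι v)) (norm_nonneg _) (by positivity)
  have hhigh : HasAdmissible ((toDualV ι).comp ι) β (v - resolv ι t (gram ι v))
      (t ^ (-β) * (t * b)) := by
    refine hasAdmissible_single hβ0 hβ'.le ht0 ?_ ?_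
    · rw [norm_toDualV_iota, gram_sub_resolv_gram ι ht0, norm_smul, Real.norm_of_nonneg ht0.le]
      exact mul_le_mul_of_nonneg_left (norm_resolv_gram_le ι ht0 v) ht0.le
    · exact mul_le_mul_of_nonneg_left (norm_sub_resolv_gram_le ι ht0 v) ht0.le
  have hall := (hhigh.add (hlow N)).add hlast
  rw [sub_add_sub_cancel, sub_add_cancel] at hall
  refine hall.interpNorm_le.trans ?_
  have hgeo : ∑ n ∈ Finset.range N, q ^ n ≤ (1 - q)⁻¹ := by
    rw [← tsum_geometric_of_lt_one hq0.le hq1]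
    exact (summable_geometric_of_lt_one hq0.le hq1).sum_le_tsum _ fun i _ => by positivity
  have hs1 : s ^ (1 / 2 - β) ≤ t ^ (1 / 2 - β) := by
    refine Real.rpow_le_rpow_of_nonpos ht0 ?_ (by linarith)
    exact le_mul_of_one_le_left ht0.le (one_le_pow₀ (by norm_num))
  have hta : a * t ^ (1 / 2 - β) = a ^ (2 - 2 * β) * b ^ (2 * β - 1) := by
    have e1 : t ^ (1 / 2 - β) = a ^ (1 - 2 * β) * b ^ (2 * β - 1) := by
      rw [ht, Real.div_rpow (by positivity) (by positivity), ← Real.rpow_natCast,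
        ← Real.rpow_natCast, ← Real.rpow_mul ha0.le, ← Real.rpow_mul hb0.le, div_eq_mul_inv,
        ← Real.rpow_neg hb0.le]
      push_cast
      congr 2 <;> ring
    rw [e1, ← mul_assoc]
    nth_rewrite 1 [← Real.rpow_one a]
    rw [← Real.rpow_add ha0]
    congr 2; ring
  have htb : t ^ (-β) * (t * b) = a * t ^ (1 / 2 - β) := by
    rw [← hrp t ht0, ht, Real.sqrt_div (by positivity), Real.sqrt_sq ha0.le, Real.sqrt_sq hb0.le]
    field_simp
  have hlast' : s ^ (-β) * (√s * a) ≤ a * t ^ (1 / 2 - β) := by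
    rw [← mul_assoc, hrp s hs0, mul_comm]
    exact mul_le_mul_of_nonneg_left hs1 ha0.le
  have hmid : 3 * a * t ^ (1 / 2 - β) * ∑ n ∈ Finset.range N, q ^ n
      ≤ 3 * a * t ^ (1 / 2 - β) * (1 - q)⁻¹ :=
    mul_le_mul_of_nonneg_left hgeo (by positivity)
  rw [← hta]
  linarith

end GelfandInterpolation

/-! ### Functions of the form `p + ∫ₐᵗ π` -/

section Calculus

open Filter Topology

theorem intervalIntegrable_of_restrict {E : Type*} [NormedAddCommGroup E] {f : ℝ → E}
    {a b c d : ℝ} (hf : Integrable f (volume.restrict (Icc a b))) (hc : c ∈ Icc a b)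
    (hd : d ∈ Icc a b) : IntervalIntegrable f volume c d := by
  rw [intervalIntegrable_iff]
  have h : IntegrableOn f (Icc a b) := hf
  exact h.mono_set (uIoc_subset_uIcc.trans (Set.uIcc_subset_Icc hc hd))

theorem absolutelyContinuousOnInterval_of_dist_le {X : Type*} [PseudoMetricSpace X] {f : ℝ → X}
    {P : ℝ → ℝ} {a b K : ℝ} (hP : AbsolutelyContinuousOnInterval P a b)
    (h : ∀ s ∈ uIcc a b, ∀ t ∈ uIcc a b, dist (f s) (f t) ≤ K * dist (P s) (P t)) :
    AbsolutelyContinuousOnInterval f a b := by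
  rw [absolutelyContinuousOnInterval_iff] at hP ⊢
  intro ε hε
  obtain ⟨δ, hδ, H⟩ := hP (ε / (|K| + 1)) (by positivity)
  refine ⟨δ, hδ, fun E hE hs => ?_⟩
  have h1 := H E hE hs
  have h2 : ∑ i ∈ Finset.range E.1, dist (f (E.2 i).1) (f (E.2 i).2)
      ≤ (|K| + 1) * ∑ i ∈ Finset.range E.1, dist (P (E.2 i).1) (P (E.2 i).2) := by
    rw [Finset.mul_sum]
    refine Finset.sum_le_sum fun i hi => ?_
    have h3 := hE.1 i hi
    refine (h _ h3.1 _ h3.2).trans ?_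
    refine mul_le_mul_of_nonneg_right ?_ dist_nonneg
    linarith [le_abs_self K]
  calc _ ≤ _ := h2
    _ < (|K| + 1) * (ε / (|K| + 1)) := by gcongr
    _ = ε := by field_simp

variable {E F : Type*} [NormedAddCommGroup E] [NormedSpace ℝ E]
  [NormedAddCommGroup F] [NormedSpace ℝ F]

theorem continuousOn_integral {f : ℝ → E} {a b : ℝ}
    (hf : Integrable f (volume.restrict (Icc a b))) :
    ContinuousOn (fun t => ∫ s in a..t, f s) (Icc a b) := by
  rcases le_or_gt a b with hab | hab
  · have h := intervalIntegral.continuousOn_primitive_interval' (μ := volume) (f := f)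
      (b₁ := a) (b₂ := b) (a := a)
      (intervalIntegrable_of_restrict hf (left_mem_Icc.2 hab) (right_mem_Icc.2 hab)) left_mem_uIcc
    rwa [uIcc_of_le hab] at h
  · rw [Icc_eq_empty hab.not_ge]; exact continuousOn_empty _

theorem norm_integral_sub_le {f : ℝ → E} {g : ℝ → ℝ} {a b s t : ℝ}
    (hf : Integrable f (volume.restrict (Icc a b))) (hg : Integrable g (volume.restrict (Icc a b)))
    (h : ∀ r, ‖f r‖ ≤ g r) (hs : s ∈ Icc a b) (ht : t ∈ Icc a b) :
    ‖(∫ r in a..s, f r) - ∫ r in a..t, f r‖ ≤ dist (∫ r in a..s, g r) (∫ r in a..t, g r) := by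
  have ha : a ∈ Icc a b := left_mem_Icc.2 (hs.1.trans hs.2)
  rw [intervalIntegral.integral_interval_sub_left (intervalIntegrable_of_restrict hf ha hs)
    (intervalIntegrable_of_restrict hf ha ht), Real.dist_eq,
    intervalIntegral.integral_interval_sub_left (intervalIntegrable_of_restrict hg ha hs)
    (intervalIntegrable_of_restrict hg ha ht)]
  exact intervalIntegral.norm_integral_le_abs_of_norm_le (ae_of_all _ h)
    (intervalIntegrable_of_restrict hg ht hs)

/-- The product rule for functions that are integrals of integrable functions. -/
theorem bilin_integral_eq [CompleteSpace E] [CompleteSpace F] (B : E →L[ℝ] F →L[ℝ] ℝ) {a b : ℝ}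
    (hab : a ≤ b) {π : ℝ → E} {κ : ℝ → F} (hπ : Integrable π (volume.restrict (Icc a b)))
    (hκ : Integrable κ (volume.restrict (Icc a b))) (p : E) (q : F) :
    B (p + ∫ s in a..b, π s) (q + ∫ s in a..b, κ s) = B p q
      + ∫ t in a..b, (B (π t) (q + ∫ s in a..t, κ s) + B (p + ∫ s in a..t, π s) (κ t)) := by
  have ha : a ∈ Icc a b := left_mem_Icc.2 hab
  have hb : b ∈ Icc a b := right_mem_Icc.2 hab
  have iπ := intervalIntegrable_of_restrict hπ ha hb
  have iκ := intervalIntegrable_of_restrict hκ ha hb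
  set P : ℝ → E := fun t => p + ∫ s in a..t, π s with hP
  set Q : ℝ → F := fun t => q + ∫ s in a..t, κ s with hQ
  set R : ℝ → ℝ := fun t => ∫ s in a..t, (‖π s‖ + ‖κ s‖) with hR
  have hPc : ContinuousOn P (Icc a b) := continuousOn_const.add (continuousOn_integral hπ)
  have hQc : ContinuousOn Q (Icc a b) := continuousOn_const.add (continuousOn_integral hκ)
  obtain ⟨CP, hCP⟩ := isCompact_Icc.exists_bound_of_continuousOn hPc
  obtain ⟨CQ, hCQ⟩ := isCompact_Icc.exists_bound_of_continuousOn hQc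
  have hRac : AbsolutelyContinuousOnInterval R a b :=
    (iπ.norm.add iκ.norm).absolutelyContinuousOnInterval_intervalIntegral left_mem_uIcc
  have hN : Integrable (fun s => ‖π s‖ + ‖κ s‖) (volume.restrict (Icc a b)) :=
    hπ.norm.add hκ.norm
  have hB0 : 0 ≤ ‖B‖ := norm_nonneg B
  have hPR : ∀ s ∈ Icc a b, ∀ t ∈ Icc a b, ‖P s - P t‖ ≤ dist (R s) (R t) := by
    intro s hs t ht
    simpa [hP] using norm_integral_sub_le hπ hN (fun s => by linarith [norm_nonneg (κ s)]) hs ht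
  have hQR : ∀ s ∈ Icc a b, ∀ t ∈ Icc a b, ‖Q s - Q t‖ ≤ dist (R s) (R t) := by
    intro s hs t ht
    simpa [hQ] using norm_integral_sub_le hκ hN (fun s => by linarith [norm_nonneg (π s)]) hs ht
  set φ : ℝ → ℝ := fun t => B (π t) (Q t) + B (P t) (κ t) with hφ
  have hQm : AEStronglyMeasurable Q (volume.restrict (Icc a b)) :=
    hQc.aestronglyMeasurable measurableSet_Icc
  have hPm : AEStronglyMeasurable P (volume.restrict (Icc a b)) :=
    hPc.aestronglyMeasurable measurableSet_Icc
  have hφi : Integrable φ (volume.restrict (Icc a b)) := by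
    refine Integrable.add ?_ ?_
    · refine Integrable.mono' (hπ.norm.const_mul (‖B‖ * CQ))
        (B.aestronglyMeasurable_comp₂ hπ.1 hQm) ?_
      filter_upwards [ae_restrict_mem measurableSet_Icc] with t ht
      refine (B.le_opNorm₂ _ _).trans ?_
      rw [mul_right_comm]
      exact mul_le_mul_of_nonneg_right (mul_le_mul_of_nonneg_left (hCQ t ht) hB0)
        (norm_nonneg _)
    · refine Integrable.mono' (hκ.norm.const_mul (‖B‖ * CP))
        (B.aestronglyMeasurable_comp₂ hPm hκ.1) ?_
      filter_upwards [ae_restrict_mem measurableSet_Icc] with t ht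
      refine (B.le_opNorm₂ _ _).trans ?_
      exact mul_le_mul_of_nonneg_right (mul_le_mul_of_nonneg_left (hCP t ht) hB0)
        (norm_nonneg _)
  have iφ := intervalIntegrable_of_restrict hφi ha hb
  have hac : AbsolutelyContinuousOnInterval (fun t => B (P t) (Q t)) a b := by
    refine absolutelyContinuousOnInterval_of_dist_le (K := ‖B‖ * (CP + CQ)) hRac ?_
    rw [uIcc_of_le hab]
    intro s hs t ht
    have e : B (P s) (Q s) - B (P t) (Q t) = B (P s) (Q s - Q t) + B (P s - P t) (Q t) := by
      simp only [map_sub, sub_apply]; ring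
    rw [dist_eq_norm, e]
    have h1 : ‖B (P s) (Q s - Q t)‖ ≤ ‖B‖ * CP * dist (R s) (R t) :=
      (B.le_opNorm₂ _ _).trans (mul_le_mul (mul_le_mul_of_nonneg_left (hCP s hs) hB0)
        (hQR s hs t ht) (norm_nonneg _)
        (mul_nonneg hB0 ((norm_nonneg _).trans (hCP s hs))))
    have h2 : ‖B (P s - P t) (Q t)‖ ≤ ‖B‖ * dist (R s) (R t) * CQ :=
      (B.le_opNorm₂ _ _).trans (mul_le_mul (mul_le_mul_of_nonneg_left (hPR s hs t ht)
        hB0) (hCQ t ht) (norm_nonneg _) (mul_nonneg hB0 dist_nonneg))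
    refine (norm_add_le _ _).trans ?_
    linarith
  have hac2 := hac.sub (iφ.absolutelyContinuousOnInterval_intervalIntegral
    (c := a) left_mem_uIcc)
  obtain ⟨C, hC⟩ := hac2.const_of_ae_hasDerivAt_zero (by
    filter_upwards [iπ.ae_hasDerivAt_integral, iκ.ae_hasDerivAt_integral,
      iφ.ae_hasDerivAt_integral] with t h1 h2 h3 ht
    have d1 : HasDerivAt P (π t) t := (h1 ht a left_mem_uIcc).const_add p
    have d2 : HasDerivAt Q (κ t) t := (h2 ht a left_mem_uIcc).const_add q
    have d3 := h3 ht a left_mem_uIcc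
    have d4 : HasDerivAt (fun t => B (P t) (Q t)) (φ t) t := by
      have := B.hasFDerivAt_of_bilinear d1.hasFDerivAt d2.hasFDerivAt
      have h5 := this.hasDerivAt
      simpa [hφ, add_comm] using h5
    simpa using d4.sub d3)
  have e1 := hC a left_mem_uIcc
  have e2 := hC b right_mem_uIcc
  simp only [Pi.sub_apply, intervalIntegral.integral_same, sub_zero] at e1 e2
  rw [← e1] at e2
  have e3 : P a = p := by simp [hP]
  have e4 : Q a = q := by simp [hQ]
  rw [e3, e4] at e2
  linarith

/-- Gronwall's inequality with an integrable weight. -/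
theorem gronwall_integral {Y ρ : ℝ → ℝ} {a b c : ℝ} (hab : a ≤ b)
    (hρ : Integrable ρ (volume.restrict (Icc a b))) (hρ0 : ∀ t ∈ Icc a b, 0 ≤ ρ t)
    (hY : ContinuousOn Y (Icc a b))
    (h : ∀ t ∈ Icc a b, Y t ≤ c + ∫ s in a..t, ρ s * Y s) :
    Y b ≤ c * Real.exp (∫ s in a..b, ρ s) := by
  have ha : a ∈ Icc a b := left_mem_Icc.2 hab
  have hb : b ∈ Icc a b := right_mem_Icc.2 hab
  have iρ := intervalIntegrable_of_restrict hρ ha hb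
  obtain ⟨C, hC⟩ := isCompact_Icc.exists_bound_of_continuousOn hY
  have hρY : Integrable (fun s => ρ s * Y s) (volume.restrict (Icc a b)) := by
    refine Integrable.mono' (hρ.norm.const_mul C)
      (hρ.1.mul (hY.aestronglyMeasurable measurableSet_Icc)) ?_
    filter_upwards [ae_restrict_mem measurableSet_Icc] with t ht
    rw [norm_mul, mul_comm]
    exact mul_le_mul_of_nonneg_right (hC t ht) (norm_nonneg _)
  have iρY := intervalIntegrable_of_restrict hρY ha hb
  set P : ℝ → ℝ := fun t => ∫ s in a..t, ρ s with hP
  set Z : ℝ → ℝ := fun t => ∫ s in a..t, ρ s * Y s with hZ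
  have hP0 : ∀ t ∈ Icc a b, 0 ≤ P t := fun t ht =>
    intervalIntegral.integral_nonneg ht.1 fun s hs => hρ0 s ⟨hs.1, hs.2.trans ht.2⟩
  have hPac : AbsolutelyContinuousOnInterval P a b :=
    iρ.absolutelyContinuousOnInterval_intervalIntegral left_mem_uIcc
  have hZac : AbsolutelyContinuousOnInterval (fun t => c + Z t) a b := by
    refine absolutelyContinuousOnInterval_of_dist_le (K := 1)
      (iρY.absolutelyContinuousOnInterval_intervalIntegral (c := a) left_mem_uIcc) ?_
    intro s _ t _
    rw [one_mul, dist_add_left]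
  have hEac : AbsolutelyContinuousOnInterval (fun t => Real.exp (-P t)) a b := by
    refine absolutelyContinuousOnInterval_of_dist_le (K := 1) hPac ?_
    rw [uIcc_of_le hab]
    have key : ∀ x y : ℝ, 0 ≤ x → x ≤ y → Real.exp (-x) - Real.exp (-y) ≤ y - x := by
      intro x y hx hxy
      have h1 := Real.add_one_le_exp (-(y - x))
      have h2 : Real.exp (-x) ≤ 1 := Real.exp_le_one_iff.2 (by linarith)
      have h3 : Real.exp (-y) = Real.exp (-x) * Real.exp (-(y - x)) := by
        rw [← Real.exp_add]; ring_nf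
      rw [h3]
      nlinarith [Real.exp_pos (-x)]
    intro s hs t ht
    rw [one_mul, Real.dist_eq, Real.dist_eq]
    rcases le_total (P s) (P t) with hle | hle
    · rw [abs_of_nonneg (sub_nonneg.2 (Real.exp_le_exp.2 (by linarith))),
        abs_of_nonpos (by linarith)]
      linarith [key _ _ (hP0 s hs) hle]
    · rw [abs_of_nonpos (sub_nonpos.2 (Real.exp_le_exp.2 (by linarith))),
        abs_of_nonneg (by linarith)]
      linarith [key _ _ (hP0 t ht) hle]
  have hint := (hZac.fun_mul hEac).integral_deriv_eq_sub
  have hle : ∫ t in a..b, deriv (fun t => (c + Z t) * Real.exp (-P t)) t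
      ≤ ∫ t in a..b, (0 : ℝ) := by
    refine intervalIntegral.integral_mono_ae_restrict hab
      (hZac.fun_mul hEac).intervalIntegrable_deriv (by simp) ?_
    have h1 := iρ.ae_hasDerivAt_integral
    have h2 := iρY.ae_hasDerivAt_integral
    filter_upwards [ae_restrict_of_ae h1, ae_restrict_of_ae h2, ae_restrict_mem measurableSet_Icc]
      with t h1 h2 ht
    rw [uIcc_of_le hab] at h1 h2
    have d1 : HasDerivAt P (ρ t) t := h1 ht a ha
    have d2 : HasDerivAt Z (ρ t * Y t) t := h2 ht a ha
    have d3 := ((d2.const_add c).mul d1.neg.exp).deriv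
    have e : (fun t => (c + Z t) * Real.exp (-P t))
      = ((fun x => c + Z x) * fun x => Real.exp ((-P) x)) := rfl
    rw [e, d3]
    have h4 := h t ht
    have h5 := hρ0 t ht
    simp only [Pi.neg_apply]
    have : ρ t * Y t * Real.exp (-P t) ≤ ρ t * (c + Z t) * Real.exp (-P t) := by gcongr
    linarith
  rw [hint] at hle
  simp only [intervalIntegral.integral_zero] at hle
  have hZa : Z a = 0 := by simp [hZ]
  have hPa : P a = 0 := by simp [hP]
  rw [hZa, hPa] at hle
  simp only [add_zero, neg_zero, Real.exp_zero, mul_one, sub_nonpos] at hle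
  have hYb := h b hb
  have : (c + Z b) ≤ c * Real.exp (P b) := by
    rw [Real.exp_neg] at hle
    rwa [← div_eq_mul_inv, div_le_iff₀ (Real.exp_pos _)] at hle
  exact hYb.trans this

/-- Gronwall's inequality for an energy `y` with dissipation `z`. -/
theorem gronwall_energy {y z ρ : ℝ → ℝ} {a b c : ℝ} (hab : a ≤ b)
    (hρ : Integrable ρ (volume.restrict (Icc a b))) (hρ0 : ∀ t ∈ Icc a b, 0 ≤ ρ t)
    (hy : ContinuousOn y (Icc a b))
    (hz0 : ∀ t ∈ Icc a b, 0 ≤ ∫ s in a..t, z s)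
    (h : ∀ t ∈ Icc a b, y t + ∫ s in a..t, z s ≤ c + ∫ s in a..t, ρ s * y s) :
    y b + ∫ s in a..b, z s ≤ c * Real.exp (∫ s in a..b, ρ s) := by
  have ha : a ∈ Icc a b := left_mem_Icc.2 hab
  have hb : b ∈ Icc a b := right_mem_Icc.2 hab
  obtain ⟨C, hC⟩ := isCompact_Icc.exists_bound_of_continuousOn hy
  have hρy : Integrable (fun s => ρ s * y s) (volume.restrict (Icc a b)) := by
    refine Integrable.mono' (hρ.norm.const_mul C)
      (hρ.1.mul (hy.aestronglyMeasurable measurableSet_Icc)) ?_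
    filter_upwards [ae_restrict_mem measurableSet_Icc] with t ht
    rw [norm_mul, mul_comm]
    exact mul_le_mul_of_nonneg_right (hC t ht) (norm_nonneg _)
  set Y : ℝ → ℝ := fun t => c + ∫ s in a..t, ρ s * y s with hY
  have hYc : ContinuousOn Y (Icc a b) := continuousOn_const.add (continuousOn_integral hρy)
  obtain ⟨C', hC'⟩ := isCompact_Icc.exists_bound_of_continuousOn hYc
  have hρY : Integrable (fun s => ρ s * Y s) (volume.restrict (Icc a b)) := by
    refine Integrable.mono' (hρ.norm.const_mul C')
      (hρ.1.mul (hYc.aestronglyMeasurable measurableSet_Icc)) ?_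
    filter_upwards [ae_restrict_mem measurableSet_Icc] with t ht
    rw [norm_mul, mul_comm]
    exact mul_le_mul_of_nonneg_right (hC' t ht) (norm_nonneg _)
  refine (h b hb).trans (gronwall_integral (Y := Y) hab hρ hρ0 hYc fun t ht => ?_)
  refine add_le_add_right ?_ c
  refine intervalIntegral.integral_mono_on ht.1 (intervalIntegrable_of_restrict hρy ha ht)
    (intervalIntegrable_of_restrict hρY ha ht) fun s hs => ?_
  have hs' : s ∈ Icc a b := ⟨hs.1, hs.2.trans ht.2⟩
  exact mul_le_mul_of_nonneg_left (by linarith [h s hs', hz0 s hs']) (hρ0 s hs')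

end Calculus

/-! ### The energy identity -/

section Energy

open Filter Topology

variable {V H : Type*} [NormedAddCommGroup V] [InnerProductSpace ℝ V] [CompleteSpace V]
  [NormedAddCommGroup H] [InnerProductSpace ℝ H] [CompleteSpace H] (ι : V →L[ℝ] H)

theorem integrable_inner_of_memLp {E : Type*} [NormedAddCommGroup E] [InnerProductSpace ℝ E]
    {μ : Measure ℝ} {f g : ℝ → E} (hf : MemLp f 2 μ) (hg : MemLp g 2 μ) :
    Integrable (fun t => inner ℝ (f t) (g t)) μ := by
  have h := hf.norm.integrable_mul hg.norm
  refine Integrable.mono' h (hf.1.inner hg.1) (ae_of_all _ fun t => ?_)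
  exact norm_inner_le_norm _ _

theorem integrable_of_memLp_two {E : Type*} [NormedAddCommGroup E] {a b : ℝ} {f : ℝ → E}
    (hf : MemLp f 2 (volume.restrict (Icc a b))) : Integrable f (volume.restrict (Icc a b)) :=
  hf.integrable (by norm_num)

/-- The energy identity (the Lions-Magenes lemma). The equation for `u = ι v` is tested with
`(ι† ι + ε)⁻¹ ι† u`, which converges to `v` in `V` and to `u` in `H` as `ε → 0`. The values of `u`
are needed at the end points only. -/
theorem energy_eq (hι : Function.Injective ι) (hι' : DenseRange ι) {a b : ℝ} (hab : a ≤ b)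
    {v α : ℝ → V} {β : ℝ → H} {ua ub : H}
    (hα : MemLp α 2 (volume.restrict (Icc a b))) (hv : MemLp v 2 (volume.restrict (Icc a b)))
    (hβ : Integrable β (volume.restrict (Icc a b)))
    (hβv : Integrable (fun t => ‖β t‖ * ‖ι (v t)‖) (volume.restrict (Icc a b)))
    (hp : ∀ᵐ t ∂volume.restrict (Icc a b),
      gram ι (v t) = emb ι ua + ∫ s in a..t, (α s + emb ι (β s)))
    (hb : emb ι ub = emb ι ua + ∫ s in a..b, (α s + emb ι (β s))) :
    ‖ub‖ ^ 2 = ‖ua‖ ^ 2 + 2 * ∫ t in a..b, (inner ℝ (α t) (v t) + inner ℝ (β t) (ι (v t))) := by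
  set μ := volume.restrict (Icc a b) with hμ
  have hπ : Integrable (fun s => α s + emb ι (β s)) μ :=
    (integrable_of_memLp_two hα).add ((emb ι).integrable_comp hβ)
  have hres : ∀ (f : ℝ → ℝ), ∫ t in a..b, f t = ∫ t, f t ∂μ := fun f => by
    rw [intervalIntegral.integral_of_le hab, integral_Icc_eq_integral_Ioc]
  set P : ℝ → V := fun t => emb ι ua + ∫ s in a..t, (α s + emb ι (β s)) with hP
  have hstep : ∀ n : ℕ, inner ℝ ub (ι (resolv ι (epsSeq n) (emb ι ub)))
      = inner ℝ ua (ι (resolv ι (epsSeq n) (emb ι ua)))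
        + 2 * ∫ t, (inner ℝ (α t) (resolv ι (epsSeq n) (gram ι (v t)))
          + inner ℝ (β t) (ι (resolv ι (epsSeq n) (gram ι (v t))))) ∂μ := by
    intro n
    set R := resolv ι (epsSeq n) with hR
    have h := bilin_integral_eq ((innerSL ℝ).flip.comp R).flip hab hπ hπ (emb ι ua) (emb ι ua)
    have hB : ∀ x y : V, ((innerSL ℝ).flip.comp R).flip x y = inner ℝ x (R y) := fun _ _ => rfl
    simp only [hB] at h
    rw [← hb, inner_emb_left, inner_emb_left, hres] at h
    rw [h, ← integral_const_mul]
    congr 1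
    refine integral_congr_ae ?_
    filter_upwards [hp] with t ht
    have e : inner ℝ (P t) (R (α t + emb ι (β t))) = inner ℝ (α t + emb ι (β t)) (R (P t)) := by
      rw [real_inner_comm, inner_resolv_comm ι (epsSeq_pos n)]
    change inner ℝ (α t + emb ι (β t)) (R (P t)) + inner ℝ (P t) (R (α t + emb ι (β t))) = _
    rw [e, hP]
    dsimp only
    rw [← ht, inner_add_left, inner_emb_left]
    ring
  have hlim : Tendsto (fun n => ∫ t, (inner ℝ (α t) (resolv ι (epsSeq n) (gram ι (v t)))
          + inner ℝ (β t) (ι (resolv ι (epsSeq n) (gram ι (v t))))) ∂μ) atTop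
      (𝓝 (∫ t, (inner ℝ (α t) (v t) + inner ℝ (β t) (ι (v t))) ∂μ)) := by
    have hαv : Integrable (fun t => ‖α t‖ * ‖v t‖) μ := hα.norm.integrable_mul hv.norm
    refine tendsto_integral_of_dominated_convergence (fun t => ‖α t‖ * ‖v t‖ + ‖β t‖ * ‖ι (v t)‖)
      (fun n => ?_) (hαv.add hβv) (fun n => ae_of_all _ fun t => ?_) (ae_of_all _ fun t => ?_)
    · have h1 : AEStronglyMeasurable (fun t => resolv ι (epsSeq n) (gram ι (v t))) μ :=
        ((resolv ι (epsSeq n)).comp (gram ι)).continuous.comp_aestronglyMeasurable hv.1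
      exact (hα.1.inner h1).add (hβ.1.inner (ι.continuous.comp_aestronglyMeasurable h1))
    · refine (norm_add_le _ _).trans (add_le_add ?_ ?_)
      · refine (norm_inner_le_norm _ _).trans (mul_le_mul_of_nonneg_left ?_ (norm_nonneg _))
        exact norm_resolv_gram_le ι (epsSeq_pos n) _
      · refine (norm_inner_le_norm _ _).trans (mul_le_mul_of_nonneg_left ?_ (norm_nonneg _))
        exact norm_iota_resolv_emb_le ι (epsSeq_pos n) _
    · have h1 := tendsto_resolv_gram ι hι (v t)
      exact (tendsto_const_nhds.inner h1).add
        (tendsto_const_nhds.inner ((ι.continuous.tendsto _).comp h1))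
  have h1 : Tendsto (fun n => inner ℝ ub (ι (resolv ι (epsSeq n) (emb ι ub)))) atTop
      (𝓝 (‖ub‖ ^ 2)) := by
    rw [← real_inner_self_eq_norm_sq]
    exact tendsto_const_nhds.inner (tendsto_iota_resolv_emb ι hι hι' ub)
  have h2 : Tendsto (fun n => inner ℝ ua (ι (resolv ι (epsSeq n) (emb ι ua)))) atTop
      (𝓝 (‖ua‖ ^ 2)) := by
    rw [← real_inner_self_eq_norm_sq]
    exact tendsto_const_nhds.inner (tendsto_iota_resolv_emb ι hι hι' ua)
  rw [hres]
  refine tendsto_nhds_unique h1 ?_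
  simp only [hstep]
  exact h2.add (hlim.const_mul 2)

end Energy

/-! ### Paths in the maximal regularity space -/

section Paths

open Filter Topology

variable {V H : Type*} [NormedAddCommGroup V] [InnerProductSpace ℝ V] [CompleteSpace V]
  [NormedAddCommGroup H] [InnerProductSpace ℝ H] [CompleteSpace H] (ι : V →L[ℝ] H)

/-- Lebesgue measure on `[a, b]`. -/
abbrev segMeasure (a b : ℝ) : Measure ℝ := volume.restrict (Icc a b)

/-- The preimage in `V` of an element of `H`, with a junk value outside of the range of `ι`. -/
def lift (h : H) : V := Function.invFun ι h

theorem lift_iota (hι : Function.Injective ι) (v : V) : lift ι (ι v) = v :=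
  Function.leftInverse_invFun hι v

theorem iota_lift {h : H} (hh : h ∈ range ι) : ι (lift ι h) = h :=
  Function.invFun_eq hh

/-- `u` represents an element of `C([a, b]; H) ∩ L²(a, b; V)`. The `V`-valued function is
`t ↦ ι⁻¹ u(t)`, so that a path is determined by its values in `H`. -/
structure IsPath (a b : ℝ) (u : ℝ → H) : Prop where
  cont : ContinuousOn u (Icc a b)
  mem_range : ∀ᵐ t ∂segMeasure a b, u t ∈ range ι
  memLp : MemLp (fun t => lift ι (u t)) 2 (segMeasure a b)

/-- `u` is a path with `u' = α + β` in `V*`. -/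
structure IsSol (a b : ℝ) (α : ℝ → V) (β : ℝ → H) (u : ℝ → H) : Prop extends IsPath ι a b u where
  eq : ∀ t ∈ Icc a b, emb ι (u t) = emb ι (u a) + ∫ s in a..t, (α s + emb ι (β s))

variable {ι} {a b : ℝ}

theorem IsPath.ae_eq {u : ℝ → H} (h : IsPath ι a b u) :
    ∀ᵐ t ∂segMeasure a b, ι (lift ι (u t)) = u t := by
  filter_upwards [h.mem_range] with t ht using iota_lift ι ht

/-- A continuous function with values in `H` that agrees almost everywhere with a function in
`L²(a, b; V)` is a path. -/
theorem isPath_of_ae_eq (hι : Function.Injective ι) {u : ℝ → H} {v : ℝ → V}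
    (hu : ContinuousOn u (Icc a b)) (hv : MemLp v 2 (segMeasure a b))
    (h : ∀ᵐ t ∂segMeasure a b, ι (v t) = u t) :
    IsPath ι a b u ∧ ∀ᵐ t ∂segMeasure a b, lift ι (u t) = v t := by
  have h1 : ∀ᵐ t ∂segMeasure a b, lift ι (u t) = v t := by
    filter_upwards [h] with t ht
    rw [← ht, lift_iota ι hι]
  refine ⟨⟨hu, ?_, ?_⟩, h1⟩
  · filter_upwards [h] with t ht using ⟨_, ht⟩
  · exact (memLp_congr_ae h1).2 hv

theorem IsPath.mono {u : ℝ → H} (h : IsPath ι a b u) {c d : ℝ} (hc : a ≤ c) (hd : d ≤ b) :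
    IsPath ι c d u := by
  have hsub : Icc c d ⊆ Icc a b := Icc_subset_Icc hc hd
  have hle : segMeasure c d ≤ segMeasure a b := Measure.restrict_mono hsub le_rfl
  exact ⟨h.cont.mono hsub, ae_mono hle h.mem_range, h.memLp.mono_measure hle⟩

theorem IsPath.linear (hι : Function.Injective ι) {u w : ℝ → H} (hu : IsPath ι a b u)
    (hw : IsPath ι a b w) (c d : ℝ) :
    IsPath ι a b (fun t => c • u t + d • w t) ∧
      ∀ᵐ t ∂segMeasure a b, lift ι (c • u t + d • w t) = c • lift ι (u t) + d • lift ι (w t) := by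
  refine isPath_of_ae_eq hι ((hu.cont.const_smul c).add (hw.cont.const_smul d))
    ((hu.memLp.const_smul c).add (hw.memLp.const_smul d)) ?_
  filter_upwards [hu.ae_eq, hw.ae_eq] with t h1 h2
  simp only [map_add, map_smul, h1, h2]

theorem IsPath.sub (hι : Function.Injective ι) {u w : ℝ → H} (hu : IsPath ι a b u)
    (hw : IsPath ι a b w) :
    IsPath ι a b (fun t => u t - w t) ∧
      ∀ᵐ t ∂segMeasure a b, lift ι (u t - w t) = lift ι (u t) - lift ι (w t) := by
  simpa [← sub_eq_add_neg] using hu.linear hι hw 1 (-1)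

theorem integrable_source {α : ℝ → V} {β : ℝ → H} (hα : MemLp α 2 (segMeasure a b))
    (hβ : Integrable β (segMeasure a b)) :
    Integrable (fun s => α s + emb ι (β s)) (segMeasure a b) :=
  (integrable_of_memLp_two hα).add ((emb ι).integrable_comp hβ)

theorem IsSol.linear (hι : Function.Injective ι) {u w : ℝ → H} {α α' : ℝ → V} {β β' : ℝ → H}
    (hu : IsSol ι a b α β u) (hw : IsSol ι a b α' β' w)
    (hα : MemLp α 2 (segMeasure a b)) (hβ : Integrable β (segMeasure a b))
    (hα' : MemLp α' 2 (segMeasure a b)) (hβ' : Integrable β' (segMeasure a b)) (c d : ℝ) :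
    IsSol ι a b (fun t => c • α t + d • α' t) (fun t => c • β t + d • β' t)
      (fun t => c • u t + d • w t) := by
  refine ⟨(hu.toIsPath.linear hι hw.toIsPath c d).1, fun t ht => ?_⟩
  have ha : a ∈ Icc a b := left_mem_Icc.2 (ht.1.trans ht.2)
  have i1 := intervalIntegrable_of_restrict (integrable_source (ι := ι) hα hβ) ha ht
  have i2 := intervalIntegrable_of_restrict (integrable_source (ι := ι) hα' hβ') ha ht
  have e : ∀ s, c • α s + d • α' s + emb ι (c • β s + d • β' s)
      = c • (α s + emb ι (β s)) + d • (α' s + emb ι (β' s)) := by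
    intro s
    simp only [map_add, map_smul, smul_add]
    abel
  rw [intervalIntegral.integral_congr (fun s _ => e s), map_add, map_smul, map_smul]
  have i1' : IntervalIntegrable (fun s => c • (α s + emb ι (β s))) volume a t := i1.smul c
  have i2' : IntervalIntegrable (fun s => d • (α' s + emb ι (β' s))) volume a t := i2.smul d
  rw [intervalIntegral.integral_add i1' i2', intervalIntegral.integral_smul,
    intervalIntegral.integral_smul, hu.eq t ht, hw.eq t ht]
  simp only [map_add, map_smul, smul_add]
  abel

theorem IsSol.sub (hι : Function.Injective ι) {u w : ℝ → H} {α α' : ℝ → V} {β β' : ℝ → H}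
    (hu : IsSol ι a b α β u) (hw : IsSol ι a b α' β' w)
    (hα : MemLp α 2 (segMeasure a b)) (hβ : Integrable β (segMeasure a b))
    (hα' : MemLp α' 2 (segMeasure a b)) (hβ' : Integrable β' (segMeasure a b)) :
    IsSol ι a b (fun t => α t - α' t) (fun t => β t - β' t) (fun t => u t - w t) := by
  simpa [← sub_eq_add_neg] using hu.linear hι hw hα hβ hα' hβ' 1 (-1)

theorem IsSol.congr {u : ℝ → H} {α α' : ℝ → V} {β β' : ℝ → H}
    (hu : IsSol ι a b α β u)
    (h : ∀ᵐ t ∂segMeasure a b, α t + emb ι (β t) = α' t + emb ι (β' t)) :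
    IsSol ι a b α' β' u := by
  refine ⟨hu.toIsPath, fun t ht => ?_⟩
  rw [hu.eq t ht]
  congr 1
  refine intervalIntegral.integral_congr_ae ?_
  have h2 := (ae_restrict_iff' measurableSet_Icc).1 h
  filter_upwards [h2] with s hs hs2
  rw [uIoc_of_le ht.1] at hs2
  exact hs ⟨hs2.1.le, hs2.2.trans ht.2⟩

theorem IsSol.eq_sub {u : ℝ → H} {α : ℝ → V} {β : ℝ → H} (hu : IsSol ι a b α β u)
    (hα : MemLp α 2 (segMeasure a b)) (hβ : Integrable β (segMeasure a b))
    {s t : ℝ} (hs : s ∈ Icc a b) (ht : t ∈ Icc a b) :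
    emb ι (u t) = emb ι (u s) + ∫ r in s..t, (α r + emb ι (β r)) := by
  have ha : a ∈ Icc a b := left_mem_Icc.2 (ht.1.trans ht.2)
  have i := integrable_source (ι := ι) hα hβ
  rw [hu.eq t ht, hu.eq s hs, add_assoc, intervalIntegral.integral_add_adjacent_intervals
    (intervalIntegrable_of_restrict i ha hs) (intervalIntegrable_of_restrict i hs ht)]

theorem IsSol.mono {u : ℝ → H} {α : ℝ → V} {β : ℝ → H} (hu : IsSol ι a b α β u)
    (hα : MemLp α 2 (segMeasure a b)) (hβ : Integrable β (segMeasure a b)) {c d : ℝ} (hc : a ≤ c)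
    (hd : d ≤ b) : IsSol ι c d α β u := by
  refine ⟨hu.toIsPath.mono hc hd, fun t ht => ?_⟩
  have hcd : c ≤ d := ht.1.trans ht.2
  exact hu.eq_sub hα hβ ⟨hc, hcd.trans hd⟩ ⟨hc.trans ht.1, ht.2.trans hd⟩

theorem IsSol.energy (hι : Function.Injective ι) (hι' : DenseRange ι) {u : ℝ → H} {α : ℝ → V}
    {β : ℝ → H} (hu : IsSol ι a b α β u)
    (hα : MemLp α 2 (segMeasure a b)) (hβ : Integrable β (segMeasure a b))
    {t : ℝ} (ht : t ∈ Icc a b) :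
    ‖u t‖ ^ 2 = ‖u a‖ ^ 2
      + 2 * ∫ s in a..t, (inner ℝ (α s) (lift ι (u s)) + inner ℝ (β s) (u s)) := by
  have hu' := hu.mono hα hβ le_rfl ht.2
  have hle : segMeasure a t ≤ segMeasure a b :=
    Measure.restrict_mono (Icc_subset_Icc_right ht.2) le_rfl
  have hα' := hα.mono_measure hle
  have hβ' := hβ.mono_measure hle
  have hae := hu'.ae_eq
  obtain ⟨C, hC⟩ := isCompact_Icc.exists_bound_of_continuousOn hu'.cont
  have h := energy_eq ι hι hι' ht.1 (v := fun t => lift ι (u t)) (ua := u a) (ub := u t) hα'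
    hu'.memLp hβ' ?_ ?_ (hu.eq t ht)
  · rw [h]
    congr 2
    refine intervalIntegral.integral_congr_ae ?_
    filter_upwards [(ae_restrict_iff' measurableSet_Icc).1 hae] with s hs hs2
    rw [uIoc_of_le ht.1] at hs2
    rw [hs ⟨hs2.1.le, hs2.2⟩]
  · refine Integrable.mono' (hβ'.norm.const_mul C)
      (hβ'.1.norm.mul (ι.continuous.comp_aestronglyMeasurable hu'.memLp.1).norm) ?_
    filter_upwards [hae, ae_restrict_mem measurableSet_Icc] with s hs hs2
    rw [hs, norm_mul, norm_norm, norm_norm, mul_comm]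
    exact mul_le_mul_of_nonneg_right (hC s hs2) (norm_nonneg _)
  · filter_upwards [hae, ae_restrict_mem measurableSet_Icc] with s hs hs2
    rw [gram_apply, hs]
    exact hu'.eq s hs2

theorem IsPath.integrable_sq {u : ℝ → H} (hu : IsPath ι a b u) :
    Integrable (fun t => ‖lift ι (u t)‖ ^ 2) (segMeasure a b) :=
  (memLp_two_iff_integrable_sq_norm hu.memLp.1).1 hu.memLp

theorem integrable_mul_norm_sq {ρ : ℝ → ℝ} {u : ℝ → H} (hρ : Integrable ρ (segMeasure a b))
    (hu : ContinuousOn u (Icc a b)) :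
    Integrable (fun t => ρ t * ‖u t‖ ^ 2) (segMeasure a b) := by
  obtain ⟨C, hC⟩ := isCompact_Icc.exists_bound_of_continuousOn (hu.norm.pow 2)
  refine Integrable.mono' (hρ.norm.const_mul C)
    (hρ.1.mul ((hu.norm.pow 2).aestronglyMeasurable measurableSet_Icc)) ?_
  filter_upwards [ae_restrict_mem measurableSet_Icc] with s hs
  rw [norm_mul, mul_comm]
  exact mul_le_mul_of_nonneg_right (hC s hs) (norm_nonneg _)

theorem integrable_inner_of_continuousOn {β u : ℝ → H} (hβ : Integrable β (segMeasure a b))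
    (hu : ContinuousOn u (Icc a b)) :
    Integrable (fun t => inner ℝ (β t) (u t)) (segMeasure a b) := by
  obtain ⟨C, hC⟩ := isCompact_Icc.exists_bound_of_continuousOn hu
  refine Integrable.mono' (hβ.norm.const_mul C)
    (hβ.1.inner (hu.aestronglyMeasurable measurableSet_Icc)) ?_
  filter_upwards [ae_restrict_mem measurableSet_Icc] with s hs
  refine (norm_inner_le_norm _ _).trans ?_
  rw [mul_comm]
  exact mul_le_mul_of_nonneg_right (hC s hs) (norm_nonneg _)

/-- The basic energy estimate. The source `γ` enters through its primitive only. -/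
theorem IsSol.energy_le (hι : Function.Injective ι) (hι' : DenseRange ι) {u : ℝ → H} {α : ℝ → V}
    {β : ℝ → H} (hu : IsSol ι a b α β u)
    (hα : MemLp α 2 (segMeasure a b)) (hβ : Integrable β (segMeasure a b))
    {θ Γ : ℝ} {ρ γ : ℝ → ℝ} (hθ : 0 ≤ θ) (hρ : Integrable ρ (segMeasure a b))
    (hρ0 : ∀ t ∈ Icc a b, 0 ≤ ρ t) (hγ : Integrable γ (segMeasure a b))
    (hΓ : ∀ t ∈ Icc a b, ∫ s in a..t, γ s ≤ Γ)
    (h : ∀ᵐ t ∂segMeasure a b, inner ℝ (α t) (lift ι (u t)) + inner ℝ (β t) (u t)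
      ≤ -θ * ‖lift ι (u t)‖ ^ 2 + ρ t / 2 * ‖u t‖ ^ 2 + γ t / 2)
    {t : ℝ} (ht : t ∈ Icc a b) :
    ‖u t‖ ^ 2 + 2 * θ * ∫ s in a..t, ‖lift ι (u s)‖ ^ 2
      ≤ (‖u a‖ ^ 2 + Γ) * Real.exp (∫ s in a..b, ρ s) := by
  have ha : a ∈ Icc a b := left_mem_Icc.2 (ht.1.trans ht.2)
  have hb : b ∈ Icc a b := right_mem_Icc.2 (ht.1.trans ht.2)
  have hle : segMeasure a t ≤ segMeasure a b :=
    Measure.restrict_mono (Icc_subset_Icc_right ht.2) le_rfl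
  have hv2 := hu.toIsPath.integrable_sq
  have hρu := integrable_mul_norm_sq hρ hu.cont
  have hi1 : Integrable (fun t => inner ℝ (α t) (lift ι (u t)) + inner ℝ (β t) (u t))
      (segMeasure a b) :=
    (integrable_inner_of_memLp hα hu.memLp).add (integrable_inner_of_continuousOn hβ hu.cont)
  have key : ∀ s ∈ Icc a b, ‖u s‖ ^ 2 + ∫ r in a..s, 2 * θ * ‖lift ι (u r)‖ ^ 2
      ≤ (‖u a‖ ^ 2 + Γ) + ∫ r in a..s, ρ r * ‖u r‖ ^ 2 := by
    intro s hs
    rw [hu.energy hι hι' hα hβ hs]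
    have i1 := intervalIntegrable_of_restrict hi1 ha hs
    have i2 := intervalIntegrable_of_restrict (hv2.const_mul θ) ha hs
    have i3 := intervalIntegrable_of_restrict hρu ha hs
    have i4 := intervalIntegrable_of_restrict hγ ha hs
    have h1 : ∫ r in a..s, 2 * (inner ℝ (α r) (lift ι (u r)) + inner ℝ (β r) (u r))
        ≤ ∫ r in a..s, (ρ r * ‖u r‖ ^ 2 + γ r - 2 * (θ * ‖lift ι (u r)‖ ^ 2)) := by
      refine intervalIntegral.integral_mono_ae_restrict hs.1 (i1.const_mul 2)
        ((i3.add i4).sub (i2.const_mul 2)) ?_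
      have h' := ae_mono (Measure.restrict_mono (Icc_subset_Icc_right hs.2) le_rfl) h
      filter_upwards [h'] with r hr
      linarith
    rw [intervalIntegral.integral_const_mul, intervalIntegral.integral_sub (i3.add i4)
      (i2.const_mul 2), intervalIntegral.integral_add i3 i4,
      intervalIntegral.integral_const_mul] at h1
    have h2 := hΓ s hs
    simp only [mul_assoc]
    rw [intervalIntegral.integral_const_mul]
    linarith
  have hΓ0 : 0 ≤ Γ := by simpa using hΓ a ha
  have h1 := gronwall_energy (y := fun t => ‖u t‖ ^ 2) (z := fun r => 2 * θ * ‖lift ι (u r)‖ ^ 2)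
    ht.1 (hρ.mono_measure hle) (fun s hs => hρ0 s ⟨hs.1, hs.2.trans ht.2⟩)
    ((hu.cont.mono (Icc_subset_Icc_right ht.2)).norm.pow 2)
    (fun s hs => intervalIntegral.integral_nonneg hs.1 fun r _ => by positivity)
    (fun s hs => key s ⟨hs.1, hs.2.trans ht.2⟩)
  rw [intervalIntegral.integral_const_mul] at h1
  refine h1.trans (mul_le_mul_of_nonneg_left (Real.exp_le_exp.2 ?_) (by positivity))
  refine intervalIntegral.integral_mono_interval le_rfl ht.1 ht.2 ?_
    (intervalIntegrable_of_restrict hρ ha hb)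
  filter_upwards [ae_restrict_mem measurableSet_Ioc] with s hs
  exact hρ0 s ⟨hs.1.le, hs.2⟩

end Paths

/-! ### The norm of the maximal regularity space -/

section PathNorm

open Filter Topology

variable {V H : Type*} [NormedAddCommGroup V] [InnerProductSpace ℝ V] [CompleteSpace V]
  [NormedAddCommGroup H] [InnerProductSpace ℝ H] [CompleteSpace H] (ι : V →L[ℝ] H)

theorem toReal_eLpNorm_two_sq {α E : Type*} [MeasurableSpace α] {μ : Measure α}
    [NormedAddCommGroup E] {f : α → E} (hf : MemLp f 2 μ) :
    (eLpNorm f 2 μ).toReal ^ 2 = ∫ t, ‖f t‖ ^ 2 ∂μ := by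
  have h0 : 0 ≤ ∫ t, ‖f t‖ ^ 2 ∂μ := integral_nonneg fun _ => by positivity
  rw [hf.eLpNorm_eq_integral_rpow_norm (by norm_num) (by norm_num)]
  simp only [ENNReal.toReal_ofNat, Real.rpow_ofNat]
  rw [ENNReal.toReal_ofReal (by positivity), ← Real.rpow_natCast, ← Real.rpow_mul h0]
  norm_num

theorem eLpNorm_two_le_ofReal {α E : Type*} [MeasurableSpace α] {μ : Measure α}
    [NormedAddCommGroup E] {f : α → E} (hf : MemLp f 2 μ) {K : ℝ} (hK : 0 ≤ K) :
    eLpNorm f 2 μ ≤ ENNReal.ofReal K ↔ ∫ t, ‖f t‖ ^ 2 ∂μ ≤ K ^ 2 := by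
  rw [← toReal_eLpNorm_two_sq hf, ENNReal.le_ofReal_iff_toReal_le hf.2.ne hK,
    sq_le_sq₀ ENNReal.toReal_nonneg hK]

theorem integral_segMeasure {E : Type*} [NormedAddCommGroup E] [NormedSpace ℝ E] {a b : ℝ}
    (hab : a ≤ b) (f : ℝ → E) : ∫ t, f t ∂segMeasure a b = ∫ t in a..b, f t := by
  rw [intervalIntegral.integral_of_le hab, integral_Icc_eq_integral_Ioc]

/-- The norm of `C([a, b]; H) ∩ L²(a, b; V)`. -/
def pnorm (a b : ℝ) (u : ℝ → H) : ℝ≥0∞ :=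
  (⨆ t ∈ Icc a b, ‖u t‖ₑ) + eLpNorm (fun t => lift ι (u t)) 2 (segMeasure a b)

variable {ι} {a b : ℝ}

theorem enorm_le_pnorm {u : ℝ → H} {t : ℝ} (ht : t ∈ Icc a b) : ‖u t‖ₑ ≤ pnorm ι a b u :=
  (le_iSup₂ (f := fun t (_ : t ∈ Icc a b) => ‖u t‖ₑ) t ht).trans le_self_add

theorem norm_le_of_pnorm_le {u : ℝ → H} {K : ℝ} (hK : 0 ≤ K)
    (h : pnorm ι a b u ≤ ENNReal.ofReal K) {t : ℝ} (ht : t ∈ Icc a b) : ‖u t‖ ≤ K := by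
  have := (enorm_le_pnorm ht).trans h
  rwa [← ofReal_norm, ENNReal.ofReal_le_ofReal_iff hK] at this

theorem IsPath.integral_le_of_pnorm_le {u : ℝ → H} (hu : IsPath ι a b u) {K : ℝ} (hK : 0 ≤ K)
    (h : pnorm ι a b u ≤ ENNReal.ofReal K) :
    ∫ t, ‖lift ι (u t)‖ ^ 2 ∂segMeasure a b ≤ K ^ 2 :=
  (eLpNorm_two_le_ofReal hu.memLp hK).1 (le_add_self.trans h)

theorem IsPath.pnorm_le {u : ℝ → H} (hu : IsPath ι a b u) {K K' : ℝ} (hK : 0 ≤ K) (hK' : 0 ≤ K')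
    (h : ∀ t ∈ Icc a b, ‖u t‖ ≤ K)
    (h' : ∫ t, ‖lift ι (u t)‖ ^ 2 ∂segMeasure a b ≤ K' ^ 2) :
    pnorm ι a b u ≤ ENNReal.ofReal (K + K') := by
  rw [ENNReal.ofReal_add hK hK']
  refine add_le_add (iSup₂_le fun t ht => ?_) ((eLpNorm_two_le_ofReal hu.memLp hK').2 h')
  rw [← ofReal_norm]
  exact ENNReal.ofReal_le_ofReal (h t ht)

theorem IsPath.pnorm_sub_le (hι : Function.Injective ι) {u w z : ℝ → H} (hu : IsPath ι a b u)
    (hw : IsPath ι a b w) (hz : IsPath ι a b z) :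
    pnorm ι a b (fun t => u t - z t)
      ≤ pnorm ι a b (fun t => u t - w t) + pnorm ι a b (fun t => w t - z t) := by
  have h1 : ∀ᵐ t ∂segMeasure a b,
      lift ι (u t - z t) = lift ι (u t - w t) + lift ι (w t - z t) := by
    filter_upwards [(hu.sub hι hz).2, (hu.sub hι hw).2, (hw.sub hι hz).2] with t e1 e2 e3
    rw [e1, e2, e3]; abel
  unfold pnorm
  rw [add_add_add_comm]
  refine add_le_add (iSup₂_le fun t ht => ?_) ?_
  · have e : u t - z t = (u t - w t) + (w t - z t) := by abel
    change ‖u t - z t‖ₑ ≤ _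
    rw [e]
    exact (enorm_add_le _ _).trans (add_le_add
      (le_iSup₂ (f := fun t (_ : t ∈ Icc a b) => ‖u t - w t‖ₑ) t ht)
      (le_iSup₂ (f := fun t (_ : t ∈ Icc a b) => ‖w t - z t‖ₑ) t ht))
  · rw [eLpNorm_congr_ae h1]
    exact eLpNorm_add_le (hu.sub hι hw).1.memLp.1 (hw.sub hι hz).1.memLp.1 (by norm_num)

theorem IsPath.pnorm_sub_comm (hι : Function.Injective ι) {u w : ℝ → H} (hu : IsPath ι a b u)
    (hw : IsPath ι a b w) :
    pnorm ι a b (fun t => u t - w t) = pnorm ι a b (fun t => w t - u t) := by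
  unfold pnorm
  congr 1
  · simp only [enorm_sub_rev]
  · rw [← eLpNorm_neg]
    refine eLpNorm_congr_ae ?_
    filter_upwards [(hu.sub hι hw).2, (hw.sub hι hu).2] with t h1 h2
    rw [Pi.neg_apply, h1, h2, neg_sub]

theorem eLpNorm_lift_sub_le_pnorm (hι : Function.Injective ι) {u w : ℝ → H} (hu : IsPath ι a b u)
    (hw : IsPath ι a b w) :
    eLpNorm (fun t => lift ι (u t) - lift ι (w t)) 2 (segMeasure a b)
      ≤ pnorm ι a b (fun t => u t - w t) := by
  rw [← eLpNorm_congr_ae (hu.sub hι hw).2]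
  exact le_add_self

/-- Completeness of `C([a, b]; H) ∩ L²(a, b; V)`. -/
theorem exists_limit_path (hι : Function.Injective ι) {u : ℕ → ℝ → H}
    (hu : ∀ n, IsPath ι a b (u n)) {B : ℕ → ℝ≥0∞} (hB : ∑' n, B n ≠ ∞)
    (hc : ∀ N n m, N ≤ n → N ≤ m → pnorm ι a b (fun t => u n t - u m t) < B N) :
    ∃ w, IsPath ι a b w ∧ Tendsto (fun n => pnorm ι a b (fun t => u n t - w t)) atTop (𝓝 0) := by
  have hB0 := ENNReal.tendsto_atTop_zero_of_tsum_ne_top hB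
  have hcau : UniformCauchySeqOn u atTop (Icc a b) := by
    rw [Metric.uniformCauchySeqOn_iff]
    intro ε hε
    obtain ⟨N, hN⟩ := (ENNReal.tendsto_atTop_zero.1 hB0) (ENNReal.ofReal ε)
      (ENNReal.ofReal_pos.2 hε)
    refine ⟨N, fun m hm n hn t ht => ?_⟩
    have h1 : ‖u m t - u n t‖ₑ ≤ pnorm ι a b (fun t => u m t - u n t) :=
      enorm_le_pnorm (u := fun t => u m t - u n t) ht
    have h := h1.trans_lt ((hc N m n hm hn).trans_le (hN N le_rfl))
    rw [← ofReal_norm, ENNReal.ofReal_lt_ofReal_iff hε] at h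
    rwa [dist_eq_norm]
  have hex : ∀ t, ∃ y, t ∈ Icc a b → Tendsto (fun n => u n t) atTop (𝓝 y) := by
    intro t
    by_cases ht : t ∈ Icc a b
    · obtain ⟨y, hy⟩ := cauchySeq_tendsto_of_complete (hcau.cauchy_map ht)
      exact ⟨y, fun _ => hy⟩
    · exact ⟨0, fun h => absurd h ht⟩
  choose w hw using hex
  have hunif : TendstoUniformlyOn u w atTop (Icc a b) :=
    hcau.tendstoUniformlyOn_of_tendsto fun t ht => hw t ht
  have hwc : ContinuousOn w (Icc a b) :=
    hunif.continuousOn (Frequently.of_forall fun n => (hu n).cont)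
  obtain ⟨v, hv, hvlim⟩ := Lp.cauchy_complete_eLpNorm (p := 2) (by norm_num)
    (f := fun n t => lift ι (u n t)) (fun n => (hu n).memLp) hB (fun N n m hn hm =>
      lt_of_le_of_lt (eLpNorm_lift_sub_le_pnorm hι (hu n) (hu m)) (hc N n m hn hm))
  have hae : ∀ᵐ t ∂segMeasure a b, ι (v t) = w t := by
    have hm := tendstoInMeasure_of_tendsto_eLpNorm (p := 2) (by norm_num)
      (fun n => (hu n).memLp.1) hv.1 hvlim
    obtain ⟨ns, hns, hlim⟩ := hm.exists_seq_tendsto_ae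
    have hall : ∀ᵐ t ∂segMeasure a b, ∀ n, ι (lift ι (u n t)) = u n t :=
      ae_all_iff.2 fun n => (hu n).ae_eq
    filter_upwards [hlim, hall, ae_restrict_mem measurableSet_Icc] with t h1 h2 h3
    have h4 := (ι.continuous.tendsto _).comp h1
    refine tendsto_nhds_unique h4 ?_
    refine ((hw t h3).comp hns.tendsto_atTop).congr fun n => ?_
    exact (h2 _).symm
  obtain ⟨hpath, hlift⟩ := isPath_of_ae_eq hι hwc hv hae
  refine ⟨w, hpath, ?_⟩
  have h1 : Tendsto (fun n => ⨆ t ∈ Icc a b, ‖u n t - w t‖ₑ) atTop (𝓝 0) := by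
    rw [ENNReal.tendsto_atTop_zero]
    intro ε hε
    rcases eq_or_ne ε ∞ with rfl | hε'
    · exact ⟨0, fun _ _ => le_top⟩
    obtain ⟨N, hN⟩ := eventually_atTop.1 (Metric.tendstoUniformlyOn_iff.1 hunif ε.toReal
      (ENNReal.toReal_pos hε.ne' hε'))
    refine ⟨N, fun n hn => iSup₂_le fun t ht => ?_⟩
    have h := hN n hn t ht
    rw [dist_comm, dist_eq_norm] at h
    rw [← ofReal_norm]
    exact ENNReal.ofReal_le_of_le_toReal h.le
  have h2 : Tendsto (fun n => eLpNorm (fun t => lift ι (u n t - w t)) 2 (segMeasure a b)) atTop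
      (𝓝 0) := by
    refine hvlim.congr fun n => eLpNorm_congr_ae ?_
    filter_upwards [((hu n).sub hι hpath).2, hlift] with t e1 e2
    rw [e1, e2]
    rfl
  simpa [pnorm] using h1.add h2

end PathNorm

/-! ### Linear equations: a priori estimate -/

section Linear

open Filter Topology

variable {V H : Type*} [NormedAddCommGroup V] [InnerProductSpace ℝ V] [CompleteSpace V]
  [SecondCountableTopology V] [MeasurableSpace V] [BorelSpace V]
  [NormedAddCommGroup H] [InnerProductSpace ℝ H] [CompleteSpace H] (ι : V →L[ℝ] H)

/-- A measurable, bounded and coercive family of operators on `[a, b]`. The operators `V → V*` are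
read as operators on `V` through the Riesz isomorphism. -/
structure CoerciveFamily (a b θ M C : ℝ) (L : ℝ → V →L[ℝ] V) : Prop where
  measurable : ∀ v : V, Measurable fun t => L t v
  bound : ∀ t ∈ Icc a b, ∀ v : V, ‖L t v‖ ≤ C * ‖v‖
  coercive : ∀ t ∈ Icc a b, ∀ v : V, θ * ‖v‖ ^ 2 - M * ‖ι v‖ ^ 2 ≤ inner ℝ (L t v) v

variable {ι} {a b θ M C : ℝ} {L : ℝ → V →L[ℝ] V}

theorem CoerciveFamily.mono (hL : CoerciveFamily ι a b θ M C L) {c d : ℝ} (hc : a ≤ c)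
    (hd : d ≤ b) : CoerciveFamily ι c d θ M C L :=
  ⟨hL.measurable, fun t ht => hL.bound t (Icc_subset_Icc hc hd ht),
    fun t ht => hL.coercive t (Icc_subset_Icc hc hd ht)⟩

theorem CoerciveFamily.aestronglyMeasurable (hL : CoerciveFamily ι a b θ M C L) {v : ℝ → V}
    (hv : AEStronglyMeasurable v (segMeasure a b)) :
    AEStronglyMeasurable (fun t => L t (v t)) (segMeasure a b) := by
  have h : Measurable (Function.uncurry fun (v : V) (t : ℝ) => L t v) :=
    measurable_uncurry_of_continuous_of_measurable (fun t => (L t).continuous) hL.measurable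
  exact (h.comp_aemeasurable (hv.aemeasurable.prodMk aemeasurable_id)).aestronglyMeasurable

theorem CoerciveFamily.eLpNorm_le (hL : CoerciveFamily ι a b θ M C L) (v : ℝ → V) (p : ℝ≥0∞) :
    eLpNorm (fun t => L t (v t)) p (segMeasure a b)
      ≤ ENNReal.ofReal C * eLpNorm v p (segMeasure a b) := by
  refine eLpNorm_le_mul_eLpNorm_of_ae_le_mul ?_ p
  filter_upwards [ae_restrict_mem measurableSet_Icc] with t ht using hL.bound t ht _

theorem CoerciveFamily.memLp (hL : CoerciveFamily ι a b θ M C L) {v : ℝ → V}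
    (hv : MemLp v 2 (segMeasure a b)) : MemLp (fun t => L t (v t)) 2 (segMeasure a b) :=
  ⟨hL.aestronglyMeasurable hv.1,
    (hL.eLpNorm_le v 2).trans_lt (ENNReal.mul_lt_top ENNReal.ofReal_lt_top hv.2)⟩

variable (ι) in
/-- `u` is a path with `u' + L u = α + β`. -/
def IsLinSol (a b : ℝ) (L : ℝ → V →L[ℝ] V) (α : ℝ → V) (β u : ℝ → H) : Prop :=
  IsSol ι a b (fun t => α t - L t (lift ι (u t))) β u

theorem IsLinSol.isPath {α : ℝ → V} {β u : ℝ → H} (hu : IsLinSol ι a b L α β u) :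
    IsPath ι a b u := hu.toIsPath

theorem IsLinSol.memLp (hL : CoerciveFamily ι a b θ M C L) {α : ℝ → V} {β u : ℝ → H}
    (hu : IsLinSol ι a b L α β u) (hα : MemLp α 2 (segMeasure a b)) :
    MemLp (fun t => α t - L t (lift ι (u t))) 2 (segMeasure a b) :=
  hα.sub (hL.memLp hu.isPath.memLp)

theorem IsLinSol.linear (hι : Function.Injective ι) (hL : CoerciveFamily ι a b θ M C L)
    {α α' : ℝ → V} {β β' u w : ℝ → H} (hu : IsLinSol ι a b L α β u)
    (hw : IsLinSol ι a b L α' β' w)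
    (hα : MemLp α 2 (segMeasure a b)) (hβ : Integrable β (segMeasure a b))
    (hα' : MemLp α' 2 (segMeasure a b)) (hβ' : Integrable β' (segMeasure a b)) (c d : ℝ) :
    IsLinSol ι a b L (fun t => c • α t + d • α' t) (fun t => c • β t + d • β' t)
      (fun t => c • u t + d • w t) := by
  refine (IsSol.linear hι hu hw (hu.memLp hL hα) hβ (hw.memLp hL hα') hβ' c d).congr ?_
  filter_upwards [(hu.isPath.linear hι hw.isPath c d).2] with t ht
  rw [ht]
  simp only [map_add, map_smul, smul_sub]
  abel

theorem IsLinSol.sub (hι : Function.Injective ι) (hL : CoerciveFamily ι a b θ M C L)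
    {α α' : ℝ → V} {β β' u w : ℝ → H} (hu : IsLinSol ι a b L α β u)
    (hw : IsLinSol ι a b L α' β' w)
    (hα : MemLp α 2 (segMeasure a b)) (hβ : Integrable β (segMeasure a b))
    (hα' : MemLp α' 2 (segMeasure a b)) (hβ' : Integrable β' (segMeasure a b)) :
    IsLinSol ι a b L (fun t => α t - α' t) (fun t => β t - β' t) (fun t => u t - w t) := by
  simpa [← sub_eq_add_neg] using hu.linear hι hL hw hα hβ hα' hβ' 1 (-1)

/-- The constant of maximal regularity on an interval of length `τ`. -/
def linConst (θ M τ : ℝ) : ℝ :=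
  √((2 + 1 / θ) * Real.exp (2 * M * τ + 1)) + √((2 + 1 / θ) * Real.exp (2 * M * τ + 1) / θ)

theorem linConst_pos {θ M τ : ℝ} (hθ : 0 < θ) : 0 < linConst θ M τ := by
  unfold linConst
  positivity

theorem linConst_mono {θ M τ τ' : ℝ} (hθ : 0 < θ) (hM : 0 ≤ M) (h : τ ≤ τ') :
    linConst θ M τ ≤ linConst θ M τ' := by
  unfold linConst
  gcongr

/-- Maximal regularity estimate. -/
theorem IsLinSol.pnorm_le (hι : Function.Injective ι) (hι' : DenseRange ι) (hab : a ≤ b)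
    (hL : CoerciveFamily ι a b θ M C L) (hθ : 0 < θ) (hM : 0 ≤ M) {α : ℝ → V} {β u : ℝ → H}
    (hu : IsLinSol ι a b L α β u) (hα : MemLp α 2 (segMeasure a b))
    (hβ : Integrable β (segMeasure a b)) {δ : ℝ} (hδ : 0 < δ) (hua : ‖u a‖ ≤ δ)
    (hαδ : ∫ t, ‖α t‖ ^ 2 ∂segMeasure a b ≤ δ ^ 2) (hβδ : ∫ t, ‖β t‖ ∂segMeasure a b ≤ δ) :
    pnorm ι a b u ≤ ENNReal.ofReal (linConst θ M (b - a) * δ) := by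
  have ha : a ∈ Icc a b := left_mem_Icc.2 hab
  have hb : b ∈ Icc a b := right_mem_Icc.2 hab
  have hα2 : Integrable (fun t => ‖α t‖ ^ 2) (segMeasure a b) :=
    (memLp_two_iff_integrable_sq_norm hα.1).1 hα
  have hγ : Integrable (fun t => θ⁻¹ * ‖α t‖ ^ 2 + δ * ‖β t‖) (segMeasure a b) :=
    (hα2.const_mul _).add (hβ.norm.const_mul _)
  have hρ : Integrable (fun t => 2 * M + δ⁻¹ * ‖β t‖) (segMeasure a b) :=
    (integrable_const _).add (hβ.norm.const_mul _)
  have hΓ : ∀ t ∈ Icc a b, ∫ s in a..t, (θ⁻¹ * ‖α s‖ ^ 2 + δ * ‖β s‖) ≤ θ⁻¹ * δ ^ 2 + δ * δ := by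
    intro t ht
    calc _ ≤ ∫ s in a..b, (θ⁻¹ * ‖α s‖ ^ 2 + δ * ‖β s‖) :=
          intervalIntegral.integral_mono_interval le_rfl ht.1 ht.2
            (ae_of_all _ fun s => by dsimp only [Pi.zero_apply]; positivity)
            (intervalIntegrable_of_restrict hγ ha hb)
      _ = ∫ s, (θ⁻¹ * ‖α s‖ ^ 2 + δ * ‖β s‖) ∂segMeasure a b := (integral_segMeasure hab _).symm
      _ ≤ _ := by
        rw [integral_add (hα2.const_mul _) (hβ.norm.const_mul _), integral_const_mul,
          integral_const_mul]
        gcongr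
  have hρint : ∫ s in a..b, (2 * M + δ⁻¹ * ‖β s‖) ≤ 2 * M * (b - a) + 1 := by
    rw [← integral_segMeasure hab, integral_add (integrable_const _) (hβ.norm.const_mul _),
      integral_const_mul δ⁻¹, integral_const]
    have : δ⁻¹ * ∫ t, ‖β t‖ ∂segMeasure a b ≤ 1 := by
      rw [inv_mul_le_iff₀ hδ]; linarith
    have h2 : (segMeasure a b).real univ = b - a := by
      simp [Measure.real, ENNReal.toReal_ofReal (sub_nonneg.2 hab)]
    rw [h2, smul_eq_mul]
    linarith
  set K : ℝ := (2 + 1 / θ) * Real.exp (2 * M * (b - a) + 1) with hK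
  have hK0 : 0 < K := by positivity
  have key : ∀ t ∈ Icc a b, ‖u t‖ ^ 2 + θ * ∫ s in a..t, ‖lift ι (u s)‖ ^ 2 ≤ K * δ ^ 2 := by
    intro t ht
    have h := IsSol.energy_le hι hι' hu (hu.memLp hL hα) hβ (θ := θ / 2) (by positivity) hρ
      (fun t _ => by positivity) hγ hΓ ?_ ht
    · have h1 : 2 * (θ / 2) = θ := by ring
      rw [h1] at h
      refine h.trans ?_
      have h3 : ‖u a‖ ^ 2 ≤ δ ^ 2 := pow_le_pow_left₀ (norm_nonneg _) hua 2
      calc _ ≤ (δ ^ 2 + (θ⁻¹ * δ ^ 2 + δ * δ)) * Real.exp (2 * M * (b - a) + 1) := by gcongr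
        _ = K * δ ^ 2 := by rw [hK]; ring
    · filter_upwards [ae_restrict_mem measurableSet_Icc, hu.isPath.ae_eq] with s hs hs2
      have h1 := hL.coercive s hs (lift ι (u s))
      rw [hs2] at h1
      have h2 := real_inner_le_norm (α s) (lift ι (u s))
      have h3 := real_inner_le_norm (β s) (u s)
      rw [inner_sub_left]
      have h4 : ‖α s‖ * ‖lift ι (u s)‖ ≤ θ / 2 * ‖lift ι (u s)‖ ^ 2 + θ⁻¹ * ‖α s‖ ^ 2 / 2 := by
        have := sq_nonneg (θ * ‖lift ι (u s)‖ - ‖α s‖)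
        have e : θ / 2 * ‖lift ι (u s)‖ ^ 2 + θ⁻¹ * ‖α s‖ ^ 2 / 2 - ‖α s‖ * ‖lift ι (u s)‖
          = θ⁻¹ / 2 * (θ * ‖lift ι (u s)‖ - ‖α s‖) ^ 2 := by field_simp; ring
        have : 0 ≤ θ⁻¹ / 2 * (θ * ‖lift ι (u s)‖ - ‖α s‖) ^ 2 := by positivity
        linarith
      have h5 : ‖β s‖ * ‖u s‖ ≤ δ⁻¹ * ‖β s‖ / 2 * ‖u s‖ ^ 2 + δ * ‖β s‖ / 2 := by
        have e : δ⁻¹ * ‖β s‖ / 2 * ‖u s‖ ^ 2 + δ * ‖β s‖ / 2 - ‖β s‖ * ‖u s‖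
          = δ⁻¹ / 2 * ‖β s‖ * (‖u s‖ - δ) ^ 2 := by field_simp; ring
        have : 0 ≤ δ⁻¹ / 2 * ‖β s‖ * (‖u s‖ - δ) ^ 2 := by positivity
        linarith
      linarith
  have hint0 : ∀ t ∈ Icc a b, 0 ≤ ∫ s in a..t, ‖lift ι (u s)‖ ^ 2 := fun t ht =>
    intervalIntegral.integral_nonneg ht.1 fun _ _ => by positivity
  have e : linConst θ M (b - a) * δ = √K * δ + √(K / θ) * δ := by
    rw [linConst, add_mul]
  rw [e]
  refine hu.isPath.pnorm_le (by positivity) (by positivity) (fun t ht => ?_) ?_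
  · refine le_of_sq_le_sq ?_ (by positivity)
    rw [mul_pow, Real.sq_sqrt hK0.le]
    have := mul_nonneg hθ.le (hint0 t ht)
    linarith [key t ht]
  · rw [mul_pow, Real.sq_sqrt (by positivity), integral_segMeasure hab]
    have h1 := key b hb
    rw [div_mul_eq_mul_div, le_div_iff₀ hθ]
    linarith [sq_nonneg ‖u b‖]

end Linear

/-! ### Linear equations: existence -/

section LinearExistence

open Filter Topology

variable {V H : Type*} [NormedAddCommGroup V] [InnerProductSpace ℝ V] [CompleteSpace V]
  [SecondCountableTopology V] [MeasurableSpace V] [BorelSpace V]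
  [NormedAddCommGroup H] [InnerProductSpace ℝ H] [CompleteSpace H] {ι : V →L[ℝ] H}
  {a b θ M C : ℝ} {L : ℝ → V →L[ℝ] V}

theorem integral_norm_le_of_eLpNorm_one_le {α E : Type*} [MeasurableSpace α] {μ : Measure α}
    [NormedAddCommGroup E] {f : α → E} (hf : Integrable f μ) {K : ℝ} (hK : 0 ≤ K)
    (h : eLpNorm f 1 μ ≤ ENNReal.ofReal K) : ∫ t, ‖f t‖ ∂μ ≤ K := by
  rw [integral_norm_eq_lintegral_enorm hf.1, ← eLpNorm_one_eq_lintegral_enorm]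
  exact ENNReal.toReal_le_of_le_ofReal hK h

theorem eLpNorm_one_le_two {E : Type*} [NormedAddCommGroup E] {f : ℝ → E}
    (hf : AEStronglyMeasurable f (segMeasure a b)) :
    eLpNorm f 1 (segMeasure a b)
      ≤ eLpNorm f 2 (segMeasure a b) * segMeasure a b univ ^ (1 / 2 : ℝ) := by
  have h := eLpNorm_le_eLpNorm_mul_rpow_measure_univ (p := 1) (q := 2) (by norm_num) hf
  norm_num at h ⊢
  exact h

theorem tendsto_integral_of_eLpNorm_one {E : Type*} [NormedAddCommGroup E] [NormedSpace ℝ E]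
    {f : ℕ → ℝ → E} {g : ℝ → E} (hf : ∀ n, Integrable (f n) (segMeasure a b))
    (hg : Integrable g (segMeasure a b))
    (h : Tendsto (fun n => eLpNorm (f n - g) 1 (segMeasure a b)) atTop (𝓝 0)) {t : ℝ}
    (ht : t ∈ Icc a b) :
    Tendsto (fun n => ∫ s in a..t, f n s) atTop (𝓝 (∫ s in a..t, g s)) := by
  have h1 := tendsto_setIntegral_of_L1' g hg.1 (Eventually.of_forall hf) h (Icc a t)
  have e : ∀ k : ℝ → E, ∫ s in Icc a t, k s ∂segMeasure a b = ∫ s in a..t, k s := by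
    intro k
    rw [Measure.restrict_restrict measurableSet_Icc,
      inter_eq_left.2 (Icc_subset_Icc_right ht.2), integral_segMeasure ht.1]
  simpa only [e] using h1

/-- The data for which a linear equation is solvable form a closed set: if the data converge, the
solutions form a Cauchy sequence by the maximal regularity estimate. -/
theorem exists_isLinSol_of_approx (hι : Function.Injective ι) (hι' : DenseRange ι) (hab : a ≤ b)
    (hL : CoerciveFamily ι a b θ M C L) (hθ : 0 < θ) (hM : 0 ≤ M) {x : H} {α : ℝ → V} {β : ℝ → H}
    (hα : MemLp α 2 (segMeasure a b)) (hβ : Integrable β (segMeasure a b))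
    (h : ∀ δ : ℝ, 0 < δ → ∃ (α' : ℝ → V) (β' u : ℝ → H), MemLp α' 2 (segMeasure a b) ∧
      Integrable β' (segMeasure a b) ∧ IsLinSol ι a b L α' β' u ∧ ‖u a - x‖ ≤ δ ∧
      eLpNorm (α' - α) 2 (segMeasure a b) ≤ ENNReal.ofReal δ ∧
      eLpNorm (β' - β) 1 (segMeasure a b) ≤ ENNReal.ofReal δ) :
    ∃ u, IsLinSol ι a b L α β u ∧ u a = x := by
  have ha : a ∈ Icc a b := left_mem_Icc.2 hab
  choose! α' β' u' hα' hβ' hu' h1 h2 h3 using h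
  set δ : ℕ → ℝ := fun n => (1 / 2) ^ n with hδ
  have hδ0 : ∀ n, 0 < δ n := fun n => by positivity
  have hδmono : ∀ {m n}, m ≤ n → δ n ≤ δ m := fun h =>
    pow_le_pow_of_le_one (by norm_num) (by norm_num) h
  have hδlim : Tendsto δ atTop (𝓝 0) :=
    tendsto_pow_atTop_nhds_zero_of_lt_one (by norm_num) (by norm_num)
  have hδlim' : Tendsto (fun n => ENNReal.ofReal (δ n)) atTop (𝓝 0) := by
    simpa using ENNReal.tendsto_ofReal hδlim
  set K : ℝ := linConst θ M (b - a) with hK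
  have hK0 : 0 < K := linConst_pos hθ
  have hcau : ∀ N n m, N ≤ n → N ≤ m →
      pnorm ι a b (fun t => u' (δ n) t - u' (δ m) t) < ENNReal.ofReal ((2 * K + 1) * δ N) := by
    intro N n m hn hm
    have hsub := (hu' _ (hδ0 n)).sub hι hL (hu' _ (hδ0 m)) (hα' _ (hδ0 n)) (hβ' _ (hδ0 n))
      (hα' _ (hδ0 m)) (hβ' _ (hδ0 m))
    have hαd := (hα' _ (hδ0 n)).sub (hα' _ (hδ0 m))
    have hβd := (hβ' _ (hδ0 n)).sub (hβ' _ (hδ0 m))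
    have hNpos := hδ0 N
    have htwo : ENNReal.ofReal (δ n) + ENNReal.ofReal (δ m) ≤ ENNReal.ofReal (2 * δ N) := by
      rw [← ENNReal.ofReal_add (hδ0 n).le (hδ0 m).le]
      exact ENNReal.ofReal_le_ofReal (by linarith [hδmono hn, hδmono hm])
    refine (hsub.pnorm_le hι hι' hab hL hθ hM hαd hβd (δ := 2 * δ N) (by positivity) ?_ ?_
      ?_).trans_lt ?_
    · have e : u' (δ n) a - u' (δ m) a = (u' (δ n) a - x) - (u' (δ m) a - x) := by abel
      rw [e]
      refine (norm_sub_le _ _).trans ?_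
      linarith [h1 _ (hδ0 n), h1 _ (hδ0 m), hδmono hn, hδmono hm]
    · refine (eLpNorm_two_le_ofReal hαd (by positivity)).1 ?_
      have e : α' (δ n) - α' (δ m) = (α' (δ n) - α) - (α' (δ m) - α) := by abel
      rw [e]
      refine (eLpNorm_sub_le ((hα' _ (hδ0 n)).sub hα).1 ((hα' _ (hδ0 m)).sub hα).1
        (by norm_num)).trans ?_
      exact (add_le_add (h2 _ (hδ0 n)) (h2 _ (hδ0 m))).trans htwo
    · refine integral_norm_le_of_eLpNorm_one_le hβd (by positivity) ?_
      have e : β' (δ n) - β' (δ m) = (β' (δ n) - β) - (β' (δ m) - β) := by abel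
      rw [e]
      refine (eLpNorm_sub_le ((hβ' _ (hδ0 n)).sub hβ).1 ((hβ' _ (hδ0 m)).sub hβ).1
        le_rfl).trans ?_
      exact (add_le_add (h3 _ (hδ0 n)) (h3 _ (hδ0 m))).trans htwo
    · rw [ENNReal.ofReal_lt_ofReal_iff (by positivity)]
      linarith
  have hsum : ∑' n, ENNReal.ofReal ((2 * K + 1) * δ n) ≠ ∞ :=
    ((summable_geometric_of_lt_one (by norm_num) (by norm_num)).mul_left _).tsum_ofReal_ne_top
  obtain ⟨w, hw, hlim⟩ := exists_limit_path hι (fun n => (hu' _ (hδ0 n)).isPath) hsum hcau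
  have hpt : ∀ t ∈ Icc a b, Tendsto (fun n => u' (δ n) t) atTop (𝓝 (w t)) := by
    intro t ht
    rw [tendsto_iff_edist_tendsto_0]
    refine tendsto_of_tendsto_of_tendsto_of_le_of_le tendsto_const_nhds hlim (fun _ => zero_le)
      fun n => ?_
    rw [edist_eq_enorm_sub]
    exact enorm_le_pnorm (u := fun t => u' (δ n) t - w t) ht
  have hwa : w a = x := by
    refine tendsto_nhds_unique (hpt a ha) ?_
    rw [tendsto_iff_norm_sub_tendsto_zero]
    exact squeeze_zero (fun _ => norm_nonneg _) (fun n => h1 _ (hδ0 n)) hδlim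
  refine ⟨w, ⟨hw, fun t ht => ?_⟩, hwa⟩
  have hWα : MemLp (fun t => α t - L t (lift ι (w t))) 2 (segMeasure a b) :=
    hα.sub (hL.memLp hw.memLp)
  have hlin : Tendsto (fun n => ∫ s in a..t,
      ((α' (δ n) s - L s (lift ι (u' (δ n) s))) + emb ι (β' (δ n) s))) atTop
      (𝓝 (∫ s in a..t, ((α s - L s (lift ι (w s))) + emb ι (β s)))) := by
    refine tendsto_integral_of_eLpNorm_one
      (fun n => integrable_source ((hu' _ (hδ0 n)).memLp hL (hα' _ (hδ0 n))) (hβ' _ (hδ0 n)))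
      (integrable_source hWα hβ) ?_ ht
    set κ : ℝ≥0∞ := segMeasure a b univ ^ (1 / 2 : ℝ) with hκ
    have hκt : κ ≠ ∞ := ENNReal.rpow_ne_top_of_nonneg (by norm_num) (measure_ne_top _ _)
    have hbd : ∀ n, eLpNorm ((fun s => (α' (δ n) s - L s (lift ι (u' (δ n) s)))
        + emb ι (β' (δ n) s)) - fun s => (α s - L s (lift ι (w s))) + emb ι (β s)) 1
        (segMeasure a b) ≤ ENNReal.ofReal (δ n) * κ
          + ENNReal.ofReal C * pnorm ι a b (fun t => u' (δ n) t - w t) * κ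
          + ENNReal.ofReal ‖emb ι‖ * ENNReal.ofReal (δ n) := by
      intro n
      have hd := (hu' _ (hδ0 n)).isPath.sub hι hw
      have e : ((fun s => (α' (δ n) s - L s (lift ι (u' (δ n) s))) + emb ι (β' (δ n) s))
          - fun s => (α s - L s (lift ι (w s))) + emb ι (β s)) =ᵐ[segMeasure a b]
          ((α' (δ n) - α) - (fun s => L s (lift ι (u' (δ n) s - w s))))
            + fun s => emb ι ((β' (δ n) - β) s) := by
        filter_upwards [hd.2] with s hs
        simp only [Pi.sub_apply, Pi.add_apply, hs, map_sub]
        abel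
      have m1 := ((hα' _ (hδ0 n)).sub hα).1
      have m2 := hL.aestronglyMeasurable hd.1.memLp.1
      have m3 := (emb ι).continuous.comp_aestronglyMeasurable ((hβ' _ (hδ0 n)).sub hβ).1
      rw [eLpNorm_congr_ae e]
      refine (eLpNorm_add_le (m1.sub m2) m3 le_rfl).trans (add_le_add
        ((eLpNorm_sub_le m1 m2 le_rfl).trans (add_le_add ?_ ?_)) ?_)
      · exact (eLpNorm_one_le_two m1).trans (mul_le_mul_left (h2 _ (hδ0 n)) _)
      · refine (eLpNorm_one_le_two m2).trans (mul_le_mul_left ?_ _)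
        exact (hL.eLpNorm_le _ 2).trans (mul_le_mul_right le_add_self _)
      · refine (eLpNorm_le_mul_eLpNorm_of_ae_le_mul (ae_of_all _ fun s =>
          (emb ι).le_opNorm ((β' (δ n) - β) s)) 1).trans (mul_le_mul_right (h3 _ (hδ0 n)) _)
    refine tendsto_of_tendsto_of_tendsto_of_le_of_le tendsto_const_nhds ?_ (fun _ => zero_le) hbd
    have l1 := ENNReal.Tendsto.mul_const (b := κ) hδlim' (Or.inr hκt)
    have l2 := ENNReal.Tendsto.mul_const (b := κ) (ENNReal.Tendsto.const_mul
      (a := ENNReal.ofReal C) hlim (Or.inr ENNReal.ofReal_ne_top)) (Or.inr hκt)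
    have l3 := ENNReal.Tendsto.const_mul (a := ENNReal.ofReal ‖emb ι‖) hδlim'
      (Or.inr ENNReal.ofReal_ne_top)
    simpa using (l1.add l2).add l3
  refine tendsto_nhds_unique (((emb ι).continuous.tendsto _).comp (hpt t ht)) ?_
  refine ((((emb ι).continuous.tendsto _).comp (hpt a ha)).add hlin).congr fun n => ?_
  exact ((hu' _ (hδ0 n)).eq t ht).symm

/-- The pointwise adjoint `h = L† g`, obtained from the Riesz theorem in `L²(a, b; V)`; this avoids
the question whether `t ↦ L(t)†` is measurable. -/
theorem CoerciveFamily.exists_adjoint (hL : CoerciveFamily ι a b θ M C L) (hC : 0 ≤ C)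
    (g : Lp V 2 (segMeasure a b)) : ∃ h : Lp V 2 (segMeasure a b), ∀ w : ℝ → V,
      MemLp w 2 (segMeasure a b) →
      ∫ t, inner ℝ (L t (w t)) (g t) ∂segMeasure a b
        = ∫ t, inner ℝ (w t) (h t) ∂segMeasure a b := by
  have hm : ∀ w : Lp V 2 (segMeasure a b), MemLp (fun t => L t (w t)) 2 (segMeasure a b) :=
    fun w => hL.memLp (Lp.memLp w)
  let T : Lp V 2 (segMeasure a b) →ₗ[ℝ] ℝ :=
    { toFun := fun w => inner ℝ g ((hm w).toLp _)
      map_add' := fun w w' => by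
        rw [← inner_add_right, ← MemLp.toLp_add]
        congr 1
        refine (MemLp.toLp_eq_toLp_iff _ _).2 ?_
        filter_upwards [Lp.coeFn_add w w'] with t ht
        rw [ht]; simp
      map_smul' := fun c w => by
        rw [RingHom.id_apply, smul_eq_mul, ← real_inner_smul_right, ← MemLp.toLp_const_smul]
        congr 1
        refine (MemLp.toLp_eq_toLp_iff _ _).2 ?_
        filter_upwards [Lp.coeFn_smul c w] with t ht
        rw [ht]; simp }
  have hT : ∀ w, ‖T w‖ ≤ (‖g‖ * C) * ‖w‖ := by
    intro w
    refine (norm_inner_le_norm (𝕜 := ℝ) g ((hm w).toLp _)).trans ?_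
    rw [mul_assoc]
    refine mul_le_mul_of_nonneg_left ?_ (norm_nonneg _)
    rw [Lp.norm_toLp]
    refine ENNReal.toReal_le_of_le_ofReal (by positivity) ?_
    rw [ENNReal.ofReal_mul hC, Lp.norm_def, ENNReal.ofReal_toReal (Lp.eLpNorm_ne_top w)]
    exact hL.eLpNorm_le _ 2
  refine ⟨(InnerProductSpace.toDual ℝ _).symm (T.mkContinuous _ hT), fun w hw => ?_⟩
  set h := (InnerProductSpace.toDual ℝ _).symm (T.mkContinuous _ hT) with hh
  have h1 : inner ℝ h (hw.toLp w) = inner ℝ g ((hm (hw.toLp w)).toLp _) := by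
    rw [hh, InnerProductSpace.toDual_symm_apply]
    rfl
  rw [L2.inner_def, L2.inner_def] at h1
  have e1 : ∫ t, inner ℝ (h t) (hw.toLp w t) ∂segMeasure a b
      = ∫ t, inner ℝ (w t) (h t) ∂segMeasure a b := by
    refine integral_congr_ae ?_
    filter_upwards [hw.coeFn_toLp] with t ht
    rw [ht, real_inner_comm]
  have e2 : ∫ t, inner ℝ (g t) ((hm (hw.toLp w)).toLp _ t) ∂segMeasure a b
      = ∫ t, inner ℝ (L t (w t)) (g t) ∂segMeasure a b := by
    refine integral_congr_ae ?_
    filter_upwards [hw.coeFn_toLp, (hm (hw.toLp w)).coeFn_toLp] with t ht ht'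
    rw [ht', ht, real_inner_comm]
  rw [← e1, ← e2, h1]

end LinearExistence

section LinearSolvability

open Filter Topology

variable {V H : Type*} [NormedAddCommGroup V] [InnerProductSpace ℝ V] [CompleteSpace V]
  [SecondCountableTopology V] [MeasurableSpace V] [BorelSpace V]
  [NormedAddCommGroup H] [InnerProductSpace ℝ H] [CompleteSpace H] {ι : V →L[ℝ] H}
  {a b θ M C : ℝ} {L : ℝ → V →L[ℝ] V}

theorem memLp_of_continuousOn {E : Type*} [NormedAddCommGroup E] {f : ℝ → E}
    (hf : ContinuousOn f (Icc a b)) (p : ℝ≥0∞) : MemLp f p (segMeasure a b) := by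
  obtain ⟨K, hK⟩ := isCompact_Icc.exists_bound_of_continuousOn hf
  refine MemLp.of_bound
    (hf.aestronglyMeasurable_of_isCompact isCompact_Icc measurableSet_Icc) K ?_
  filter_upwards [ae_restrict_mem measurableSet_Icc] with t ht using hK t ht

/-- Primitives of functions in `L²(a, b; V)` solve the linear equation for explicit data. -/
theorem isLinSol_primitive (hι : Function.Injective ι) {ξ : ℝ → V}
    (hξ : MemLp ξ 2 (segMeasure a b)) (x : V) :
    IsLinSol ι a b L (fun t => gram ι (ξ t) + L t (x + ∫ s in a..t, ξ s)) 0
      (fun t => ι (x + ∫ s in a..t, ξ s)) := by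
  have hc : ContinuousOn (fun t => x + ∫ s in a..t, ξ s) (Icc a b) :=
    continuousOn_const.add (continuousOn_integral (integrable_of_memLp_two hξ))
  have hp := (isPath_of_ae_eq hι (ι.continuous.comp_continuousOn hc)
    (memLp_of_continuousOn hc 2) (ae_of_all _ fun t => rfl)).1
  refine ⟨hp, fun t ht => ?_⟩
  have ha : a ∈ Icc a b := left_mem_Icc.2 (ht.1.trans ht.2)
  simp only [lift_iota ι hι, add_sub_cancel_right, Pi.zero_apply, map_zero, add_zero,
    intervalIntegral.integral_same]
  rw [ContinuousLinearMap.intervalIntegral_comp_comm _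
    (intervalIntegrable_of_restrict (integrable_of_memLp_two hξ) ha ht), ← gram_apply, ← gram_apply,
    map_add]

/-- The dual problem: a function orthogonal to all data of primitives vanishes. By duality it
solves the adjoint equation backward in time with end value `0`. -/
theorem eq_zero_of_orthogonal (hι : Function.Injective ι) (hι' : DenseRange ι) (hab : a ≤ b)
    (hL : CoerciveFamily ι a b θ M C L) (hC : 0 ≤ C) (hθ : 0 < θ) (hM : 0 ≤ M)
    {g : Lp V 2 (segMeasure a b)}
    (horth : ∀ ξ : ℝ → V, MemLp ξ 2 (segMeasure a b) →
      ∫ t, inner ℝ (gram ι (ξ t) + L t (∫ s in a..t, ξ s)) (g t) ∂segMeasure a b = 0) :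
    g = 0 := by
  have ha : a ∈ Icc a b := left_mem_Icc.2 hab
  have hb : b ∈ Icc a b := right_mem_Icc.2 hab
  obtain ⟨h, hh⟩ := hL.exists_adjoint hC g
  have hg2 : MemLp g 2 (segMeasure a b) := Lp.memLp g
  have hh2 : MemLp h 2 (segMeasure a b) := Lp.memLp h
  have hhi : Integrable h (segMeasure a b) := integrable_of_memLp_two hh2
  set q0 : V := ∫ s in a..b, h s with hq0
  set q : ℝ → V := fun t => q0 + ∫ s in a..t, -h s with hq
  have hqc : ContinuousOn q (Icc a b) := continuousOn_const.add (continuousOn_integral hhi.neg)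
  have hq2 : MemLp q 2 (segMeasure a b) := memLp_of_continuousOn hqc 2
  have hG2 : MemLp (fun t => gram ι (g t)) 2 (segMeasure a b) := (gram ι).comp_memLp' hg2
  have hzero : ∀ ξ : ℝ → V, MemLp ξ 2 (segMeasure a b) →
      ∫ t, inner ℝ (ξ t) (gram ι (g t) + q t) ∂segMeasure a b = 0 := by
    intro ξ hξ
    have hξi := integrable_of_memLp_two hξ
    have hPc : ContinuousOn (fun t => ∫ s in a..t, ξ s) (Icc a b) := continuousOn_integral hξi
    have hP2 := memLp_of_continuousOn hPc 2
    have h1 := horth ξ hξ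
    have h2 := bilin_integral_eq (innerSL ℝ) hab hξi hhi.neg 0 q0
    have hB : ∀ x y : V, (innerSL ℝ) x y = inner ℝ x y := fun _ _ => rfl
    have hqb : q0 + ∫ s in a..b, (-⇑h) s = 0 := by
      simp only [Pi.neg_apply]
      rw [intervalIntegral.integral_neg, hq0, add_neg_cancel]
    simp only [hB] at h2
    rw [hqb, inner_zero_right, inner_zero_left, zero_add, ← integral_segMeasure hab] at h2
    simp only [zero_add, Pi.neg_apply, inner_neg_right] at h2
    have i1 : Integrable (fun t => inner ℝ (ξ t) (q t)) (segMeasure a b) :=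
      integrable_inner_of_memLp hξ hq2
    have i2 : Integrable (fun t => inner ℝ (∫ s in a..t, ξ s) (h t)) (segMeasure a b) :=
      integrable_inner_of_memLp hP2 hh2
    have i3 : Integrable (fun t => inner ℝ (gram ι (ξ t)) (g t)) (segMeasure a b) :=
      integrable_inner_of_memLp ((gram ι).comp_memLp' hξ) hg2
    have i4 : Integrable (fun t => inner ℝ (L t (∫ s in a..t, ξ s)) (g t)) (segMeasure a b) :=
      integrable_inner_of_memLp (hL.memLp hP2) hg2
    have i5 : Integrable (fun t => inner ℝ (ξ t) (gram ι (g t))) (segMeasure a b) :=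
      integrable_inner_of_memLp hξ hG2
    have h3 : ∫ t, inner ℝ (ξ t) (q t) ∂segMeasure a b
        = ∫ t, inner ℝ (∫ s in a..t, ξ s) (h t) ∂segMeasure a b := by
      have h4 : (0 : ℝ) = ∫ t, (inner ℝ (ξ t) (q t) + -inner ℝ (∫ s in a..t, ξ s) (h t))
        ∂segMeasure a b := h2
      have i2' : Integrable (fun t => -inner ℝ (∫ s in a..t, ξ s) (h t)) (segMeasure a b) := i2.neg
      rw [integral_add i1 i2', integral_neg] at h4
      linarith
    simp only [inner_add_left] at h1
    rw [integral_add i3 i4, hh _ hP2] at h1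
    simp only [inner_add_right]
    rw [integral_add i5 i1, h3, ← h1]
    congr 1
    refine integral_congr_ae (ae_of_all _ fun t => ?_)
    simp only [inner_gram_left, inner_gram_right]
  -- `ι† ι g = -q` is an equation in `V*` for `g`, with derivative `h` and end value `0`
  have hae : ∀ᵐ t ∂segMeasure a b, gram ι (g t) + q t = 0 := by
    have hs : MemLp (fun t => gram ι (g t) + q t) 2 (segMeasure a b) := hG2.add hq2
    have h1 := hzero _ hs
    simp only [real_inner_self_eq_norm_sq] at h1
    rw [integral_eq_zero_iff_of_nonneg (fun t => by positivity)
      ((memLp_two_iff_integrable_sq_norm hs.1).1 hs)] at h1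
    filter_upwards [h1] with t ht
    simpa using ht
  have hqsub : ∀ s ∈ Icc a b, ∀ t ∈ Icc a b, -q t = -q s + ∫ r in s..t, h r := by
    intro s hs t ht
    have e := intervalIntegral.integral_add_adjacent_intervals
      (intervalIntegrable_of_restrict hhi ha hs) (intervalIntegrable_of_restrict hhi hs ht)
    simp only [hq, intervalIntegral.integral_neg]
    rw [← e]
    abel
  have hqb : q b = 0 := by
    simp only [hq, intervalIntegral.integral_neg, hq0, add_neg_cancel]
  have hg2i : Integrable (fun t => ‖g t‖ ^ 2) (segMeasure a b) :=
    (memLp_two_iff_integrable_sq_norm hg2.1).1 hg2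
  have hιg2 : MemLp (fun t => ι (g t)) 2 (segMeasure a b) := ι.comp_memLp' hg2
  have hy : Integrable (fun t => ‖ι (g t)‖ ^ 2) (segMeasure a b) :=
    (memLp_two_iff_integrable_sq_norm hιg2.1).1 hιg2
  have hineq : ∀ᵐ s ∂segMeasure a b, ‖ι (g s)‖ ^ 2 ≤ 2 * M * ∫ t in s..b, ‖ι (g t)‖ ^ 2 := by
    filter_upwards [hae, ae_restrict_mem measurableSet_Icc] with s hs hs'
    have hle : segMeasure s b ≤ segMeasure a b :=
      Measure.restrict_mono (Icc_subset_Icc_left hs'.1) le_rfl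
    have hse : emb ι (ι (g s)) = -q s := eq_neg_of_add_eq_zero_left hs
    have hen := energy_eq ι hι hι' hs'.2 (v := g) (α := h) (β := 0) (ua := ι (g s)) (ub := 0)
      (hh2.mono_measure hle) (hg2.mono_measure hle) (integrable_zero _ _ _) (by simp) ?_ ?_
    · simp only [Pi.zero_apply, inner_zero_left, add_zero, norm_zero] at hen
      have hind : MemLp ((Icc s b).indicator g) 2 (segMeasure a b) :=
        hg2.indicator measurableSet_Icc
      have h1 := hh _ hind
      have e1 : ∀ k : V → ℝ → ℝ, (∀ t, k 0 t = 0) →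
          ∫ t, k ((Icc s b).indicator g t) t ∂segMeasure a b = ∫ t in s..b, k (g t) t := by
        intro k hk
        have : (fun t => k ((Icc s b).indicator g t) t)
            = (Icc s b).indicator (fun t => k (g t) t) := by
          ext t
          by_cases ht : t ∈ Icc s b
          · simp [ht]
          · simp [ht, hk]
        rw [this, integral_indicator measurableSet_Icc, Measure.restrict_restrict measurableSet_Icc,
          inter_eq_left.2 (Icc_subset_Icc_left hs'.1), integral_segMeasure hs'.2]
      rw [e1 (fun v t => inner ℝ (L t v) (g t)) (by simp), e1 (fun v t => inner ℝ v (h t))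
        (by simp)] at h1
      have e2 : ∫ t in s..b, inner ℝ (h t) (g t) = ∫ t in s..b, inner ℝ (L t (g t)) (g t) := by
        rw [h1]
        simp only [real_inner_comm]
      have h2 : ∫ t in s..b, (θ * ‖g t‖ ^ 2 - M * ‖ι (g t)‖ ^ 2)
          ≤ ∫ t in s..b, inner ℝ (L t (g t)) (g t) := by
        refine intervalIntegral.integral_mono_on hs'.2 ?_ ?_ fun t ht =>
          hL.coercive t ⟨hs'.1.trans ht.1, ht.2⟩ _
        · exact intervalIntegrable_of_restrict ((hg2i.const_mul _).sub (hy.const_mul _)) hs' hb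
        · exact intervalIntegrable_of_restrict (integrable_inner_of_memLp (hL.memLp hg2) hg2) hs' hb
      rw [intervalIntegral.integral_sub
        (intervalIntegrable_of_restrict (hg2i.const_mul _) hs' hb)
        (intervalIntegrable_of_restrict (hy.const_mul _) hs' hb),
        intervalIntegral.integral_const_mul, intervalIntegral.integral_const_mul] at h2
      have h3 : 0 ≤ θ * ∫ t in s..b, ‖g t‖ ^ 2 :=
        mul_nonneg hθ.le (intervalIntegral.integral_nonneg hs'.2 fun _ _ => by positivity)
      rw [e2] at hen
      linarith
    · filter_upwards [ae_mono hle hae, ae_restrict_mem measurableSet_Icc] with t ht ht'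
      simp only [Pi.zero_apply, map_zero, add_zero]
      rw [hse, ← hqsub s hs' t ⟨hs'.1.trans ht'.1, ht'.2⟩]
      exact eq_neg_of_add_eq_zero_left ht
    · simp only [Pi.zero_apply, map_zero, add_zero]
      rw [hse, ← hqsub s hs' b hb, hqb, neg_zero]
  -- Gronwall's inequality applies to `s ↦ F (a + b - s)`, which vanishes at `s = a`
  set F : ℝ → ℝ := fun s => ∫ t in s..b, ‖ι (g t)‖ ^ 2 with hF
  have hFc : ContinuousOn F (Icc a b) := by
    have h1 : ContinuousOn (fun s => (∫ t in a..b, ‖ι (g t)‖ ^ 2) - ∫ t in a..s, ‖ι (g t)‖ ^ 2)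
        (Icc a b) := continuousOn_const.sub (continuousOn_integral hy)
    refine h1.congr fun s hs => ?_
    rw [hF]
    exact (intervalIntegral.integral_interval_sub_left (intervalIntegrable_of_restrict hy ha hb)
      (intervalIntegrable_of_restrict hy ha hs)).symm
  have hmaps : ∀ t ∈ Icc a b, a + b - t ∈ Icc a b := fun t ht => by
    constructor <;> linarith [ht.1, ht.2]
  have hgr := gronwall_integral (Y := fun t => F (a + b - t)) (ρ := fun _ => 2 * M) (c := 0) hab
    (integrable_const _) (fun _ _ => by positivity)
    (hFc.comp (by fun_prop) hmaps) ?_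
  · simp only [add_sub_cancel_right, zero_mul] at hgr
    rw [hF] at hgr
    dsimp only at hgr
    rw [← integral_segMeasure hab] at hgr
    have h0 : ∫ t, ‖ι (g t)‖ ^ 2 ∂segMeasure a b = 0 :=
      le_antisymm hgr (integral_nonneg fun _ => by positivity)
    rw [integral_eq_zero_iff_of_nonneg (fun t => by positivity) hy] at h0
    rw [Lp.eq_zero_iff_ae_eq_zero]
    filter_upwards [h0] with t ht
    have : ι (g t) = 0 := by simpa using ht
    exact hι (by rw [this, Pi.zero_apply, map_zero])
  · intro t ht
    rw [zero_add, intervalIntegral.integral_comp_sub_left (fun s => 2 * M * F s) (a + b)]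
    have e : a + b - a = b := by ring
    rw [e]
    refine intervalIntegral.integral_mono_ae_restrict (hmaps t ht).2
      (intervalIntegrable_of_restrict hy (hmaps t ht) hb)
      (intervalIntegrable_of_restrict
        ((memLp_of_continuousOn hFc 1).integrable le_rfl |>.const_mul (2 * M)) (hmaps t ht) hb) ?_
    exact ae_mono (Measure.restrict_mono (Icc_subset_Icc_left (hmaps t ht).1) le_rfl) hineq

/-- Solvability for sources `α` and initial value zero: the solvable sources form a subspace of
`L²(a, b; V)`, which is dense by `eq_zero_of_orthogonal`, and they form a closed set. -/
theorem exists_isLinSol_zero (hι : Function.Injective ι) (hι' : DenseRange ι) (hab : a ≤ b)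
    (hL : CoerciveFamily ι a b θ M C L) (hC : 0 ≤ C) (hθ : 0 < θ) (hM : 0 ≤ M) {α : ℝ → V}
    (hα : MemLp α 2 (segMeasure a b)) : ∃ u, IsLinSol ι a b L α 0 u ∧ u a = 0 := by
  have hz : Integrable (0 : ℝ → H) (segMeasure a b) := integrable_zero _ _ _
  have hcongr : ∀ {α α' : ℝ → V} {β u : ℝ → H}, IsLinSol ι a b L α β u → (∀ t, β t = 0) →
      α =ᵐ[segMeasure a b] α' → IsLinSol ι a b L α' 0 u := by
    intro α α' β u hu hβ hαα'
    refine IsSol.congr hu ?_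
    filter_upwards [hαα'] with t ht
    rw [ht, hβ, Pi.zero_apply]
  let G : Submodule ℝ (Lp V 2 (segMeasure a b)) :=
    { carrier := {α | ∃ u, IsLinSol ι a b L α 0 u ∧ u a = 0}
      add_mem' := by
        rintro α α' ⟨u, hu, hua⟩ ⟨u', hu', hua'⟩
        refine ⟨_, hcongr (hu.linear hι hL hu' (Lp.memLp α) hz (Lp.memLp α') hz 1 1) (by simp) ?_,
          by simp [hua, hua']⟩
        filter_upwards [Lp.coeFn_add α α'] with t ht
        rw [ht]; simp
      zero_mem' := by
        refine ⟨fun t => ι (0 + ∫ s in a..t, (0 : ℝ → V) s),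
          hcongr (isLinSol_primitive hι MemLp.zero' 0) (fun _ => rfl) ?_, by simp⟩
        filter_upwards [Lp.coeFn_zero V 2 (segMeasure a b)] with t ht
        rw [ht]; simp
      smul_mem' := by
        rintro c α ⟨u, hu, hua⟩
        refine ⟨fun t => c • u t + (0 : ℝ) • u t, hcongr
          (hu.linear hι hL hu (Lp.memLp α) hz (Lp.memLp α) hz c 0) (by simp) ?_, by simp [hua]⟩
        filter_upwards [Lp.coeFn_smul c α] with t ht
        rw [ht]; simp }
  have hdense : G.topologicalClosure = ⊤ := by
    rw [Submodule.topologicalClosure_eq_top_iff, Submodule.eq_bot_iff]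
    intro g hg
    refine eq_zero_of_orthogonal hι hι' hab hL hC hθ hM fun ξ hξ => ?_
    have hc : ContinuousOn (fun t => ∫ s in a..t, ξ s) (Icc a b) :=
      continuousOn_integral (integrable_of_memLp_two hξ)
    have hm : MemLp (fun t => gram ι (ξ t) + L t (∫ s in a..t, ξ s)) 2 (segMeasure a b) :=
      ((gram ι).comp_memLp' hξ).add (hL.memLp (memLp_of_continuousOn hc 2))
    have hmem : hm.toLp _ ∈ G := by
      refine ⟨_, hcongr (isLinSol_primitive hι hξ 0) (fun _ => rfl) ?_, by simp⟩
      filter_upwards [hm.coeFn_toLp] with t ht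
      rw [ht, zero_add]
    have h1 := hg _ hmem
    rw [L2.inner_def] at h1
    rw [← h1]
    refine integral_congr_ae ?_
    filter_upwards [hm.coeFn_toLp] with t ht
    rw [ht]
  refine exists_isLinSol_of_approx hι hι' hab hL hθ hM hα hz fun δ hδ => ?_
  have hmem : hα.toLp α ∈ closure (G : Set (Lp V 2 (segMeasure a b))) := by
    rw [← Submodule.topologicalClosure_coe, hdense]; trivial
  obtain ⟨α', ⟨u, hu, hua⟩, hd⟩ := Metric.mem_closure_iff.1 hmem δ hδ
  refine ⟨α', 0, u, Lp.memLp α', hz, hu, by simp [hua, hδ.le], ?_, by simp⟩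
  rw [dist_comm, dist_eq_norm, Lp.norm_def] at hd
  have e : eLpNorm (⇑α' - α) 2 (segMeasure a b)
      = eLpNorm (α' - hα.toLp α : Lp V 2 (segMeasure a b)) 2 (segMeasure a b) := by
    refine eLpNorm_congr_ae ?_
    filter_upwards [hα.coeFn_toLp, Lp.coeFn_sub α' (hα.toLp α)] with t h1 h2
    rw [h2, Pi.sub_apply, Pi.sub_apply, h1]
  rw [e]
  exact (ENNReal.le_ofReal_iff_toReal_le (Lp.eLpNorm_ne_top _) hδ.le).2 hd.le

/-- Solvability of linear equations. The initial value is approximated by elements `y` of `V`, the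
source in `H` by simple functions, and subtracting the constant path `y` reduces the problem to a
source in `L²(a, b; V)` and initial value zero. -/
theorem exists_isLinSol (hι : Function.Injective ι) (hι' : DenseRange ι) (hab : a ≤ b)
    (hL : CoerciveFamily ι a b θ M C L) (hC : 0 ≤ C) (hθ : 0 < θ) (hM : 0 ≤ M) (x : H) {α : ℝ → V}
    {β : ℝ → H} (hα : MemLp α 2 (segMeasure a b)) (hβ : Integrable β (segMeasure a b)) :
    ∃ u, IsLinSol ι a b L α β u ∧ u a = x := by
  have hz : Integrable (0 : ℝ → H) (segMeasure a b) := integrable_zero _ _ _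
  refine exists_isLinSol_of_approx hι hι' hab hL hθ hM hα hβ fun δ hδ => ?_
  obtain ⟨y, hy⟩ := hι'.exists_dist_lt x hδ
  obtain ⟨β', hβ', hβ'1⟩ := (memLp_one_iff_integrable.2 hβ).exists_simpleFunc_eLpNorm_sub_lt
    (by norm_num) (ENNReal.ofReal_pos.2 hδ).ne'
  have hβ'2 : MemLp β' 2 (segMeasure a b) := β'.memLp_of_isFiniteMeasure 2 _
  have hm0 : MemLp (fun t => gram ι ((0 : ℝ → V) t) + L t (y + ∫ s in a..t, (0 : ℝ → V) s)) 2
      (segMeasure a b) := by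
    refine ((gram ι).comp_memLp' MemLp.zero').add (hL.memLp (memLp_of_continuousOn ?_ 2))
    simpa using continuousOn_const
  have hm1 : MemLp (fun t => α t + emb ι (β' t) - (gram ι ((0 : ℝ → V) t)
      + L t (y + ∫ s in a..t, (0 : ℝ → V) s))) 2 (segMeasure a b) :=
    (hα.add ((emb ι).comp_memLp' hβ'2)).sub hm0
  obtain ⟨w, hw, hwa⟩ := exists_isLinSol_zero hι hι' hab hL hC hθ hM hm1
  have h1 := IsLinSol.linear hι hL (isLinSol_primitive hι MemLp.zero' y) hw hm0 hz hm1 hz 1 1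
  refine ⟨α, β', _, hα, memLp_one_iff_integrable.1 hβ'1, IsSol.congr h1 (ae_of_all _ fun t => ?_),
    ?_, by simp, ?_⟩
  · simp
    abel
  · simp only [hwa, intervalIntegral.integral_same, add_zero, one_smul]
    rw [← dist_eq_norm, dist_comm]
    exact hy.le
  · rw [← eLpNorm_neg, neg_sub]
    exact hβ'.le

end LinearSolvability

/-! ### Local existence -/

section LocalExistence

open Filter Topology

variable {V H : Type*} [NormedAddCommGroup V] [InnerProductSpace ℝ V] [CompleteSpace V]
  [SecondCountableTopology V] [MeasurableSpace V] [BorelSpace V]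
  [NormedAddCommGroup H] [InnerProductSpace ℝ H] [CompleteSpace H] {ι : V →L[ℝ] H}
  {a b : ℝ}

theorem IsPath.eqOn {u u' : ℝ → H} (hu : IsPath ι a b u) (h : ∀ t ∈ Icc a b, u t = u' t) :
    IsPath ι a b u' := by
  have hae : ∀ᵐ t ∂segMeasure a b, u t = u' t := by
    filter_upwards [ae_restrict_mem measurableSet_Icc] with t ht using h t ht
  refine ⟨hu.cont.congr fun t ht => (h t ht).symm, ?_, (memLp_congr_ae ?_).1 hu.memLp⟩
  · filter_upwards [hu.mem_range, hae] with t h1 h2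
    rwa [← h2]
  · filter_upwards [hae] with t h2
    rw [h2]

theorem IsSol.eqOn {u u' : ℝ → H} {α : ℝ → V} {β : ℝ → H} (hu : IsSol ι a b α β u)
    (h : ∀ t ∈ Icc a b, u t = u' t) : IsSol ι a b α β u' := by
  refine ⟨hu.toIsPath.eqOn h, fun t ht => ?_⟩
  rw [← h t ht, ← h a (left_mem_Icc.2 (ht.1.trans ht.2))]
  exact hu.eq t ht

/-- Banach's fixed point theorem in a ball of `C([a, b]; H) ∩ L²(a, b; V)`. -/
theorem exists_fixedPoint (hι : Function.Injective ι) {Φ : (ℝ → H) → ℝ → H} {z : ℝ → H} {r : ℝ}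
    (hr : 0 < r) (hz : IsPath ι a b z)
    (hΦ : ∀ u, IsPath ι a b u → pnorm ι a b (fun t => u t - z t) ≤ ENNReal.ofReal r →
      IsPath ι a b (Φ u))
    (hcontr : ∀ u w, IsPath ι a b u → pnorm ι a b (fun t => u t - z t) ≤ ENNReal.ofReal r →
      IsPath ι a b w → pnorm ι a b (fun t => w t - z t) ≤ ENNReal.ofReal r → ∀ d : ℝ, 0 < d →
      pnorm ι a b (fun t => u t - w t) ≤ ENNReal.ofReal d →
      pnorm ι a b (fun t => Φ u t - Φ w t) ≤ ENNReal.ofReal (d / 2))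
    (hstart : pnorm ι a b (fun t => Φ z t - z t) ≤ ENNReal.ofReal (r / 2)) :
    ∃ u, IsPath ι a b u ∧ pnorm ι a b (fun t => u t - z t) ≤ ENNReal.ofReal r ∧
      ∀ t ∈ Icc a b, Φ u t = u t := by
  set u : ℕ → ℝ → H := fun k => Φ^[k] z with hu
  have hsucc : ∀ k, u (k + 1) = Φ (u k) := fun k => Function.iterate_succ_apply' Φ k z
  set q : ℕ → ℝ := fun k => (1 / 2) ^ k with hq
  have hq0 : ∀ k, 0 < q k := fun k => by positivity
  have hqs : ∀ k, q (k + 1) = q k / 2 := fun k => by simp only [hq, pow_succ]; ring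
  have hq1 : ∀ k, q k ≤ 1 := fun k => pow_le_one₀ (by norm_num) (by norm_num)
  have hmain : ∀ k, IsPath ι a b (u k) ∧
      pnorm ι a b (fun t => u k t - z t) ≤ ENNReal.ofReal (r * (1 - q k)) ∧
      pnorm ι a b (fun t => u (k + 1) t - u k t) ≤ ENNReal.ofReal (r / 2 * q k) := by
    intro k
    induction k with
    | zero =>
      refine ⟨hz, ?_, by simpa [hq, hu] using hstart⟩
      have h0 : (fun t => u 0 t - z t) = fun _ => (0 : H) := by ext t; simp [hu]
      rw [h0]
      have hl : lift ι (0 : H) = 0 := by simpa using lift_iota ι hι 0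
      simp [pnorm, hl]
    | succ k ih =>
      obtain ⟨h1, h2, h3⟩ := ih
      have hb : pnorm ι a b (fun t => u k t - z t) ≤ ENNReal.ofReal r := by
        refine h2.trans (ENNReal.ofReal_le_ofReal ?_)
        nlinarith [hq0 k]
      have hp : IsPath ι a b (u (k + 1)) := by rw [hsucc]; exact hΦ _ h1 hb
      have h4 : pnorm ι a b (fun t => u (k + 1) t - z t)
          ≤ ENNReal.ofReal (r * (1 - q (k + 1))) := by
        refine (hp.pnorm_sub_le hι h1 hz).trans ((add_le_add h3 h2).trans ?_)
        rw [← ENNReal.ofReal_add (by have := hq0 k; positivity)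
          (mul_nonneg hr.le (sub_nonneg.2 (hq1 k)))]
        refine ENNReal.ofReal_le_ofReal ?_
        rw [hqs]
        linarith
      refine ⟨hp, h4, ?_⟩
      have hb' : pnorm ι a b (fun t => u (k + 1) t - z t) ≤ ENNReal.ofReal r := by
        refine h4.trans (ENNReal.ofReal_le_ofReal ?_)
        nlinarith [hq0 (k + 1)]
      have h5 := hcontr _ _ hp hb' h1 hb _ (by have := hq0 k; positivity) h3
      rw [← hsucc, ← hsucc] at h5
      rw [hqs, mul_div_assoc']
      exact h5
  have hball : ∀ k, pnorm ι a b (fun t => u k t - z t) ≤ ENNReal.ofReal r := fun k => by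
    refine (hmain k).2.1.trans (ENNReal.ofReal_le_ofReal ?_)
    nlinarith [hq0 k]
  have htail : ∀ n j, pnorm ι a b (fun t => u (n + j) t - u n t)
      ≤ ENNReal.ofReal (r * (q n - q (n + j))) := by
    intro n j
    induction j with
    | zero =>
      have h0 : (fun t => u (n + 0) t - u n t) = fun _ => (0 : H) := by ext t; simp
      have hl : lift ι (0 : H) = 0 := by simpa using lift_iota ι hι 0
      rw [h0]
      simp [pnorm, hl]
    | succ j ih =>
      have hle : q (n + j) ≤ q n := pow_le_pow_of_le_one (by norm_num) (by norm_num) (by omega)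
      refine ((hmain (n + j + 1)).1.pnorm_sub_le hι (hmain (n + j)).1 (hmain n).1).trans
        ((add_le_add (hmain (n + j)).2.2 ih).trans ?_)
      rw [← ENNReal.ofReal_add (by have := hq0 (n + j); positivity)
        (mul_nonneg hr.le (sub_nonneg.2 hle)), ← add_assoc, hqs]
      refine ENNReal.ofReal_le_ofReal ?_
      linarith
  have hcau : ∀ N n m, N ≤ n → N ≤ m →
      pnorm ι a b (fun t => u n t - u m t) < ENNReal.ofReal (2 * r * q N) := by
    have hone : ∀ N n m, N ≤ n → n ≤ m →
        pnorm ι a b (fun t => u m t - u n t) < ENNReal.ofReal (2 * r * q N) := by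
      intro N n m hn hm
      obtain ⟨j, rfl⟩ := Nat.exists_eq_add_of_le hm
      refine (htail n j).trans_lt ?_
      have hN := hq0 N
      rw [ENNReal.ofReal_lt_ofReal_iff (by positivity)]
      have hle : q n ≤ q N := pow_le_pow_of_le_one (by norm_num) (by norm_num) hn
      nlinarith [hq0 (n + j)]
    intro N n m hn hm
    rcases le_total n m with h | h
    · rw [(hmain n).1.pnorm_sub_comm hι (hmain m).1]
      exact hone N n m hn h
    · exact hone N m n hm h
  have hsum : ∑' n, ENNReal.ofReal (2 * r * q n) ≠ ∞ :=
    ((summable_geometric_of_lt_one (by norm_num) (by norm_num)).mul_left _).tsum_ofReal_ne_top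
  obtain ⟨w, hw, hlim⟩ := exists_limit_path hι (fun k => (hmain k).1) hsum hcau
  have hwz : pnorm ι a b (fun t => w t - z t) ≤ ENNReal.ofReal r := by
    have h1 : Tendsto (fun n => pnorm ι a b (fun t => u n t - w t) + ENNReal.ofReal r) atTop
        (𝓝 (0 + ENNReal.ofReal r)) := hlim.add_const _
    rw [zero_add] at h1
    refine ge_of_tendsto' h1 fun n => ?_
    refine (hw.pnorm_sub_le hι (hmain n).1 hz).trans (add_le_add ?_ (hball n))
    rw [hw.pnorm_sub_comm hι (hmain n).1]
  have hΦw := hΦ w hw hwz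
  refine ⟨w, hw, hwz, fun t ht => ?_⟩
  have hsmall : ∀ ε : ℝ, 0 < ε → ‖Φ w t - w t‖ ≤ 2 * ε := by
    intro ε hε
    obtain ⟨n, hn⟩ := (ENNReal.tendsto_atTop_zero.1 hlim) (ENNReal.ofReal ε)
      (ENNReal.ofReal_pos.2 hε)
    have h1 := hn n le_rfl
    have h2 := hn (n + 1) (Nat.le_succ n)
    have h3 := hcontr _ _ (hmain n).1 (hball n) hw hwz ε hε h1
    rw [← hsucc] at h3
    have h4 : pnorm ι a b (fun t => Φ w t - w t) ≤ ENNReal.ofReal (2 * ε) := by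
      refine (hΦw.pnorm_sub_le hι (hmain (n + 1)).1 hw).trans ?_
      rw [hΦw.pnorm_sub_comm hι (hmain (n + 1)).1]
      refine (add_le_add h3 h2).trans ?_
      rw [← ENNReal.ofReal_add (by positivity) hε.le]
      exact ENNReal.ofReal_le_ofReal (by linarith)
    exact norm_le_of_pnorm_le (u := fun t => Φ w t - w t) (by positivity) h4 ht
  rw [← sub_eq_zero, ← norm_le_zero_iff]
  refine le_of_forall_pos_le_add fun ε hε => ?_
  linarith [hsmall (ε / 2) (by positivity)]

variable (ι) in
/-- The nonlinearities of the evolution equation `u' = N(t, u) + σ(t, u)` on `[0, T]`, with `N` in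
`V*` (read in `V`) and `σ` in `H`. The weight `(1 + ‖v₁‖ + ‖v₂‖) ‖v₁ - v₂‖_H` has the critical
homogeneity for the space `C([0, T]; H) ∩ L²(0, T; V)`. The field `linearization` says that near
each `y ∈ V`, in the norm of `H`, there are coercive linear operators `L` such that `N + L` has an
arbitrarily small Lipschitz constant in the norm of `V`; the neighbourhood and the constants do not
depend on `y` in a ball of `H`, so that `y` can be chosen close to a given initial value in `H`. -/
structure Nonlinearity (T : ℝ) (N : ℝ → V → V) (σ : ℝ → V → H) : Prop where
  memLp_comp : ∀ (a b n : ℝ) (v : ℝ → V), 0 ≤ a → b ≤ T → MemLp v 2 (segMeasure a b) →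
    (∀ᵐ t ∂segMeasure a b, ‖ι (v t)‖ ≤ n) → MemLp (fun t => N t (v t)) 2 (segMeasure a b)
  integrable_comp : ∀ (a b n : ℝ) (v : ℝ → V), 0 ≤ a → b ≤ T → MemLp v 2 (segMeasure a b) →
    (∀ᵐ t ∂segMeasure a b, ‖ι (v t)‖ ≤ n) → Integrable (fun t => σ t (v t)) (segMeasure a b)
  lipschitz : ∀ n : ℝ, ∃ κ : ℝ → ℝ, MemLp κ 2 (segMeasure 0 T) ∧ (∀ t, 0 ≤ κ t) ∧
    ∀ t ∈ Icc 0 T, ∀ v w : V, ‖ι v‖ ≤ n → ‖ι w‖ ≤ n →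
      ‖σ t v - σ t w‖ ≤ κ t * (‖v - w‖ + (1 + ‖v‖ + ‖w‖) * ‖ι v - ι w‖)
  linearization : ∀ n : ℝ, ∃ θ M C : ℝ, 0 < θ ∧ 0 ≤ M ∧ 0 ≤ C ∧ ∀ η : ℝ, 0 < η →
    ∃ δ C' : ℝ, 0 < δ ∧ 0 ≤ C' ∧ ∀ y : V, ‖ι y‖ ≤ n → ∃ L : ℝ → V →L[ℝ] V,
      CoerciveFamily ι 0 T θ M C L ∧
      ∀ t ∈ Icc 0 T, ∀ v w : V, ‖ι v - ι y‖ ≤ δ → ‖ι w - ι y‖ ≤ δ →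
        ‖N t v + L t v - (N t w + L t w)‖
          ≤ η * ‖v - w‖ + C' * (1 + ‖v‖ + ‖w‖) * ‖ι v - ι w‖
  monotone : ∀ n : ℝ, ∃ (θ : ℝ) (ρ : ℝ → ℝ) (C : ℝ), 0 < θ ∧ 0 ≤ C ∧
    Integrable ρ (segMeasure 0 T) ∧ (∀ t, 0 ≤ ρ t) ∧
    ∀ t ∈ Icc 0 T, ∀ v w : V, ‖ι v‖ ≤ n → ‖ι w‖ ≤ n →
      inner ℝ (N t v - N t w) (v - w) + inner ℝ (σ t v - σ t w) (ι v - ι w)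
        ≤ -θ * ‖v - w‖ ^ 2 + (ρ t + C * (‖v‖ ^ 2 + ‖w‖ ^ 2)) * ‖ι v - ι w‖ ^ 2

theorem IsPath.exists_bound {u : ℝ → H} (hu : IsPath ι a b u) :
    ∃ n, ∀ t ∈ Icc a b, ‖u t‖ ≤ n :=
  isCompact_Icc.exists_bound_of_continuousOn hu.cont

theorem IsPath.ae_norm_lift_le {u : ℝ → H} (hu : IsPath ι a b u) {n : ℝ}
    (hn : ∀ t ∈ Icc a b, ‖u t‖ ≤ n) : ∀ᵐ t ∂segMeasure a b, ‖ι (lift ι (u t))‖ ≤ n := by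
  filter_upwards [hu.ae_eq, ae_restrict_mem measurableSet_Icc] with t h1 h2
  rw [h1]
  exact hn t h2

theorem Nonlinearity.memLp {T : ℝ} {N : ℝ → V → V} {σ : ℝ → V → H} (hP : Nonlinearity ι T N σ)
    (a b : ℝ) (u : ℝ → H) (ha : 0 ≤ a) (hb : b ≤ T) (hu : IsPath ι a b u) :
    MemLp (fun t => N t (lift ι (u t))) 2 (segMeasure a b) := by
  obtain ⟨n, hn⟩ := hu.exists_bound
  exact hP.memLp_comp a b n _ ha hb hu.memLp (hu.ae_norm_lift_le hn)

theorem Nonlinearity.integrable {T : ℝ} {N : ℝ → V → V} {σ : ℝ → V → H}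
    (hP : Nonlinearity ι T N σ) (a b : ℝ) (u : ℝ → H) (ha : 0 ≤ a) (hb : b ≤ T)
    (hu : IsPath ι a b u) : Integrable (fun t => σ t (lift ι (u t))) (segMeasure a b) := by
  obtain ⟨n, hn⟩ := hu.exists_bound
  exact hP.integrable_comp a b n _ ha hb hu.memLp (hu.ae_norm_lift_le hn)

variable (ι) in
/-- `u` solves `u' = N(t, u) + σ(t, u)` on `[a, b]`. -/
def IsNSol (a b : ℝ) (N : ℝ → V → V) (σ : ℝ → V → H) (u : ℝ → H) : Prop :=
  IsSol ι a b (fun t => N t (lift ι (u t))) (fun t => σ t (lift ι (u t))) u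

theorem eventually_integral_le {f : ℝ → ℝ} (hab : a < b) (hf : Integrable f (segMeasure a b))
    {ε : ℝ} (hε : 0 < ε) : ∀ᶠ c in 𝓝[>] a, ∫ t, f t ∂segMeasure a c ≤ ε := by
  have h1 : Tendsto (fun t => ∫ s in a..t, f s) (𝓝[Icc a b] a) (𝓝 0) := by
    have := continuousOn_integral hf a (left_mem_Icc.2 hab.le)
    simpa [ContinuousWithinAt] using this
  have h2 : 𝓝[>] a ≤ 𝓝[Icc a b] a := by
    rw [← nhdsWithin_Ioc_eq_nhdsGT hab]
    exact nhdsWithin_mono _ Ioc_subset_Icc_self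
  filter_upwards [(h1.mono_left h2).eventually (gt_mem_nhds hε), self_mem_nhdsWithin] with c hc hac
  rw [integral_segMeasure (le_of_lt hac)]
  exact hc.le

end LocalExistence

section LocalExistenceTheorem

open Filter Topology

variable {V H : Type*} [NormedAddCommGroup V] [InnerProductSpace ℝ V] [CompleteSpace V]
  [SecondCountableTopology V] [MeasurableSpace V] [BorelSpace V]
  [NormedAddCommGroup H] [InnerProductSpace ℝ H] [CompleteSpace H] {ι : V →L[ℝ] H}
  {T : ℝ} {N : ℝ → V → V} {σ : ℝ → V → H}

theorem integral_const_mul_add {μ : Measure ℝ} {f g : ℝ → ℝ} (hf : Integrable f μ)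
    (hg : Integrable g μ) (p q : ℝ) :
    ∫ t, (p * f t + q * g t) ∂μ = p * ∫ t, f t ∂μ + q * ∫ t, g t ∂μ := by
  rw [integral_add (hf.const_mul p) (hg.const_mul q), integral_const_mul, integral_const_mul]

theorem integral_const_mul_add₃ {μ : Measure ℝ} {f g h : ℝ → ℝ} (hf : Integrable f μ)
    (hg : Integrable g μ) (hh : Integrable h μ) (p q r : ℝ) :
    ∫ t, (p * f t + q * g t + r * h t) ∂μ
      = p * ∫ t, f t ∂μ + q * ∫ t, g t ∂μ + r * ∫ t, h t ∂μ := by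
  have h1 : Integrable (fun t => p * f t + q * g t) μ := (hf.const_mul p).add (hg.const_mul q)
  rw [integral_add h1 (hh.const_mul r), integral_const_mul_add hf hg, integral_const_mul]

set_option maxHeartbeats 1000000 in
/-- Local existence from an arbitrary initial value. The equation is linearized at a point `y ∈ V`
close to the initial value in `H`, and the solution is found by Banach's fixed point theorem near
the solution `z` of the linearized homogeneous equation. -/
theorem Nonlinearity.exists_local (hP : Nonlinearity ι T N σ) (hι : Function.Injective ι)
    (hι' : DenseRange ι) {t₀ : ℝ} (h0 : 0 ≤ t₀) (hT : t₀ < T) (x : H) :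
    ∃ t₁, t₀ < t₁ ∧ t₁ ≤ T ∧ ∃ u, IsNSol ι t₀ t₁ N σ u ∧ u t₀ = x := by
  obtain ⟨θ, M, C, hθ, hM, hC, hlin⟩ := hP.linearization (‖x‖ + 2)
  set K : ℝ := linConst θ M T with hK
  have hK0 : 0 < K := linConst_pos hθ
  obtain ⟨δ₀, C', hδ₀, hC', hlin⟩ := hlin (1 / (4 * K)) (by positivity)
  obtain ⟨κ, hκ, hκ0, hlip⟩ := hP.lipschitz (‖x‖ + 2)
  set δ := min δ₀ 1 with hδ
  have hδpos : 0 < δ := lt_min hδ₀ one_pos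
  have hδ1 : δ ≤ 1 := min_le_right _ _
  have hδδ : δ ≤ δ₀ := min_le_left _ _
  obtain ⟨y, hy⟩ := hι'.exists_dist_lt x (show 0 < δ / 3 by positivity)
  rw [dist_eq_norm] at hy
  have hyn : ‖ι y‖ ≤ ‖x‖ + 2 := by
    have := norm_sub_norm_le (ι y) x
    rw [norm_sub_rev] at this
    linarith
  obtain ⟨L, hL, hlin⟩ := hlin y hyn
  have hL0 : CoerciveFamily ι t₀ T θ M C L := hL.mono h0 le_rfl
  obtain ⟨z, hz, hzx⟩ := exists_isLinSol hι hι' hT.le hL0 hC hθ hM x (α := 0) (β := 0) MemLp.zero'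
    (integrable_zero _ _ _)
  -- `s₀` bounds the integral of `(1 + ‖u‖_V + ‖w‖_V)²` up to a factor `3`
  set s₀ : ℝ := min 1 (1 / (48 * (C' ^ 2 + 1) * K ^ 2)) with hs₀
  have hs₀pos : 0 < s₀ := lt_min one_pos (by positivity)
  have hs₀1 : s₀ ≤ 1 := min_le_left _ _
  have hs₀2 : 6 * C' ^ 2 * s₀ ≤ 1 / (8 * K ^ 2) := by
    have h1 : s₀ ≤ 1 / (48 * (C' ^ 2 + 1) * K ^ 2) := min_le_right _ _
    calc 6 * C' ^ 2 * s₀ ≤ 6 * (C' ^ 2 + 1) * (1 / (48 * (C' ^ 2 + 1) * K ^ 2)) := by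
          gcongr; linarith
      _ = 1 / (8 * K ^ 2) := by field_simp; norm_num
  set r : ℝ := min (δ / 3) (s₀ / 8) with hr
  have hrpos : 0 < r := lt_min (by positivity) (by positivity)
  have hrδ : r ≤ δ / 3 := min_le_left _ _
  have hrs : 4 * r ^ 2 ≤ s₀ / 2 := by
    have h1 : r ≤ s₀ / 8 := min_le_right _ _
    nlinarith
  -- on a short interval the integrals of `1 + 4 ‖z‖²` and `κ²` and the residual of `z` are small
  have hzR2 := hz.isPath
  have hRm : ∀ a b u, 0 ≤ a → b ≤ T → IsPath ι a b u →
      MemLp (fun t => N t (lift ι (u t)) + L t (lift ι (u t))) 2 (segMeasure a b) :=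
    fun a b u ha hb hu => (hP.memLp a b u ha hb hu).add ((hL.mono ha hb).memLp hu.memLp)
  have hf1 : Integrable (fun t => 1 + 4 * ‖lift ι (z t)‖ ^ 2) (segMeasure t₀ T) :=
    (integrable_const _).add (hzR2.integrable_sq.const_mul 4)
  have hf2 : Integrable (fun t => κ t ^ 2) (segMeasure t₀ T) :=
    (hκ.integrable_sq).mono_measure (Measure.restrict_mono (Icc_subset_Icc_left h0) le_rfl)
  have hf3m := hRm t₀ T z h0 le_rfl hzR2
  have hf3 := (memLp_two_iff_integrable_sq_norm hf3m.1).1 hf3m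
  have hf4 := (hP.integrable t₀ T z h0 le_rfl hzR2).norm
  have hev1 := eventually_integral_le hT hf1 (show 0 < s₀ / 2 by positivity)
  have hev2 := eventually_integral_le hT hf2 (show 0 < 1 / (32 * K ^ 2) by positivity)
  have hev3 := eventually_integral_le hT hf3 (show 0 < (r / (2 * K)) ^ 2 by positivity)
  have hev4 := eventually_integral_le hT hf4 (show 0 < r / (2 * K) by positivity)
  have hev5 : ∀ᶠ c in 𝓝[>] t₀, ∀ t ∈ Icc t₀ c, c ≤ T → ‖z t - x‖ ≤ δ / 3 := by
    have hc := hzR2.cont t₀ (left_mem_Icc.2 hT.le)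
    obtain ⟨ε, hε, hc⟩ := Metric.continuousWithinAt_iff.1 hc (δ / 3) (by positivity)
    have : Ioo t₀ (t₀ + ε) ∈ 𝓝[>] t₀ := Ioo_mem_nhdsGT (by linarith)
    filter_upwards [this] with c hc' t ht hcT
    have h1 := hc (x := t) ⟨ht.1, ht.2.trans hcT⟩ (by
      rw [Real.dist_eq, abs_of_nonneg (by linarith [ht.1])]; linarith [ht.2, hc'.2])
    rw [hzx, dist_eq_norm] at h1
    exact h1.le
  have hev6 : ∀ᶠ c in 𝓝[>] t₀, c ∈ Ioc t₀ T := Ioc_mem_nhdsGT hT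
  obtain ⟨t₁, h1, h2, h3, h4, h5, h6, h7⟩ :=
    (hev1.and (hev2.and (hev3.and (hev4.and (hev5.and hev6))))).exists
  have h5' : ∀ t ∈ Icc t₀ t₁, ‖z t - x‖ ≤ δ / 3 := fun t ht => h5 t ht h7
  refine ⟨t₁, h6, h7, ?_⟩
  have hle : segMeasure t₀ t₁ ≤ segMeasure t₀ T :=
    Measure.restrict_mono (Icc_subset_Icc_right h7) le_rfl
  have hle0 : segMeasure t₀ t₁ ≤ segMeasure 0 T :=
    Measure.restrict_mono (Icc_subset_Icc h0 h7) le_rfl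
  have hL1 : CoerciveFamily ι t₀ t₁ θ M C L := hL.mono h0 h7
  have hz1 : IsLinSol ι t₀ t₁ L 0 0 z :=
    IsSol.mono hz (hz.memLp hL0 MemLp.zero') (integrable_zero _ _ _) le_rfl h7
  have hzp := hz1.isPath
  have hconst : ∀ d : ℝ, 0 < d → linConst θ M (t₁ - t₀) * (d / (2 * K)) ≤ d / 2 := by
    intro d hd
    have := linConst_mono hθ hM (show t₁ - t₀ ≤ T by linarith)
    calc _ ≤ K * (d / (2 * K)) := by gcongr
      _ = d / 2 := by field_simp
  -- `Φ u` solves the linear equation `w' + L w = (N(t, u) + L u) + σ(t, u)`, `w(t₀) = x`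
  have hex : ∀ u : ℝ → H, ∃ w, IsPath ι t₀ t₁ u →
      IsLinSol ι t₀ t₁ L (fun t => N t (lift ι (u t)) + L t (lift ι (u t)))
        (fun t => σ t (lift ι (u t))) w ∧ w t₀ = x := by
    intro u
    by_cases hu : IsPath ι t₀ t₁ u
    · obtain ⟨w, hw⟩ := exists_isLinSol hι hι' h6.le hL1 hC hθ hM x (hRm _ _ u h0 h7 hu)
        (hP.integrable _ _ u h0 h7 hu)
      exact ⟨w, fun _ => hw⟩
    · exact ⟨0, fun h => absurd h hu⟩
  choose Φ hΦ using hex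
  have hclose : ∀ u, IsPath ι t₀ t₁ u → pnorm ι t₀ t₁ (fun t => u t - z t) ≤ ENNReal.ofReal r →
      ∀ᵐ t ∂segMeasure t₀ t₁, t ∈ Icc 0 T ∧ ι (lift ι (u t)) = u t ∧
        ‖ι (lift ι (u t)) - ι y‖ ≤ δ₀ ∧ ‖ι (lift ι (u t))‖ ≤ ‖x‖ + 2 := by
    intro u hu hur
    filter_upwards [hu.ae_eq, ae_restrict_mem measurableSet_Icc] with t ht ht'
    have e1 := norm_le_of_pnorm_le (u := fun t => u t - z t) hrpos.le hur ht'
    have e2 := h5' t ht'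
    rw [ht]
    refine ⟨⟨h0.trans ht'.1, ht'.2.trans h7⟩, rfl, ?_, ?_⟩
    · have e : u t - ι y = (u t - z t) + (z t - x) + (x - ι y) := by abel
      rw [e]
      refine (norm_add₃_le).trans ?_
      linarith
    · have e : u t = (u t - z t) + (z t - x) + x := by abel
      rw [e]
      refine (norm_add₃_le).trans ?_
      linarith
  suffices hfp : ∃ u, IsPath ι t₀ t₁ u ∧ ∀ t ∈ Icc t₀ t₁, Φ u t = u t by
    obtain ⟨u, hu, hfix⟩ := hfp
    refine ⟨Φ u, ?_, (hΦ u hu).2⟩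
    have hsol := (hΦ u hu).1
    refine IsSol.congr hsol ?_
    filter_upwards [ae_restrict_mem measurableSet_Icc] with t ht
    rw [hfix t ht]
    simp
  refine (exists_fixedPoint hι (Φ := Φ) hrpos hzp (fun u hu _ => (hΦ u hu).1.isPath)
    ?_ ?_).imp fun u h => ⟨h.1, h.2.2⟩
  · intro u w hu hur hw hwr d hd hd'
    have hsub := (hΦ u hu).1.sub hι hL1 (hΦ w hw).1 (hRm _ _ u h0 h7 hu)
      (hP.integrable _ _ u h0 h7 hu) (hRm _ _ w h0 h7 hw) (hP.integrable _ _ w h0 h7 hw)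
    have hα := (hRm _ _ u h0 h7 hu).sub (hRm _ _ w h0 h7 hw)
    have hβ := (hP.integrable _ _ u h0 h7 hu).sub (hP.integrable _ _ w h0 h7 hw)
    have huw := hu.sub hι hw
    have hW := huw.1.integral_le_of_pnorm_le hd.le hd'
    have hWi := huw.1.integrable_sq
    have hub := (hu.sub hι hzp).1.integral_le_of_pnorm_le hrpos.le hur
    have hwb := (hw.sub hι hzp).1.integral_le_of_pnorm_le hrpos.le hwr
    have hubi := (hu.sub hι hzp).1.integrable_sq
    have hwbi := (hw.sub hι hzp).1.integrable_sq
    have hf1' := hf1.mono_measure hle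
    have hf2' := hf2.mono_measure hle
    -- a majorant of `(1 + ‖u‖ + ‖w‖)²`
    set X : ℝ → ℝ := fun t => 3 * (1 + 4 * ‖lift ι (z t)‖ ^ 2) + 6 * ‖lift ι (u t - z t)‖ ^ 2
      + 6 * ‖lift ι (w t - z t)‖ ^ 2 with hX
    have hXi : Integrable X (segMeasure t₀ t₁) :=
      ((hf1'.const_mul 3).add (hubi.const_mul 6)).add (hwbi.const_mul 6)
    have hXint : ∫ t, X t ∂segMeasure t₀ t₁ ≤ 3 * s₀ := by
      have e := integral_const_mul_add₃ hf1' hubi hwbi 3 6 6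
      have e' : ∫ t, X t ∂segMeasure t₀ t₁ = _ := e
      rw [e']
      linarith
    have hpt : ∀ᵐ t ∂segMeasure t₀ t₁,
        (1 + ‖lift ι (u t)‖ + ‖lift ι (w t)‖) ^ 2 ≤ X t := by
      filter_upwards [(hu.sub hι hzp).2, (hw.sub hι hzp).2] with t e1 e2
      have n1 : ‖lift ι (u t)‖ ≤ ‖lift ι (u t - z t)‖ + ‖lift ι (z t)‖ := by
        rw [e1]; simpa using norm_add_le (lift ι (u t) - lift ι (z t)) (lift ι (z t))
      have n2 : ‖lift ι (w t)‖ ≤ ‖lift ι (w t - z t)‖ + ‖lift ι (z t)‖ := by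
        rw [e2]; simpa using norm_add_le (lift ι (w t) - lift ι (z t)) (lift ι (z t))
      have sq3 : ∀ p q s : ℝ, (p + q + s) ^ 2 ≤ 3 * (p ^ 2 + q ^ 2 + s ^ 2) := fun p q s => by
        nlinarith [sq_nonneg (p - q), sq_nonneg (q - s), sq_nonneg (p - s)]
      have sq2 : ∀ p q s : ℝ, 0 ≤ p → p ≤ q + s → p ^ 2 ≤ 2 * q ^ 2 + 2 * s ^ 2 :=
        fun p q s hp h => by nlinarith [sq_nonneg (q - s)]
      have m1 := sq2 _ _ _ (norm_nonneg _) n1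
      have m2 := sq2 _ _ _ (norm_nonneg _) n2
      have m3 := sq3 1 ‖lift ι (u t)‖ ‖lift ι (w t)‖
      simp only [hX]
      linarith
    refine (hsub.pnorm_le hι hι' h6.le hL1 hθ hM hα hβ (δ := d / (2 * K)) (by positivity) ?_ ?_
      ?_).trans (ENNReal.ofReal_le_ofReal (hconst d hd))
    · rw [(hΦ u hu).2, (hΦ w hw).2, sub_self, norm_zero]; positivity
    · have hmaj : ∀ᵐ t ∂segMeasure t₀ t₁,
          ‖N t (lift ι (u t)) + L t (lift ι (u t)) - (N t (lift ι (w t)) + L t (lift ι (w t)))‖ ^ 2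
          ≤ 2 * (1 / (4 * K)) ^ 2 * ‖lift ι (u t - w t)‖ ^ 2 + 2 * C' ^ 2 * d ^ 2 * X t := by
        filter_upwards [hclose u hu hur, hclose w hw hwr, hpt, huw.2,
          ae_restrict_mem measurableSet_Icc] with t c1 c2 c3 c4 ht
        have e1 := hlin t c1.1 _ _ c1.2.2.1 c2.2.2.1
        rw [c1.2.1, c2.2.1, ← c4] at e1
        have e2 := norm_le_of_pnorm_le (u := fun t => u t - w t) hd.le hd' ht
        set Y := 1 + ‖lift ι (u t)‖ + ‖lift ι (w t)‖ with hY
        have hY0 : 0 ≤ Y := by positivity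
        have e3 : C' * Y * ‖u t - w t‖ ≤ C' * Y * d := by gcongr
        have e4 := pow_le_pow_left₀ (norm_nonneg _) (e1.trans (add_le_add_right e3 _)) 2
        refine e4.trans ?_
        have e5 : C' ^ 2 * d ^ 2 * Y ^ 2 ≤ C' ^ 2 * d ^ 2 * X t := by gcongr
        nlinarith [sq_nonneg (1 / (4 * K) * ‖lift ι (u t - w t)‖ - C' * Y * d)]
      refine (integral_mono_of_nonneg (ae_of_all _ fun t => by positivity)
        ((hWi.const_mul _).add (hXi.const_mul _)) hmaj).trans ?_
      refine (integral_const_mul_add hWi hXi _ _).trans_le ?_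
      have e1 : 2 * (1 / (4 * K)) ^ 2 * ∫ t, ‖lift ι (u t - w t)‖ ^ 2 ∂segMeasure t₀ t₁
          ≤ 2 * (1 / (4 * K)) ^ 2 * d ^ 2 := by gcongr
      have e2 : 2 * C' ^ 2 * d ^ 2 * ∫ t, X t ∂segMeasure t₀ t₁
          ≤ 2 * C' ^ 2 * d ^ 2 * (3 * s₀) := by gcongr
      have e3 : d ^ 2 * (6 * C' ^ 2 * s₀) ≤ d ^ 2 * (1 / (8 * K ^ 2)) := by gcongr
      have e4 : 2 * (1 / (4 * K)) ^ 2 * d ^ 2 + d ^ 2 * (1 / (8 * K ^ 2)) = (d / (2 * K)) ^ 2 := by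
        field_simp; norm_num
      linarith
    · have hmaj : ∀ᵐ t ∂segMeasure t₀ t₁, ‖σ t (lift ι (u t)) - σ t (lift ι (w t))‖
          ≤ 8 * K * d * κ t ^ 2 + 1 / (16 * K * d) * ‖lift ι (u t - w t)‖ ^ 2
            + d / (16 * K) * X t := by
        filter_upwards [hclose u hu hur, hclose w hw hwr, hpt, huw.2,
          ae_restrict_mem measurableSet_Icc] with t c1 c2 c3 c4 ht
        have e1 := hlip t c1.1 _ _ c1.2.2.2 c2.2.2.2
        rw [c1.2.1, c2.2.1, ← c4] at e1
        have e2 := norm_le_of_pnorm_le (u := fun t => u t - w t) hd.le hd' ht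
        set Y := 1 + ‖lift ι (u t)‖ + ‖lift ι (w t)‖ with hY
        set W := ‖lift ι (u t - w t)‖ with hW'
        have hY0 : 0 ≤ Y := by positivity
        have e3 : κ t * (W + Y * ‖u t - w t‖) ≤ κ t * (W + Y * d) := by
          have := hκ0 t
          gcongr
        refine (e1.trans e3).trans ?_
        have e5 : d / (16 * K) * Y ^ 2 ≤ d / (16 * K) * X t := by gcongr
        have e6 : 8 * K * d * κ t ^ 2 + 1 / (16 * K * d) * W ^ 2 + d / (16 * K) * Y ^ 2
            - κ t * (W + Y * d) = 1 / (32 * K * d) * ((16 * K * d * κ t - (W + Y * d)) ^ 2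
              + (W - Y * d) ^ 2) := by
          field_simp; ring
        have e7 : 0 ≤ 1 / (32 * K * d) * ((16 * K * d * κ t - (W + Y * d)) ^ 2
              + (W - Y * d) ^ 2) := by positivity
        linarith
      refine (integral_mono_of_nonneg (ae_of_all _ fun t => by positivity)
        (((hf2'.const_mul _).add (hWi.const_mul _)).add (hXi.const_mul _)) hmaj).trans ?_
      refine (integral_const_mul_add₃ hf2' hWi hXi _ _ _).trans_le ?_
      have e0 : 8 * K * d * ∫ t, κ t ^ 2 ∂segMeasure t₀ t₁ ≤ 8 * K * d * (1 / (32 * K ^ 2)) := by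
        gcongr
      have e1 : 1 / (16 * K * d) * ∫ t, ‖lift ι (u t - w t)‖ ^ 2 ∂segMeasure t₀ t₁
          ≤ 1 / (16 * K * d) * d ^ 2 := by gcongr
      have e2 : d / (16 * K) * ∫ t, X t ∂segMeasure t₀ t₁ ≤ d / (16 * K) * (3 * 1) := by
        gcongr
        linarith
      have e4 : 8 * K * d * (1 / (32 * K ^ 2)) + (1 / (16 * K * d) * d ^ 2 + d / (16 * K) * (3 * 1))
          = d / (2 * K) := by
        field_simp; norm_num
      linarith
  · have hsub := (hΦ z hzp).1.sub hι hL1 hz1 (hRm _ _ z h0 h7 hzp)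
      (hP.integrable _ _ z h0 h7 hzp) MemLp.zero' (integrable_zero _ _ _)
    have hα := (hRm _ _ z h0 h7 hzp).sub (MemLp.zero' (p := 2) (μ := segMeasure t₀ t₁) (ε := V))
    have hβ := (hP.integrable _ _ z h0 h7 hzp).sub (integrable_zero ℝ H (segMeasure t₀ t₁))
    refine (hsub.pnorm_le hι hι' h6.le hL1 hθ hM hα hβ (δ := r / (2 * K)) (by positivity) ?_ ?_
      ?_).trans (ENNReal.ofReal_le_ofReal (hconst r hrpos))
    · rw [(hΦ z hzp).2, hzx, sub_self, norm_zero]; positivity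
    · simpa using h3
    · simpa using h4

end LocalExistenceTheorem

/-! ### Uniqueness and continuation -/

section Global

open Filter Topology

variable {V H : Type*} [NormedAddCommGroup V] [InnerProductSpace ℝ V] [CompleteSpace V]
  [SecondCountableTopology V] [MeasurableSpace V] [BorelSpace V]
  [NormedAddCommGroup H] [InnerProductSpace ℝ H] [CompleteSpace H] {ι : V →L[ℝ] H}
  {T : ℝ} {N : ℝ → V → V} {σ : ℝ → V → H} {a b c : ℝ}

theorem IsPath.glue {u : ℝ → H} (hab : a ≤ b) (hbc : b ≤ c) (h₁ : IsPath ι a b u)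
    (h₂ : IsPath ι b c u) : IsPath ι a c u := by
  have hun : Icc a c = Icc a b ∪ Icc b c := (Icc_union_Icc_eq_Icc hab hbc).symm
  refine ⟨?_, ?_, ?_⟩
  · rw [hun]
    exact h₁.cont.union_of_isClosed h₂.cont isClosed_Icc isClosed_Icc
  · rw [segMeasure, hun, ae_restrict_union_iff]
    exact ⟨h₁.mem_range, h₂.mem_range⟩
  · rw [memLp_two_iff_integrable_sq_norm]
    · rw [segMeasure, hun]
      exact IntegrableOn.union h₁.integrable_sq h₂.integrable_sq
    · rw [segMeasure, hun, aestronglyMeasurable_union_iff]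
      exact ⟨h₁.memLp.1, h₂.memLp.1⟩

theorem IsNSol.eqOn {u u' : ℝ → H} (hu : IsNSol ι a b N σ u) (h : ∀ t ∈ Icc a b, u t = u' t) :
    IsNSol ι a b N σ u' := by
  refine (IsSol.eqOn hu h).congr ?_
  filter_upwards [ae_restrict_mem measurableSet_Icc] with t ht
  rw [h t ht]

theorem IsNSol.isPath {u : ℝ → H} (hu : IsNSol ι a b N σ u) : IsPath ι a b u := hu.toIsPath

theorem IsNSol.mono (hP : Nonlinearity ι T N σ) {u : ℝ → H} (ha : 0 ≤ a) (hb : b ≤ T)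
    (hu : IsNSol ι a b N σ u) {a' b' : ℝ} (ha' : a ≤ a') (hb' : b' ≤ b) :
    IsNSol ι a' b' N σ u :=
  IsSol.mono hu (hP.memLp a b u ha hb hu.isPath) (hP.integrable a b u ha hb hu.isPath) ha' hb'

theorem IsNSol.glue (hP : Nonlinearity ι T N σ) (ha : 0 ≤ a) (hab : a ≤ b) (hbc : b ≤ c)
    (hc : c ≤ T) {u : ℝ → H} (h₁ : IsNSol ι a b N σ u) (h₂ : IsNSol ι b c N σ u) :
    IsNSol ι a c N σ u := by
  have hpath := h₁.isPath.glue hab hbc h₂.isPath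
  have hi := integrable_source (ι := ι) (hP.memLp a c u ha hc hpath)
    (hP.integrable a c u ha hc hpath)
  refine ⟨hpath, fun t ht => ?_⟩
  rcases le_total t b with htb | htb
  · exact h₁.eq t ⟨ht.1, htb⟩
  · have hb : b ∈ Icc a c := ⟨hab, hbc⟩
    rw [h₂.eq t ⟨htb, ht.2⟩, h₁.eq b ⟨hab, le_rfl⟩, add_assoc,
      intervalIntegral.integral_add_adjacent_intervals
      (intervalIntegrable_of_restrict hi (left_mem_Icc.2 (hab.trans hbc)) hb)
      (intervalIntegrable_of_restrict hi hb ht)]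

/-- Solutions are determined by their initial values, by local monotonicity and Gronwall's
inequality. -/
theorem Nonlinearity.unique (hP : Nonlinearity ι T N σ) (hι : Function.Injective ι)
    (hι' : DenseRange ι) (ha : 0 ≤ a) (hb : b ≤ T) {u w : ℝ → H} (hu : IsNSol ι a b N σ u)
    (hw : IsNSol ι a b N σ w) (h : u a = w a) {t : ℝ} (ht : t ∈ Icc a b) : u t = w t := by
  obtain ⟨n₁, hn₁⟩ := hu.isPath.exists_bound
  obtain ⟨n₂, hn₂⟩ := hw.isPath.exists_bound
  obtain ⟨θ, ρ, C, hθ, hC, hρ, hρ0, hmon⟩ := hP.monotone (max n₁ n₂)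
  have huα := hP.memLp a b u ha hb hu.isPath
  have huβ := hP.integrable a b u ha hb hu.isPath
  have hwα := hP.memLp a b w ha hb hw.isPath
  have hwβ := hP.integrable a b w ha hb hw.isPath
  have hsub := IsSol.sub hι hu hw huα huβ hwα hwβ
  have hρ' : Integrable ρ (segMeasure a b) :=
    hρ.mono_measure (Measure.restrict_mono (Icc_subset_Icc ha hb) le_rfl)
  have hR : Integrable (fun t => 2 * (ρ t + C * (‖lift ι (u t)‖ ^ 2 + ‖lift ι (w t)‖ ^ 2)))
      (segMeasure a b) :=
    (hρ'.add ((hu.isPath.integrable_sq.add hw.isPath.integrable_sq).const_mul C)).const_mul 2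
  have hE := hsub.energy_le hι hι' (huα.sub hwα) (huβ.sub hwβ) (γ := 0) (Γ := 0) hθ.le hR
    (fun t _ => by have := hρ0 t; positivity) (integrable_zero _ _ _) (by simp) ?_ ht
  · have h1 : 0 ≤ ∫ s in a..t, ‖lift ι (u s - w s)‖ ^ 2 :=
      intervalIntegral.integral_nonneg ht.1 fun _ _ => by positivity
    rw [h, sub_self, norm_zero] at hE
    have h2 : ‖u t - w t‖ ^ 2 ≤ 0 := by
      have := mul_nonneg (mul_nonneg zero_le_two hθ.le) h1
      nlinarith
    rw [← sub_eq_zero, ← norm_eq_zero]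
    exact pow_eq_zero_iff two_ne_zero |>.1 (le_antisymm h2 (sq_nonneg _))
  · filter_upwards [ae_restrict_mem measurableSet_Icc, hu.isPath.ae_eq, hw.isPath.ae_eq,
      (hu.isPath.sub hι hw.isPath).2] with s hs e1 e2 e3
    have hm := hmon s ⟨ha.trans hs.1, hs.2.trans hb⟩ (lift ι (u s)) (lift ι (w s))
      (by rw [e1]; exact (hn₁ s hs).trans (le_max_left _ _))
      (by rw [e2]; exact (hn₂ s hs).trans (le_max_right _ _))
    rw [e1, e2] at hm
    rw [e3, Pi.zero_apply]
    linarith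

/-- A solution on `[0, c)` with finite energy has a continuous extension to `[0, c]`: the
continuation is the solution of the linear problem `w' + w = (N(t, u) + u) + σ(t, u)`. -/
theorem Nonlinearity.exists_extension (hP : Nonlinearity ι T N σ) (hι : Function.Injective ι)
    (hι' : DenseRange ι) (hc0 : 0 < c) (hcT : c ≤ T) {u : ℝ → H}
    (hu : ∀ d, 0 ≤ d → d < c → IsNSol ι 0 d N σ u) {R : ℝ}
    (hR : ∀ t, 0 ≤ t → t < c → ‖u t‖ ≤ R)
    (hR' : ∀ d, 0 ≤ d → d < c → ∫ t, ‖lift ι (u t)‖ ^ 2 ∂segMeasure 0 d ≤ R) :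
    ∃ w, IsNSol ι 0 c N σ w ∧ w 0 = u 0 := by
  set d : ℕ → ℝ := fun k => c * (1 - epsSeq k) with hd
  have heps0 : Tendsto epsSeq atTop (𝓝 0) := tendsto_one_div_add_atTop_nhds_zero_nat
  have hd1 : Tendsto d atTop (𝓝 c) := by
    simpa using (tendsto_const_nhds (x := c)).mul ((tendsto_const_nhds (x := (1 : ℝ))).sub heps0)
  have heps1 : ∀ k, epsSeq k ≤ 1 := fun k => by
    unfold epsSeq
    rw [div_le_one (by positivity)]
    linarith [(Nat.cast_nonneg k : (0 : ℝ) ≤ k)]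
  have hd0 : ∀ k, 0 ≤ d k := fun k => mul_nonneg hc0.le (sub_nonneg.2 (heps1 k))
  have hdc : ∀ k, d k < c := fun k => by
    have := epsSeq_pos k
    simp only [hd]
    nlinarith
  have hcov : AECover (segMeasure 0 c) atTop fun k => Icc (0 : ℝ) (d k) :=
    aecover_Icc_of_Icc tendsto_const_nhds hd1
  have hres : ∀ k, (segMeasure 0 c).restrict (Icc 0 (d k)) = segMeasure 0 (d k) := fun k => by
    rw [segMeasure, Measure.restrict_restrict measurableSet_Icc,
      inter_eq_left.2 (Icc_subset_Icc_right (hdc k).le)]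
  have hall : ∀ᵐ t ∂segMeasure 0 c, t ∈ Icc 0 c ∧ t ≠ c := by
    filter_upwards [ae_restrict_mem measurableSet_Icc,
      (Measure.ae_ne volume c).filter_mono (ae_mono Measure.restrict_le_self)] with t h1 h2
      using ⟨h1, h2⟩
  have hk : ∀ k, IsNSol ι 0 (d k) N σ u := fun k => hu _ (hd0 k) (hdc k)
  have hvm : AEStronglyMeasurable (fun t => lift ι (u t)) (segMeasure 0 c) :=
    hcov.aestronglyMeasurable fun k => by rw [hres k]; exact (hk k).isPath.memLp.1
  have hv : MemLp (fun t => lift ι (u t)) 2 (segMeasure 0 c) := by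
    rw [memLp_two_iff_integrable_sq_norm hvm]
    refine hcov.integrable_of_integral_norm_bounded R (fun k => ?_) (Eventually.of_forall fun k => ?_)
    · rw [IntegrableOn, hres k]; exact (hk k).isPath.integrable_sq
    · rw [hres k]
      simpa using hR' _ (hd0 k) (hdc k)
  have hrange : ∀ᵐ t ∂segMeasure 0 c, ι (lift ι (u t)) = u t := by
    have h1 : ∀ᵐ t ∂segMeasure 0 c, ∀ k, t ∈ Icc 0 (d k) → ι (lift ι (u t)) = u t := by
      refine ae_all_iff.2 fun k => ?_
      rw [← ae_restrict_iff' measurableSet_Icc, hres k]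
      exact (hk k).isPath.ae_eq
    filter_upwards [h1, hcov.ae_eventually_mem] with t h2 h3
    obtain ⟨k, hk⟩ := h3.exists
    exact h2 k hk
  have hvb : ∀ᵐ t ∂segMeasure 0 c, ‖ι (lift ι (u t))‖ ≤ R := by
    filter_upwards [hrange, hall] with t h1 h2
    rw [h1]
    exact hR t h2.1.1 (lt_of_le_of_ne h2.1.2 h2.2)
  have hα := hP.memLp_comp 0 c R _ le_rfl hcT hv hvb
  have hβ := hP.integrable_comp 0 c R _ le_rfl hcT hv hvb
  have hL : CoerciveFamily ι 0 c 1 0 1 fun _ => ContinuousLinearMap.id ℝ V :=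
    ⟨fun v => measurable_const, fun t _ v => by simp,
      fun t _ v => by simp⟩
  obtain ⟨w, hw, hw0⟩ := exists_isLinSol hι hι' hc0.le hL zero_le_one one_pos le_rfl (u 0)
    (hα.add hv) hβ
  have hwp := hw.isPath
  have heq : ∀ t, 0 ≤ t → t < c → w t = u t := by
    intro t ht htc
    have hle : segMeasure 0 t ≤ segMeasure 0 c :=
      Measure.restrict_mono (Icc_subset_Icc_right htc.le) le_rfl
    have hut := hu t ht htc
    have hαt := hα.mono_measure hle
    have hβt := hβ.mono_measure hle
    have hwt : IsSol ι 0 t _ _ w := IsSol.mono hw (hw.memLp hL (hα.add hv)) hβ le_rfl htc.le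
    have hwα := (hw.memLp hL (hα.add hv)).mono_measure hle
    have hsub := IsSol.sub hι hwt hut hwα hβt hαt hβt
    have hE := hsub.energy_le hι hι' (hwα.sub hαt) (hβt.sub hβt) (θ := 0) (ρ := 0) (γ := 0)
      (Γ := 0) le_rfl (integrable_zero _ _ _) (by simp) (integrable_zero _ _ _) (by simp) ?_
      (right_mem_Icc.2 ht)
    · rw [hw0, sub_self, norm_zero] at hE
      have h2 : ‖w t - u t‖ ^ 2 ≤ 0 := by simpa using hE
      rw [← sub_eq_zero, ← norm_eq_zero]
      exact pow_eq_zero_iff two_ne_zero |>.1 (le_antisymm h2 (sq_nonneg _))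
    · filter_upwards [((hwp.mono le_rfl htc.le).sub hι hut.isPath).2] with s e
      have e2 : N s (lift ι (u s)) + lift ι (u s) - lift ι (w s) - N s (lift ι (u s))
          = -(lift ι (w s) - lift ι (u s)) := by abel
      simp only [e, sub_self, inner_zero_left, Pi.add_apply, ContinuousLinearMap.id_apply, e2,
        inner_neg_left, real_inner_self_eq_norm_sq]
      simp
  refine ⟨w, IsSol.congr hw ?_, hw0⟩
  filter_upwards [hall] with t ht
  rw [heq t ht.1.1 (lt_of_le_of_ne ht.1.2 ht.2)]
  simp

/-- Global existence under an a priori bound: with `c` the supremum of the existence times, there is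
a solution on `[0, c]`, and if `c < T` it is continued beyond `c` by a local solution. -/
theorem Nonlinearity.exists_global (hP : Nonlinearity ι T N σ) (hι : Function.Injective ι)
    (hι' : DenseRange ι) (hT : 0 < T) (x : H) {R : ℝ}
    (hR : ∀ (c : ℝ) (u : ℝ → H), 0 ≤ c → c ≤ T → IsNSol ι 0 c N σ u → u 0 = x →
      (∀ t ∈ Icc 0 c, ‖u t‖ ≤ R) ∧ ∫ t, ‖lift ι (u t)‖ ^ 2 ∂segMeasure 0 c ≤ R) :
    ∃ u, IsNSol ι 0 T N σ u ∧ u 0 = x := by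
  set E : Set ℝ := {c | c ∈ Icc 0 T ∧ ∃ u, IsNSol ι 0 c N σ u ∧ u 0 = x} with hE
  have hdown : ∀ c ∈ E, ∀ d, 0 ≤ d → d ≤ c → d ∈ E := by
    rintro c ⟨hc, u, hu, hux⟩ d hd hdc
    exact ⟨⟨hd, hdc.trans hc.2⟩, u, IsNSol.mono hP le_rfl hc.2 hu le_rfl hdc, hux⟩
  obtain ⟨t₁, ht₁, ht₁T, u₁, hu₁, hu₁x⟩ := hP.exists_local hι hι' le_rfl hT x
  have ht₁E : t₁ ∈ E := ⟨⟨ht₁.le, ht₁T⟩, u₁, hu₁, hu₁x⟩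
  have hbdd : BddAbove E := ⟨T, fun c hc => hc.1.2⟩
  set c := sSup E with hc
  have hc0 : 0 < c := ht₁.trans_le (le_csSup hbdd ht₁E)
  have hcT : c ≤ T := csSup_le ⟨t₁, ht₁E⟩ fun d hd => hd.1.2
  have hlt : ∀ d, 0 ≤ d → d < c → d ∈ E := by
    intro d hd hdc
    obtain ⟨e, he, hde⟩ := exists_lt_of_lt_csSup ⟨t₁, ht₁E⟩ hdc
    exact hdown e he d hd hde.le
  have hex : ∀ d, ∃ u, 0 ≤ d → d < c → IsNSol ι 0 d N σ u ∧ u 0 = x := by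
    intro d
    by_cases h : 0 ≤ d ∧ d < c
    · obtain ⟨-, u, hu⟩ := hlt d h.1 h.2
      exact ⟨u, fun _ _ => hu⟩
    · exact ⟨0, fun h1 h2 => absurd ⟨h1, h2⟩ h⟩
  choose U hU using hex
  have hUU : ∀ d, 0 ≤ d → d < c → ∀ t ∈ Icc 0 d, U d t = U t t := by
    intro d hd hdc t ht
    have htc := ht.2.trans_lt hdc
    refine hP.unique hι hι' le_rfl (htc.le.trans hcT)
      (IsNSol.mono hP le_rfl (hdc.le.trans hcT) (hU d hd hdc).1 le_rfl ht.2)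
      (hU t ht.1 htc).1 ?_ (right_mem_Icc.2 ht.1)
    rw [(hU d hd hdc).2, (hU t ht.1 htc).2]
  have hu : ∀ d, 0 ≤ d → d < c → IsNSol ι 0 d N σ fun t => U t t := fun d hd hdc =>
    (hU d hd hdc).1.eqOn (hUU d hd hdc)
  have hux : U 0 0 = x := (hU 0 le_rfl hc0).2
  obtain ⟨w, hw, hw0⟩ := hP.exists_extension hι hι' hc0 hcT hu
    (fun t ht htc => (hR t _ ht (htc.le.trans hcT) (hu t ht htc) hux).1 t (right_mem_Icc.2 ht))
    (fun d hd hdc => (hR d _ hd (hdc.le.trans hcT) (hu d hd hdc) hux).2)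
  rcases hcT.eq_or_lt with heq | hlt'
  · exact ⟨w, heq ▸ hw, hw0.trans hux⟩
  · obtain ⟨t₂, ht₂, ht₂T, w₂, hw₂, hw₂x⟩ := hP.exists_local hι hι' hc0.le hlt' (w c)
    refine absurd (le_csSup hbdd ⟨⟨hc0.le.trans ht₂.le, ht₂T⟩,
      fun t => if t ≤ c then w t else w₂ t, ?_, ?_⟩) (not_le.2 ht₂)
    · refine IsNSol.glue hP le_rfl hc0.le ht₂.le ht₂T (hw.eqOn fun t ht => ?_)
        (hw₂.eqOn fun t ht => ?_)
      · rw [if_pos ht.2]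
      · rcases ht.1.eq_or_lt with h | h
        · subst h; simpa using hw₂x
        · rw [if_neg (not_le.2 h)]
    · simpa [hc0.le] using hw0.trans hux

end Global

/-! ### Subcritical and critical estimates -/

section Estimates

open Filter Topology

variable {V H : Type*} [NormedAddCommGroup V] [InnerProductSpace ℝ V] [CompleteSpace V]
  [NormedAddCommGroup H] [InnerProductSpace ℝ H] [CompleteSpace H] {ι : V →L[ℝ] H}

/-- Young's inequality with a small constant in front of one of the factors. -/
theorem exists_young {κ D ε : ℝ} (hκ : 0 < κ) (hκ' : κ < 1) (hD : 0 ≤ D) (hε : 0 < ε) :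
    ∃ C, 0 ≤ C ∧ ∀ x y : ℝ, 0 ≤ x → 0 ≤ y → D * (x ^ κ * y ^ (1 - κ)) ≤ ε * x + C * y := by
  have h1 : 0 < 1 - κ := sub_pos.2 hκ'
  set E : ℝ := (D * ε ^ (-κ)) ^ (1 / (1 - κ)) with hE
  have hE0 : 0 ≤ E := by positivity
  refine ⟨E, hE0, fun x y hx hy => ?_⟩
  have h := Real.geom_mean_le_arith_mean2_weighted hκ.le h1.le (mul_nonneg hε.le hx)
    (mul_nonneg hE0 hy) (by ring)
  have e1 : E ^ (1 - κ) = D * ε ^ (-κ) := by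
    rw [hE, ← Real.rpow_mul (by positivity), one_div, inv_mul_cancel₀ h1.ne', Real.rpow_one]
  have e2 : ε ^ κ * ε ^ (-κ) = 1 := by
    rw [← Real.rpow_add hε, add_neg_cancel, Real.rpow_zero]
  rw [Real.mul_rpow hε.le hx, Real.mul_rpow hE0 hy, e1] at h
  have e3 : ε ^ κ * x ^ κ * (D * ε ^ (-κ) * y ^ (1 - κ))
      = (ε ^ κ * ε ^ (-κ)) * (D * (x ^ κ * y ^ (1 - κ))) := by ring
  rw [e3, e2, one_mul] at h
  refine h.trans ?_
  have h2 : κ * (ε * x) ≤ ε * x := mul_le_of_le_one_left (by positivity) hκ'.le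
  have h3 : (1 - κ) * (E * y) ≤ E * y := mul_le_of_le_one_left (by positivity) (by linarith)
  linarith

/-- On balls of `H`, the norm of `[V*, V]_β` is bounded by a power of the norm of `V`. -/
theorem exists_normβ_le_rpow (hι : Function.Injective ι) {β n : ℝ} (hβ : 1 / 2 < β) (hβ' : β < 1)
    (hn : 0 ≤ n) : ∃ C, 0 ≤ C ∧ ∀ v : V, ‖ι v‖ ≤ n →
      normβ ι β v ≤ C * (1 + ‖v‖) ^ (2 * β - 1) := by
  obtain ⟨C, hC, h⟩ := exists_normβ_le ι hι hβ hβ'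
  refine ⟨C * n ^ (2 - 2 * β), by positivity, fun v hv => (h v).trans ?_⟩
  rw [mul_assoc]
  have h1 : ‖ι v‖ ^ (2 - 2 * β) ≤ n ^ (2 - 2 * β) :=
    Real.rpow_le_rpow (norm_nonneg _) hv (by linarith)
  have h2 : ‖v‖ ^ (2 * β - 1) ≤ (1 + ‖v‖) ^ (2 * β - 1) :=
    Real.rpow_le_rpow (norm_nonneg _) (by linarith) (by linarith)
  gcongr

/-- The power `‖v‖_β ^ (ρ + 1)`, which is of order `(2 β - 1) (ρ + 1)` in the norm of `V`, is at most
linear in the critical range. -/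
theorem criticality {ρ β : ℝ} (hρ : 0 ≤ ρ) (h : 2 * β ≤ 1 + 1 / (1 + ρ)) :
    (2 * β - 1) * (ρ + 1) ≤ 1 := by
  have h1 : 2 * β - 1 ≤ 1 / (1 + ρ) := by linarith
  rw [le_div_iff₀ (by linarith)] at h1
  linarith

/-- A nonlinearity of critical growth grows at most linearly in `V` on balls of `H`. -/
theorem exists_growth_term (hι : Function.Injective ι) {ρ β n : ℝ} (hρ : 0 ≤ ρ)
    (hβ : 1 / 2 < β) (hβ' : β < 1) (h : 2 * β ≤ 1 + 1 / (1 + ρ)) (hn : 0 ≤ n) :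
    ∃ C, 0 ≤ C ∧ ∀ u : V, ‖ι u‖ ≤ n → 1 + normβ ι β u ^ (ρ + 1) ≤ C * (1 + ‖u‖) := by
  obtain ⟨K, hK, hKu⟩ := exists_normβ_le_rpow hι hβ hβ' hn
  refine ⟨1 + K ^ (ρ + 1), by positivity, fun u hu => ?_⟩
  have h0 : (1 : ℝ) ≤ 1 + ‖u‖ := by linarith [norm_nonneg u]
  have h1 : normβ ι β u ^ (ρ + 1) ≤ K ^ (ρ + 1) * (1 + ‖u‖) := by
    refine (Real.rpow_le_rpow (normβ_nonneg ι β u) (hKu u hu) (by linarith)).trans ?_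
    rw [Real.mul_rpow hK (by positivity), ← Real.rpow_mul (by positivity)]
    gcongr
    calc (1 + ‖u‖) ^ ((2 * β - 1) * (ρ + 1)) ≤ (1 + ‖u‖) ^ (1 : ℝ) :=
          Real.rpow_le_rpow_of_exponent_le h0 (criticality hρ h)
      _ = 1 + ‖u‖ := Real.rpow_one _
  linarith

/-- A nonlinearity of critical growth is Lipschitz continuous on balls of `H`, with an arbitrarily
small constant in the norm of `V` and the critical weight in the norm of `H`. -/
theorem exists_lipschitz_term (hι : Function.Injective ι) {ρ β n : ℝ} (hρ : 0 ≤ ρ)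
    (hβ : 1 / 2 < β) (hβ' : β < 1) (h : 2 * β ≤ 1 + 1 / (1 + ρ)) (hn : 0 ≤ n) {ε : ℝ}
    (hε : 0 < ε) :
    ∃ C, 0 ≤ C ∧ ∀ u v : V, ‖ι u‖ ≤ n → ‖ι v‖ ≤ n →
      (1 + normβ ι β u ^ ρ + normβ ι β v ^ ρ) * normβ ι β (u - v)
        ≤ ε * ‖u - v‖ + C * ((1 + ‖u‖ + ‖v‖) * ‖ι u - ι v‖) := by
  obtain ⟨K, hK, hKu⟩ := exists_normβ_le_rpow hι hβ hβ' hn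
  obtain ⟨K', hK', hKw⟩ := exists_normβ_le ι hι hβ hβ'
  obtain ⟨C, hC, hY⟩ := exists_young (κ := 2 * β - 1) (D := (1 + 2 * K ^ ρ) * K') (ε := ε)
    (by linarith) (by linarith) (by positivity) hε
  refine ⟨C, hC, fun u v hu hv => ?_⟩
  set Y := 1 + ‖u‖ + ‖v‖ with hYdef
  have hY1 : 1 ≤ Y := by linarith [norm_nonneg u, norm_nonneg v]
  have hκ : (2 * β - 1) * ρ ≤ 1 - (2 * β - 1) := by
    linarith [criticality hρ h]
  have hpow : ∀ w : V, ‖ι w‖ ≤ n → 1 + ‖w‖ ≤ Y →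
      normβ ι β w ^ ρ ≤ K ^ ρ * Y ^ (1 - (2 * β - 1)) := by
    intro w hw hwY
    refine (Real.rpow_le_rpow (normβ_nonneg ι β w) (hKu w hw) hρ).trans ?_
    rw [Real.mul_rpow hK (by positivity), ← Real.rpow_mul (by positivity)]
    gcongr
    calc (1 + ‖w‖) ^ ((2 * β - 1) * ρ) ≤ Y ^ ((2 * β - 1) * ρ) :=
          Real.rpow_le_rpow (by positivity) hwY (mul_nonneg (by linarith) hρ)
      _ ≤ Y ^ (1 - (2 * β - 1)) := Real.rpow_le_rpow_of_exponent_le hY1 hκ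
  have h1 := hpow u hu (by linarith [norm_nonneg v])
  have h2 := hpow v hv (by linarith [norm_nonneg u])
  have h3 : 1 ≤ Y ^ (1 - (2 * β - 1)) := Real.one_le_rpow hY1 (by linarith)
  have h4 := hKw (u - v)
  rw [map_sub] at h4
  have h5 := hY ‖u - v‖ (Y * ‖ι u - ι v‖) (norm_nonneg _) (by positivity)
  refine le_trans ?_ h5
  rw [Real.mul_rpow (by positivity) (norm_nonneg _)]
  calc (1 + normβ ι β u ^ ρ + normβ ι β v ^ ρ) * normβ ι β (u - v)
      ≤ ((1 + 2 * K ^ ρ) * Y ^ (1 - (2 * β - 1)))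
        * (K' * (‖ι u - ι v‖ ^ (2 - 2 * β) * ‖u - v‖ ^ (2 * β - 1))) := by
        refine mul_le_mul (by linarith) h4 (normβ_nonneg ι β _) (by positivity)
    _ = _ := by
        rw [show 1 - (2 * β - 1) = 2 - 2 * β by ring]
        ring

theorem exists_growth_sum (s : Finset ℕ) {f : ℕ → V → ℝ} {n : ℝ}
    (h : ∀ j ∈ s, ∃ C, 0 ≤ C ∧ ∀ u : V, ‖ι u‖ ≤ n → f j u ≤ C * (1 + ‖u‖)) :
    ∃ C, 0 ≤ C ∧ ∀ u : V, ‖ι u‖ ≤ n → ∑ j ∈ s, f j u ≤ C * (1 + ‖u‖) := by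
  choose! C hC0 hC using h
  refine ⟨∑ j ∈ s, C j, Finset.sum_nonneg hC0, fun u hu => ?_⟩
  rw [Finset.sum_mul]
  exact Finset.sum_le_sum fun j hj => hC j hj u hu

theorem exists_lipschitz_sum (s : Finset ℕ) {f : ℕ → V → V → ℝ} {n : ℝ}
    (h : ∀ j ∈ s, ∀ ε : ℝ, 0 < ε → ∃ C, 0 ≤ C ∧ ∀ u v : V, ‖ι u‖ ≤ n → ‖ι v‖ ≤ n →
      f j u v ≤ ε * ‖u - v‖ + C * ((1 + ‖u‖ + ‖v‖) * ‖ι u - ι v‖)) {ε : ℝ} (hε : 0 < ε) :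
    ∃ C, 0 ≤ C ∧ ∀ u v : V, ‖ι u‖ ≤ n → ‖ι v‖ ≤ n →
      ∑ j ∈ s, f j u v ≤ ε * ‖u - v‖ + C * ((1 + ‖u‖ + ‖v‖) * ‖ι u - ι v‖) := by
  have hs : (0 : ℝ) < s.card + 1 := by positivity
  choose! C hC0 hC using fun j hj => h j hj (ε / (s.card + 1)) (by positivity)
  refine ⟨∑ j ∈ s, C j, Finset.sum_nonneg hC0, fun u v hu hv => ?_⟩
  calc ∑ j ∈ s, f j u v ≤ ∑ j ∈ s, (ε / (s.card + 1) * ‖u - v‖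
        + C j * ((1 + ‖u‖ + ‖v‖) * ‖ι u - ι v‖)) := Finset.sum_le_sum fun j hj => hC j hj u v hu hv
    _ = s.card * (ε / (s.card + 1)) * ‖u - v‖
        + (∑ j ∈ s, C j) * ((1 + ‖u‖ + ‖v‖) * ‖ι u - ι v‖) := by
        rw [Finset.sum_add_distrib, Finset.sum_const, nsmul_eq_mul, Finset.sum_mul, mul_assoc]
    _ ≤ _ := by
        gcongr
        rw [mul_div_assoc', div_le_iff₀ hs]
        nlinarith

variable {U : Type*} [NormedAddCommGroup U] [InnerProductSpace ℝ U] [CompleteSpace U]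

/-- The structural bounds of the coefficients on balls of `H`, with the interpolation norms
eliminated. -/
structure CoefficientBounds (ι : V →L[ℝ] H) (c : Coefficients V H U) (T n C : ℝ) : Prop where
  nonneg : 0 ≤ C
  A₀_le : ∀ t ∈ Icc 0 T, ∀ u w : V, ‖ι u‖ ≤ n → ‖c.A₀ t (ι u) w‖ ≤ C * ‖w‖
  A₀_sub_le : ∀ t ∈ Icc 0 T, ∀ u v w : V, ‖ι u‖ ≤ n → ‖ι v‖ ≤ n →
    ‖c.A₀ t (ι u) w - c.A₀ t (ι v) w‖ ≤ C * ‖ι u - ι v‖ * ‖w‖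
  B₀_le : ∀ t ∈ Icc 0 T, ∀ u w : V, ‖ι u‖ ≤ n → ‖c.B₀ t (ι u) w‖ ≤ C * ‖w‖
  B₀_sub_le : ∀ t ∈ Icc 0 T, ∀ u v w : V, ‖ι u‖ ≤ n → ‖ι v‖ ≤ n →
    ‖c.B₀ t (ι u) w - c.B₀ t (ι v) w‖ ≤ C * ‖ι u - ι v‖ * ‖w‖
  F_le : ∀ t ∈ Icc 0 T, ∀ u : V, ‖ι u‖ ≤ n → ‖c.F t u‖ ≤ C * (1 + ‖u‖)
  G_le : ∀ t ∈ Icc 0 T, ∀ u : V, ‖ι u‖ ≤ n → ‖c.G t u‖ ≤ C * (1 + ‖u‖)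
  F_sub_le : ∀ ε : ℝ, 0 < ε → ∃ C', 0 ≤ C' ∧ ∀ t ∈ Icc 0 T, ∀ u v : V, ‖ι u‖ ≤ n → ‖ι v‖ ≤ n →
    ‖c.F t u - c.F t v‖ ≤ ε * ‖u - v‖ + C' * ((1 + ‖u‖ + ‖v‖) * ‖ι u - ι v‖)
  G_sub_le : ∀ ε : ℝ, 0 < ε → ∃ C', 0 ≤ C' ∧ ∀ t ∈ Icc 0 T, ∀ u v : V, ‖ι u‖ ≤ n → ‖ι v‖ ≤ n →
    ‖c.G t u - c.G t v‖ ≤ ε * ‖u - v‖ + C' * ((1 + ‖u‖ + ‖v‖) * ‖ι u - ι v‖)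

theorem exists_coefficientBounds [MeasurableSpace V] [MeasurableSpace H] (hι : Function.Injective ι)
    {c : Coefficients V H U} (hc : c.IsCritical ι) {T n : ℝ} (hT : 0 < T) (hn : 0 ≤ n) :
    ∃ C, CoefficientBounds ι c T n C := by
  obtain ⟨mF, mG, ρ, β, hρβ, hgr⟩ := hc.growth
  obtain ⟨C, hC⟩ := hgr T hT n hn
  have hF : ∀ j ∈ Finset.Icc 1 mF, j ∈ Finset.Icc 1 (mF + mG) := fun j hj => by
    rw [Finset.mem_Icc] at hj ⊢; omega
  have hG : ∀ j ∈ Finset.Icc (mF + 1) (mF + mG), j ∈ Finset.Icc 1 (mF + mG) := fun j hj => by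
    rw [Finset.mem_Icc] at hj ⊢; omega
  have hgrow : ∀ s : Finset ℕ, (∀ j ∈ s, j ∈ Finset.Icc 1 (mF + mG)) →
      ∃ K, 0 ≤ K ∧ ∀ u : V, ‖ι u‖ ≤ n →
        ∑ j ∈ s, (1 + normβ ι (β j) u ^ (ρ j + 1)) ≤ K * (1 + ‖u‖) := fun s hs =>
    exists_growth_sum s fun j hj => by
      obtain ⟨h1, h2, h3, h4⟩ := hρβ j (hs j hj)
      exact exists_growth_term hι h1 h2 h3 h4 hn
  have hlip : ∀ s : Finset ℕ, (∀ j ∈ s, j ∈ Finset.Icc 1 (mF + mG)) → ∀ ε : ℝ, 0 < ε →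
      ∃ K, 0 ≤ K ∧ ∀ u v : V, ‖ι u‖ ≤ n → ‖ι v‖ ≤ n →
        ∑ j ∈ s, (1 + normβ ι (β j) u ^ ρ j + normβ ι (β j) v ^ ρ j) * normβ ι (β j) (u - v)
          ≤ ε * ‖u - v‖ + K * ((1 + ‖u‖ + ‖v‖) * ‖ι u - ι v‖) := fun s hs ε hε =>
    exists_lipschitz_sum s (fun j hj ε hε => by
      obtain ⟨h1, h2, h3, h4⟩ := hρβ j (hs j hj)
      exact exists_lipschitz_term hι h1 h2 h3 h4 hn hε) hε
  obtain ⟨KF, hKF, hKF'⟩ := hgrow _ hF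
  obtain ⟨KG, hKG, hKG'⟩ := hgrow _ hG
  -- the constant of the hypothesis may be negative
  set D := max C 0 with hD
  have hD0 : 0 ≤ D := le_max_right _ _
  have hCD : ∀ {x y : ℝ}, 0 ≤ y → x ≤ C * y → x ≤ D * y := fun hy hx =>
    hx.trans (mul_le_mul_of_nonneg_right (le_max_left _ _) hy)
  have hsum0 : ∀ (s : Finset ℕ) (u : V), 0 ≤ ∑ j ∈ s, (1 + normβ ι (β j) u ^ (ρ j + 1)) :=
    fun s u => Finset.sum_nonneg fun j _ => by
      have := Real.rpow_nonneg (normβ_nonneg ι (β j) u) (ρ j + 1)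
      linarith
  have hsum1 : ∀ (s : Finset ℕ) (u v : V), 0 ≤ ∑ j ∈ s,
      (1 + normβ ι (β j) u ^ ρ j + normβ ι (β j) v ^ ρ j) * normβ ι (β j) (u - v) :=
    fun s u v => Finset.sum_nonneg fun j _ => by
      have h1 := Real.rpow_nonneg (normβ_nonneg ι (β j) u) (ρ j)
      have h2 := Real.rpow_nonneg (normβ_nonneg ι (β j) v) (ρ j)
      exact mul_nonneg (by linarith) (normβ_nonneg ι _ _)
  have hle : ∀ s : Finset ℕ, (∀ j ∈ s, j ∈ Finset.Icc 1 (mF + mG)) → ∀ ε : ℝ, 0 < ε →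
      ∃ C', 0 ≤ C' ∧ ∀ u v : V, ‖ι u‖ ≤ n → ‖ι v‖ ≤ n →
        D * ∑ j ∈ s, (1 + normβ ι (β j) u ^ ρ j + normβ ι (β j) v ^ ρ j) * normβ ι (β j) (u - v)
          ≤ ε * ‖u - v‖ + C' * ((1 + ‖u‖ + ‖v‖) * ‖ι u - ι v‖) := by
    intro s hs ε hε
    obtain ⟨K, hK, hK'⟩ := hlip s hs (ε / (D + 1)) (by positivity)
    refine ⟨D * K, by positivity, fun u v hu hv => ?_⟩
    refine (mul_le_mul_of_nonneg_left (hK' u v hu hv) hD0).trans ?_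
    rw [mul_add, ← mul_assoc, ← mul_assoc]
    gcongr
    rw [mul_div_assoc', div_le_iff₀ (by linarith)]
    nlinarith
  have p1 := mul_nonneg hD0 hKF
  have p2 := mul_nonneg hD0 hKG
  have p3 := mul_nonneg hD0 hn
  have m1 : D * (1 + n) ≤ D * (1 + n) + D * KF + D * KG := by linarith
  have m2 : D ≤ D * (1 + n) + D * KF + D * KG := by linarith
  have m3 : D * KF ≤ D * (1 + n) + D * KF + D * KG := by linarith
  have m4 : D * KG ≤ D * (1 + n) + D * KF + D * KG := by linarith
  refine ⟨D * (1 + n) + D * KF + D * KG, ⟨by positivity, ?_, ?_, ?_, ?_, ?_, ?_, ?_, ?_⟩⟩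
  · intro t ht u w hu
    have h := (hC t ht u u w hu hu).1
    rw [mul_assoc] at h
    refine (hCD (by positivity) h).trans ?_
    calc D * ((1 + ‖ι u‖) * ‖w‖) ≤ D * ((1 + n) * ‖w‖) := by gcongr
      _ = D * (1 + n) * ‖w‖ := by ring
      _ ≤ _ := by gcongr
  · intro t ht u v w hu hv
    have h := (hC t ht u v w hu hv).2.1
    rw [mul_assoc] at h ⊢
    refine (hCD (by positivity) h).trans ?_
    gcongr
  · intro t ht u w hu
    have h := (hC t ht u u w hu hu).2.2.1
    rw [mul_assoc] at h
    refine (hCD (by positivity) h).trans ?_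
    calc D * ((1 + ‖ι u‖) * ‖w‖) ≤ D * ((1 + n) * ‖w‖) := by gcongr
      _ = D * (1 + n) * ‖w‖ := by ring
      _ ≤ _ := by gcongr
  · intro t ht u v w hu hv
    have h := (hC t ht u v w hu hv).2.2.2.1
    rw [mul_assoc] at h ⊢
    refine (hCD (by positivity) h).trans ?_
    gcongr
  · intro t ht u hu
    refine (hCD (hsum0 _ u) (hC t ht u u u hu hu).2.2.2.2.1).trans ?_
    calc _ ≤ D * (KF * (1 + ‖u‖)) := mul_le_mul_of_nonneg_left (hKF' u hu) hD0
      _ = D * KF * (1 + ‖u‖) := by ring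
      _ ≤ _ := by gcongr
  · intro t ht u hu
    refine (hCD (hsum0 _ u) (hC t ht u u u hu hu).2.2.2.2.2.2.1).trans ?_
    calc _ ≤ D * (KG * (1 + ‖u‖)) := mul_le_mul_of_nonneg_left (hKG' u hu) hD0
      _ = D * KG * (1 + ‖u‖) := by ring
      _ ≤ _ := by gcongr
  · intro ε hε
    obtain ⟨C', hC', h⟩ := hle _ hF ε hε
    exact ⟨C', hC', fun t ht u v hu hv =>
      (hCD (hsum1 _ u v) (hC t ht u v u hu hv).2.2.2.2.2.1).trans (h u v hu hv)⟩
  · intro ε hε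
    obtain ⟨C', hC', h⟩ := hle _ hG ε hε
    exact ⟨C', hC', fun t ht u v hu hv =>
      (hCD (hsum1 _ u v) (hC t ht u v u hu hv).2.2.2.2.2.2.2).trans (h u v hu hv)⟩

end Estimates

/-! ### The coefficients as nonlinearities -/

section CoefficientMaps

open Filter Topology

variable {V H U : Type*} [NormedAddCommGroup V] [InnerProductSpace ℝ V] [CompleteSpace V]
  [NormedAddCommGroup H] [InnerProductSpace ℝ H] [CompleteSpace H]
  [NormedAddCommGroup U] [InnerProductSpace ℝ U] [CompleteSpace U]

/-- The Hilbert-Schmidt norm dominates the operator norm. -/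
theorem HilbertSchmidt.norm_apply_le (S : HilbertSchmidt U H) (y : U) :
    ‖S.toCLM y‖ ≤ ‖S‖ * ‖y‖ := by
  have h : ‖ContinuousLinearMap.adjoint S.toCLM‖ ≤ ‖S‖ := by
    refine ContinuousLinearMap.opNorm_le_bound _ (norm_nonneg _) fun h => ?_
    have h1 := (hsBasis U).hasSum_inner_mul_inner (ContinuousLinearMap.adjoint S.toCLM h)
      (ContinuousLinearMap.adjoint S.toCLM h)
    have h2 := S.hasSum_norm_sq.mul_right (‖h‖ ^ 2)
    have h3 := hasSum_le (fun i => ?_) h1 h2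
    · rw [real_inner_self_eq_norm_sq, ← mul_pow] at h3
      exact le_of_sq_le_sq h3 (by positivity)
    · rw [ContinuousLinearMap.adjoint_inner_left, ContinuousLinearMap.adjoint_inner_right,
        real_inner_comm, ← sq, ← mul_pow, ← sq_abs]
      exact pow_le_pow_left₀ (abs_nonneg _) (abs_real_inner_le_norm _ _) 2
  rw [LinearIsometryEquiv.norm_map] at h
  exact (S.toCLM.le_opNorm y).trans (mul_le_mul_of_nonneg_right h (norm_nonneg _))

/-- Evaluation of Hilbert-Schmidt operators is jointly measurable; no separability of the space
of operators is needed. -/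
theorem HilbertSchmidt.measurable_apply [MeasurableSpace U] [BorelSpace U]
    [SecondCountableTopology U] [MeasurableSpace H] [BorelSpace H] :
    Measurable fun p : U × HilbertSchmidt U H => p.2.toCLM p.1 := by
  have h : Measurable (Function.uncurry fun (y : U) (S : HilbertSchmidt U H) => S.toCLM y) := by
    refine measurable_uncurry_of_continuous_of_measurable (fun S => S.toCLM.continuous) fun y => ?_
    have hc : Continuous ((ContinuousLinearMap.apply ℝ H y).toLinearMap
        ∘ₗ (HilbertSchmidt.toCLM (U := U) (H := H))) :=
      AddMonoidHomClass.continuous_of_bound _ ‖y‖ fun S => by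
        rw [mul_comm]; exact S.norm_apply_le y
    exact hc.measurable
  exact h

/-- The inverse of the Riesz isomorphism, as a real linear operator. -/
def fromDual : StrongDual ℝ V →L[ℝ] V :=
  LinearMap.mkContinuous
    { toFun := (InnerProductSpace.toDual ℝ V).symm
      map_add' := map_add _
      map_smul' := fun r x => by simp } 1 fun x => by simp

namespace Coefficients

variable (c : Coefficients V H U) (ι : V →L[ℝ] H)

/-- The map `-A`, read in `V` through the Riesz isomorphism. It is constant in time for `t ≤ 0`, so
that it is measurable on all of `ℝ`. -/
def drift (t : ℝ) (v : V) : V :=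
  -(InnerProductSpace.toDual ℝ V).symm (c.A ι (t.toNNReal : ℝ) v)

/-- The map `B(t, ·) ψ(t)`. -/
def diffusion (ψ : ℝ → U) (t : ℝ) (v : V) : H := (c.B ι (t.toNNReal : ℝ) v).toCLM (ψ t)

variable {c ι} {T n C : ℝ} {t : ℝ}

theorem drift_eq (ht : 0 ≤ t) (v : V) :
    c.drift ι t v = -(InnerProductSpace.toDual ℝ V).symm (c.A ι t v) := by
  rw [drift, Real.coe_toNNReal t ht]

theorem diffusion_eq {ψ : ℝ → U} (ht : 0 ≤ t) (v : V) :
    c.diffusion ι ψ t v = (c.B ι t v).toCLM (ψ t) := by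
  rw [diffusion, Real.coe_toNNReal t ht]

theorem inner_drift (ht : 0 ≤ t) (v w : V) : inner ℝ (c.drift ι t v) w = -c.A ι t v w := by
  rw [drift_eq ht, inner_neg_left, InnerProductSpace.toDual_symm_apply]

theorem norm_drift_le (hb : CoefficientBounds ι c T n C) (ht : t ∈ Icc 0 T) {v : V}
    (hv : ‖ι v‖ ≤ n) : ‖c.drift ι t v‖ ≤ C * ‖v‖ + C * (1 + ‖v‖) + ‖c.f t‖ := by
  rw [drift_eq ht.1, norm_neg, LinearIsometryEquiv.norm_map, A]
  refine (norm_sub_le _ _).trans (add_le_add ((norm_sub_le _ _).trans (add_le_add ?_ ?_)) le_rfl)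
  · exact hb.A₀_le t ht v v hv
  · exact hb.F_le t ht v hv

theorem norm_B_le (hb : CoefficientBounds ι c T n C) (ht : t ∈ Icc 0 T) {v : V}
    (hv : ‖ι v‖ ≤ n) : ‖c.B ι t v‖ ≤ C * ‖v‖ + C * (1 + ‖v‖) + ‖c.g t‖ := by
  rw [B]
  refine norm_add₃_le.trans (add_le_add (add_le_add ?_ ?_) le_rfl)
  · exact hb.B₀_le t ht v v hv
  · exact hb.G_le t ht v hv

theorem exists_B_sub_le (hb : CoefficientBounds ι c T n C) :
    ∃ C', 0 ≤ C' ∧ ∀ t ∈ Icc 0 T, ∀ v w : V, ‖ι v‖ ≤ n → ‖ι w‖ ≤ n →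
      ‖c.B ι t v - c.B ι t w‖ ≤ C' * (‖v - w‖ + (1 + ‖v‖ + ‖w‖) * ‖ι v - ι w‖) := by
  obtain ⟨C₁, hC₁, hG⟩ := hb.G_sub_le 1 one_pos
  have hC := hb.nonneg
  refine ⟨C + 1 + C₁, by positivity, fun t ht v w hv hw => ?_⟩
  have e : c.B ι t v - c.B ι t w = c.B₀ t (ι v) (v - w)
      + (c.B₀ t (ι v) w - c.B₀ t (ι w) w) + (c.G t v - c.G t w) := by
    rw [B, B, map_sub]; abel
  have h1 := hb.B₀_le t ht v (v - w) hv
  have h2 := hb.B₀_sub_le t ht v w w hv hw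
  have h3 := hG t ht v w hv hw
  rw [e]
  refine norm_add₃_le.trans ((add_le_add (add_le_add h1 h2) h3).trans ?_)
  have p1 : 0 ≤ C * ‖ι v - ι w‖ * (1 + ‖v‖) := by positivity
  have p2 : 0 ≤ C₁ * ‖v - w‖ := by positivity
  have p3 : 0 ≤ (1 + ‖v‖ + ‖w‖) * ‖ι v - ι w‖ := by positivity
  linarith

theorem measurable_drift [SecondCountableTopology V] [MeasurableSpace V] [BorelSpace V]
    [MeasurableSpace H] [BorelSpace H] (hc : c.IsCritical ι) :
    Measurable (Function.uncurry (c.drift ι)) := by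
  have hJ : Measurable fun x : StrongDual ℝ V => (InnerProductSpace.toDual ℝ V).symm x :=
    (InnerProductSpace.toDual ℝ V).symm.continuous.measurable
  have h1 : Measurable (Function.uncurry fun (w : V) (q : ℝ≥0 × H) => c.A₀ q.1 q.2 w) :=
    measurable_uncurry_of_continuous_of_measurable (fun q => (c.A₀ q.1 q.2).continuous)
      hc.measurable_A₀
  have ht : Measurable fun p : ℝ × V => p.1.toNNReal := measurable_fst.real_toNNReal
  have h2 : Measurable fun p : ℝ × V => c.A₀ (p.1.toNNReal : ℝ) (ι p.2) p.2 :=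
    h1.comp (measurable_snd.prodMk (ht.prodMk (ι.continuous.measurable.comp measurable_snd)))
  have h3 : Measurable fun p : ℝ × V => c.F (p.1.toNNReal : ℝ) p.2 :=
    hc.measurable_F.comp (ht.prodMk measurable_snd)
  have h4 : Measurable fun p : ℝ × V => c.f (p.1.toNNReal : ℝ) := hc.measurable_f.comp ht
  have h5 := (((hJ.comp h2).sub (hJ.comp h3)).sub (hJ.comp h4)).neg
  convert h5 using 1
  ext p
  simp [Function.uncurry, drift, A, map_sub]

theorem aestronglyMeasurable_diffusion [SecondCountableTopology V] [MeasurableSpace V]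
    [BorelSpace V] [MeasurableSpace H] [BorelSpace H] [SecondCountableTopology H]
    [SecondCountableTopology U] (hc : c.IsCritical ι) {μ : Measure ℝ} {ψ : ℝ → U} {v : ℝ → V}
    (hψ : AEStronglyMeasurable ψ μ) (hv : AEStronglyMeasurable v μ) :
    AEStronglyMeasurable (fun t => c.diffusion ι ψ t (v t)) μ := by
  borelize U
  have h1 : Measurable (Function.uncurry fun (w : V) (q : ℝ≥0 × H) => c.B₀ q.1 q.2 w) := by
    refine measurable_uncurry_of_continuous_of_measurable (fun q => (c.B₀ q.1 q.2).continuous)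
      hc.measurable_B₀
  have ht : AEMeasurable (fun t : ℝ => t.toNNReal) μ := measurable_real_toNNReal.aemeasurable
  have hv' := hv.aemeasurable
  have h2 : AEMeasurable (fun t => c.B₀ (t.toNNReal : ℝ) (ι (v t)) (v t)) μ :=
    h1.comp_aemeasurable (hv'.prodMk (ht.prodMk (ι.continuous.measurable.comp_aemeasurable hv')))
  have h3 : AEMeasurable (fun t => c.G (t.toNNReal : ℝ) (v t)) μ :=
    hc.measurable_G.comp_aemeasurable (ht.prodMk hv')
  have h4 : AEMeasurable (fun t => c.g (t.toNNReal : ℝ)) μ := hc.measurable_g.comp_aemeasurable ht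
  have hev := HilbertSchmidt.measurable_apply (U := U) (H := H)
  have h5 := ((hev.comp_aemeasurable (hψ.aemeasurable.prodMk h2)).add
    (hev.comp_aemeasurable (hψ.aemeasurable.prodMk h3))).add
    (hev.comp_aemeasurable (hψ.aemeasurable.prodMk h4))
  convert h5.aestronglyMeasurable using 1
  ext t
  simp [diffusion, B, map_add]

/-- The drift is linearized at `y ∈ V` by freezing the coefficient of `A₀`, i.e. by
`L(t) = A₀(t, y)`. -/
theorem exists_drift_linearization [SecondCountableTopology V] [MeasurableSpace V] [BorelSpace V]
    [MeasurableSpace H] (hι : Function.Injective ι) (hc : c.IsCritical ι) (hT : 0 < T)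
    (n : ℝ) : ∃ θ M C : ℝ, 0 < θ ∧ 0 ≤ M ∧ 0 ≤ C ∧ ∀ η : ℝ, 0 < η →
    ∃ δ C' : ℝ, 0 < δ ∧ 0 ≤ C' ∧ ∀ y : V, ‖ι y‖ ≤ n → ∃ L : ℝ → V →L[ℝ] V,
      CoerciveFamily ι 0 T θ M C L ∧
      ∀ t ∈ Icc 0 T, ∀ v w : V, ‖ι v - ι y‖ ≤ δ → ‖ι w - ι y‖ ≤ δ →
        ‖c.drift ι t v + L t v - (c.drift ι t w + L t w)‖
          ≤ η * ‖v - w‖ + C' * (1 + ‖v‖ + ‖w‖) * ‖ι v - ι w‖ := by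
  have hm : 0 ≤ max n 0 + 1 := by positivity
  obtain ⟨C, hb⟩ := exists_coefficientBounds hι hc hT hm
  obtain ⟨θ, M, hθ, hM, hco⟩ := hc.coercive₀ T hT _ hm
  have hC := hb.nonneg
  refine ⟨θ, M, C, hθ, hM.le, hC, fun η hη => ?_⟩
  obtain ⟨C₁, hC₁, hF⟩ := hb.F_sub_le (η / 2) (by positivity)
  set δ := min 1 (η / (2 * (C + 1))) with hδ
  have hδ0 : 0 < δ := lt_min one_pos (by positivity)
  have hδ1 : δ ≤ 1 := min_le_left _ _
  have hδ2 : C * δ ≤ η / 2 := by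
    have h1 : δ ≤ η / (2 * (C + 1)) := min_le_right _ _
    rw [le_div_iff₀ (by positivity)] at h1
    nlinarith
  refine ⟨δ, C + C₁, hδ0, by positivity, fun y hy => ?_⟩
  have hyn : ‖ι y‖ ≤ max n 0 + 1 := by linarith [le_max_left n 0]
  set J := (InnerProductSpace.toDual ℝ V).symm with hJ
  refine ⟨fun t => fromDual.comp
    (c.A₀ (t.toNNReal : ℝ) (ι y)), ⟨fun v => ?_, fun t ht v => ?_, fun t ht v => ?_⟩, ?_⟩
  · exact J.continuous.measurable.comp
      ((hc.measurable_A₀ v).comp (measurable_real_toNNReal.prodMk measurable_const))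
  · rw [Real.coe_toNNReal t ht.1]
    refine (J.norm_map _).trans_le ?_
    exact hb.A₀_le t ht y v hyn
  · have h1 := hco t ht (ι y) v hyn
    have h2 : inner ℝ (J (c.A₀ t (ι y) v)) v = c.A₀ t (ι y) v v :=
      InnerProductSpace.toDual_symm_apply
    rw [Real.coe_toNNReal t ht.1]
    refine le_trans ?_ h2.ge
    linarith [sq_nonneg ‖c.B₀ t (ι y) v‖]
  · intro t ht v w hv hw
    have hnorm : ∀ z : V, ‖ι z - ι y‖ ≤ δ → ‖ι z‖ ≤ max n 0 + 1 := fun z hz => by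
      have := norm_sub_norm_le (ι z) (ι y)
      linarith [le_max_left n 0]
    have hvn := hnorm v hv
    have hwn := hnorm w hw
    have e : c.drift ι t v + J (c.A₀ (t.toNNReal : ℝ) (ι y) v)
        - (c.drift ι t w + J (c.A₀ (t.toNNReal : ℝ) (ι y) w))
        = J ((c.A₀ t (ι y) (v - w) - c.A₀ t (ι v) (v - w))
          + (c.A₀ t (ι w) w - c.A₀ t (ι v) w) + (c.F t v - c.F t w)) := by
      rw [drift_eq ht.1, drift_eq ht.1, Real.coe_toNNReal t ht.1, A, A]
      simp only [map_sub, map_add, ← hJ]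
      abel
    change ‖c.drift ι t v + J (c.A₀ (t.toNNReal : ℝ) (ι y) v)
        - (c.drift ι t w + J (c.A₀ (t.toNNReal : ℝ) (ι y) w))‖ ≤ _
    rw [e, J.norm_map]
    refine norm_add₃_le.trans ((add_le_add (add_le_add (hb.A₀_sub_le t ht y v (v - w) hyn hvn)
      (hb.A₀_sub_le t ht w v w hwn hvn)) (hF t ht v w hvn hwn)).trans ?_)
    rw [norm_sub_rev (ι y), norm_sub_rev (ι w)]
    have h1 : C * ‖ι v - ι y‖ * ‖v - w‖ ≤ η / 2 * ‖v - w‖ := by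
      refine mul_le_mul_of_nonneg_right (le_trans ?_ hδ2) (norm_nonneg _)
      gcongr
    have h2 : C * ‖ι v - ι w‖ * ‖w‖ ≤ C * ((1 + ‖v‖ + ‖w‖) * ‖ι v - ι w‖) := by
      rw [mul_assoc, mul_comm ‖ι v - ι w‖]
      gcongr
      linarith [norm_nonneg v]
    linarith

/-- Local monotonicity of the drift. -/
theorem exists_drift_monotone [MeasurableSpace V] [MeasurableSpace H] (hι : Function.Injective ι)
    (hc : c.IsCritical ι) (hT : 0 < T) (n : ℝ) :
    ∃ θ M C : ℝ, 0 < θ ∧ 0 ≤ M ∧ 0 ≤ C ∧ ∀ t ∈ Icc 0 T, ∀ v w : V, ‖ι v‖ ≤ n → ‖ι w‖ ≤ n →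
      inner ℝ (c.drift ι t v - c.drift ι t w) (v - w)
        ≤ -θ * ‖v - w‖ ^ 2 + M * ‖ι v - ι w‖ ^ 2
          + C * ((1 + ‖v‖ + ‖w‖) * ‖ι v - ι w‖) * ‖v - w‖ := by
  have hm : 0 ≤ max n 0 := le_max_right _ _
  obtain ⟨C, hb⟩ := exists_coefficientBounds hι hc hT hm
  obtain ⟨θ, M, hθ, hM, hco⟩ := hc.coercive₀ T hT _ hm
  obtain ⟨C₁, hC₁, hF⟩ := hb.F_sub_le (θ / 2) (by positivity)
  have hC := hb.nonneg
  refine ⟨θ / 2, M, C + C₁, by positivity, hM.le, by positivity, fun t ht v w hv hw => ?_⟩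
  have hvn := hv.trans (le_max_left n 0)
  have hwn := hw.trans (le_max_left n 0)
  have h1 := hco t ht (ι v) (v - w) hvn
  have h2 := hb.A₀_sub_le t ht v w w hvn hwn
  have h3 := hF t ht v w hvn hwn
  have h4 := ((c.A₀ t (ι v) w - c.A₀ t (ι w) w)).le_opNorm (v - w)
  rw [Real.norm_eq_abs] at h4
  have h5 := ((c.F t v - c.F t w)).le_opNorm (v - w)
  rw [Real.norm_eq_abs] at h5
  have e : inner ℝ (c.drift ι t v - c.drift ι t w) (v - w)
      = -c.A₀ t (ι v) (v - w) (v - w) - (c.A₀ t (ι v) w - c.A₀ t (ι w) w) (v - w)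
        + (c.F t v - c.F t w) (v - w) := by
    rw [inner_sub_left, inner_drift ht.1, inner_drift ht.1, A, A]
    simp only [map_sub, sub_apply]
    ring
  rw [e]
  have h6 := h4.trans (mul_le_mul_of_nonneg_right h2 (norm_nonneg _))
  have h7 := h5.trans (mul_le_mul_of_nonneg_right h3 (norm_nonneg _))
  have h8 : C * ‖ι v - ι w‖ * ‖w‖ * ‖v - w‖
      ≤ C * ((1 + ‖v‖ + ‖w‖) * ‖ι v - ι w‖) * ‖v - w‖ := by
    rw [mul_assoc C, mul_comm ‖ι v - ι w‖]
    gcongr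
    linarith [norm_nonneg v]
  have h9 := neg_abs_le ((c.A₀ t (ι v) w - c.A₀ t (ι w) w) (v - w))
  have h10 := le_abs_self ((c.F t v - c.F t w) (v - w))
  rw [map_sub ι] at h1
  nlinarith [sq_nonneg ‖c.B₀ t (ι v) (v - w)‖]

theorem young_half {θ x y : ℝ} (hθ : 0 < θ) : y * x ≤ θ / 4 * x ^ 2 + θ⁻¹ * y ^ 2 := by
  have e : θ / 4 * x ^ 2 + θ⁻¹ * y ^ 2 - y * x = θ⁻¹ * (θ / 2 * x - y) ^ 2 := by
    field_simp; ring
  have : 0 ≤ θ⁻¹ * (θ / 2 * x - y) ^ 2 := by positivity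
  linarith

variable [SecondCountableTopology V] [MeasurableSpace V] [BorelSpace V] [MeasurableSpace H]
  [BorelSpace H] [SecondCountableTopology H] [SecondCountableTopology U]

theorem ae_mem_Icc {a b : ℝ} (ha : 0 ≤ a) (hb : b ≤ T) :
    ∀ᵐ t ∂segMeasure a b, t ∈ Icc 0 T := by
  filter_upwards [ae_restrict_mem measurableSet_Icc] with t ht
    using ⟨ha.trans ht.1, ht.2.trans hb⟩

theorem memLp_affine {E F : Type*} [NormedAddCommGroup E] [NormedAddCommGroup F] {a b : ℝ}
    {v : ℝ → E} {g : ℝ → F} (hv : MemLp v 2 (segMeasure a b)) (hg : MemLp g 2 (segMeasure a b))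
    (C : ℝ) : MemLp (fun t => C * ‖v t‖ + C * (1 + ‖v t‖) + ‖g t‖) 2 (segMeasure a b) := by
  have h1 : MemLp (fun _ : ℝ => (1 : ℝ)) 2 (segMeasure a b) := memLp_const 1
  have h2 : MemLp (fun t => 1 + ‖v t‖) 2 (segMeasure a b) := h1.add hv.norm
  exact ((hv.norm.const_mul C).add (h2.const_mul C)).add hg.norm

/-- The Lipschitz constant of `B(t, ·) ψ(t)` is proportional to `‖ψ(t)‖`. -/
theorem exists_diffusion_lipschitz (hι : Function.Injective ι) (hc : c.IsCritical ι) (hT : 0 < T)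
    (n : ℝ) : ∃ C, 0 ≤ C ∧ ∀ (ψ : ℝ → U), ∀ t ∈ Icc 0 T, ∀ v w : V, ‖ι v‖ ≤ n → ‖ι w‖ ≤ n →
      ‖c.diffusion ι ψ t v - c.diffusion ι ψ t w‖
        ≤ C * ‖ψ t‖ * (‖v - w‖ + (1 + ‖v‖ + ‖w‖) * ‖ι v - ι w‖) := by
  obtain ⟨C, hb⟩ := exists_coefficientBounds hι hc hT (le_max_right n 0)
  obtain ⟨C', hC', h⟩ := exists_B_sub_le hb
  refine ⟨C', hC', fun ψ t ht v w hv hw => ?_⟩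
  have h1 := h t ht v w (hv.trans (le_max_left n 0)) (hw.trans (le_max_left n 0))
  rw [diffusion_eq ht.1, diffusion_eq ht.1, ← sub_apply, ← map_sub]
  refine (HilbertSchmidt.norm_apply_le _ _).trans ?_
  calc _ ≤ C' * (‖v - w‖ + (1 + ‖v‖ + ‖w‖) * ‖ι v - ι w‖) * ‖ψ t‖ := by gcongr
    _ = _ := by ring

/-- Local monotonicity of drift and diffusion, with constants that do not depend on the control. -/
theorem exists_monotone (hι : Function.Injective ι) (hc : c.IsCritical ι) (hT : 0 < T) (n : ℝ) :
    ∃ θ D : ℝ, 0 < θ ∧ 0 ≤ D ∧ ∀ (ψ : ℝ → U), ∀ t ∈ Icc 0 T, ∀ v w : V, ‖ι v‖ ≤ n → ‖ι w‖ ≤ n →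
      inner ℝ (c.drift ι t v - c.drift ι t w) (v - w)
        + inner ℝ (c.diffusion ι ψ t v - c.diffusion ι ψ t w) (ι v - ι w)
        ≤ -θ * ‖v - w‖ ^ 2
          + D * (1 + ‖ψ t‖ ^ 2 + (‖v‖ ^ 2 + ‖w‖ ^ 2)) * ‖ι v - ι w‖ ^ 2 := by
  obtain ⟨θ, M, C, hθ, hM, hC, hmon⟩ := exists_drift_monotone hι hc hT n
  obtain ⟨C', hC', hlip⟩ := exists_diffusion_lipschitz hι hc hT n
  refine ⟨θ / 2, M + 3 * (θ⁻¹ * C ^ 2 + 1) + (θ⁻¹ + 1) * C' ^ 2, by positivity, by positivity,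
    fun ψ t ht v w hv hw => ?_⟩
  have h1 := hmon t ht v w hv hw
  have h2 := (real_inner_le_norm (c.diffusion ι ψ t v - c.diffusion ι ψ t w)
    (ι v - ι w)).trans (mul_le_mul_of_nonneg_right (hlip ψ t ht v w hv hw) (norm_nonneg _))
  set Y := 1 + ‖v‖ + ‖w‖ with hY
  set d := ‖v - w‖
  set h := ‖ι v - ι w‖
  set κ := C' * ‖ψ t‖ with hκ
  have hY2 : Y ^ 2 ≤ 3 * (1 + ‖v‖ ^ 2 + ‖w‖ ^ 2) := by
    rw [hY]
    nlinarith [sq_nonneg (‖v‖ - 1), sq_nonneg (‖w‖ - 1), sq_nonneg (‖v‖ - ‖w‖)]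
  have y1 := young_half (x := d) (y := C * (Y * h)) hθ
  have y2 := young_half (x := d) (y := κ * h) hθ
  have y3 : κ * (Y * h) * h ≤ (κ ^ 2 + Y ^ 2) * h ^ 2 := by
    have : 0 ≤ ((κ - Y) ^ 2 + κ ^ 2 + Y ^ 2) * h ^ 2 := by positivity
    nlinarith
  have y4 : (θ⁻¹ * C ^ 2 + 1) * (Y ^ 2 * h ^ 2)
      ≤ (θ⁻¹ * C ^ 2 + 1) * (3 * (1 + ‖v‖ ^ 2 + ‖w‖ ^ 2) * h ^ 2) := by gcongr
  have y5 : (M + 3 * (θ⁻¹ * C ^ 2 + 1) * (1 + (‖v‖ ^ 2 + ‖w‖ ^ 2)) + (θ⁻¹ + 1) * κ ^ 2) * h ^ 2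
      ≤ (M + 3 * (θ⁻¹ * C ^ 2 + 1) + (θ⁻¹ + 1) * C' ^ 2)
        * (1 + ‖ψ t‖ ^ 2 + (‖v‖ ^ 2 + ‖w‖ ^ 2)) * h ^ 2 := by
    refine mul_le_mul_of_nonneg_right ?_ (sq_nonneg _)
    have p1 : 0 ≤ M * (‖ψ t‖ ^ 2 + (‖v‖ ^ 2 + ‖w‖ ^ 2)) := by positivity
    have p2 : 0 ≤ 3 * (θ⁻¹ * C ^ 2 + 1) * ‖ψ t‖ ^ 2 := by positivity
    have p3 : 0 ≤ (θ⁻¹ + 1) * C' ^ 2 * (1 + (‖v‖ ^ 2 + ‖w‖ ^ 2)) := by positivity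
    rw [hκ, mul_pow]
    linarith
  linarith

/-- The coefficients of the skeleton equation satisfy the hypotheses of the abstract theory. -/
theorem nonlinearity (hι : Function.Injective ι) (hc : c.IsCritical ι) (hT : 0 < T) {ψ : ℝ → U}
    (hψ : MemLp ψ 2 (segMeasure 0 T)) : Nonlinearity ι T (c.drift ι) (c.diffusion ι ψ) := by
  refine ⟨fun a b n v ha hb hv hvn => ?_, fun a b n v ha hb hv hvn => ?_, fun n => ?_,
    exists_drift_linearization hι hc hT, fun n => ?_⟩
  · obtain ⟨C, hC⟩ := exists_coefficientBounds hι hc hT (le_max_right n 0)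
    have hf : MemLp c.f 2 (segMeasure a b) := (hc.memLp_f T hT).mono_measure
      (Measure.restrict_mono (Icc_subset_Icc ha hb) le_rfl)
    have hmaj : MemLp (fun t => C * ‖v t‖ + C * (1 + ‖v t‖) + ‖c.f t‖) 2 (segMeasure a b) :=
      memLp_affine hv hf C
    have hm : AEMeasurable (fun t => c.drift ι t (v t)) (segMeasure a b) :=
      (measurable_drift hc).comp_aemeasurable (f := fun t => (t, v t))
        (aemeasurable_id.prodMk hv.1.aemeasurable)
    refine hmaj.mono' hm.aestronglyMeasurable ?_
    filter_upwards [hvn, ae_mem_Icc ha hb] with t h1 h2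
    exact norm_drift_le hC h2 (h1.trans (le_max_left n 0))
  · obtain ⟨C, hC⟩ := exists_coefficientBounds hι hc hT (le_max_right n 0)
    have hle : segMeasure a b ≤ segMeasure 0 T :=
      Measure.restrict_mono (Icc_subset_Icc ha hb) le_rfl
    have hg : MemLp c.g 2 (segMeasure a b) := (hc.memLp_g T hT).mono_measure hle
    have hψ' := hψ.mono_measure hle
    have hmaj : MemLp (fun t => C * ‖v t‖ + C * (1 + ‖v t‖) + ‖c.g t‖) 2 (segMeasure a b) :=
      memLp_affine hv hg C
    refine (hmaj.integrable_mul hψ'.norm).mono' (aestronglyMeasurable_diffusion hc hψ'.1 hv.1) ?_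
    filter_upwards [hvn, ae_mem_Icc ha hb] with t h1 h2
    rw [diffusion_eq h2.1]
    refine (HilbertSchmidt.norm_apply_le _ _).trans ?_
    exact mul_le_mul_of_nonneg_right (norm_B_le hC h2 (h1.trans (le_max_left n 0)))
      (norm_nonneg _)
  · obtain ⟨C, hC, h⟩ := exists_diffusion_lipschitz hι hc hT n
    exact ⟨fun t => C * ‖ψ t‖, hψ.norm.const_mul C, fun t => by positivity, h ψ⟩
  · obtain ⟨θ, D, hθ, hD, h⟩ := exists_monotone hι hc hT n
    have hψ2 : Integrable (fun t => ‖ψ t‖ ^ 2) (segMeasure 0 T) :=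
      (memLp_two_iff_integrable_sq_norm hψ.1).1 hψ
    refine ⟨θ, fun t => D * (1 + ‖ψ t‖ ^ 2), D, hθ, hD,
      ((integrable_const _).add hψ2).const_mul D, fun t => by positivity, fun t ht v w hv hw => ?_⟩
    refine (h ψ t ht v w hv hw).trans (le_of_eq ?_)
    ring

end Coefficients

end CoefficientMaps

/-! ### Strong solutions of the skeleton equation -/

section SkeletonSolutions

open Filter Topology

variable {V H U : Type*} [NormedAddCommGroup V] [InnerProductSpace ℝ V] [CompleteSpace V]
  [NormedAddCommGroup H] [InnerProductSpace ℝ H] [CompleteSpace H]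
  [NormedAddCommGroup U] [InnerProductSpace ℝ U] [CompleteSpace U]
  {ι : V →L[ℝ] H} {T : ℝ}

/-- The path of an element of `MR(0, T)`, extended to `ℝ` by constants. -/
def pathOf (hT : 0 ≤ T) (u : MR ι T) : ℝ → H := IccExtend hT (contPart u)

theorem pathOf_apply (hT : 0 ≤ T) (u : MR ι T) {t : ℝ} (ht : t ∈ Icc 0 T) :
    pathOf hT u t = contPart u ⟨t, ht⟩ := IccExtend_of_mem hT _ ht

theorem pathOf_sub (hT : 0 ≤ T) (u w : MR ι T) (t : ℝ) :
    pathOf hT (u - w) t = pathOf hT u t - pathOf hT w t := rfl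

theorem isPath_pathOf (hι : Function.Injective ι) (hT : 0 ≤ T) (u : MR ι T) :
    IsPath ι 0 T (pathOf hT u) ∧ ∀ᵐ t ∂segMeasure 0 T, lift ι (pathOf hT u t) = l2Part u t := by
  refine isPath_of_ae_eq hι ((contPart u).continuous.Icc_extend').continuousOn
    (Lp.memLp (l2Part u)) ?_
  filter_upwards [u.2, ae_restrict_mem measurableSet_Icc] with t h1 h2
  rw [pathOf_apply hT u h2]
  exact h1 h2

theorem exists_pathOf_eq (hT : 0 ≤ T) {w : ℝ → H} (hw : IsPath ι 0 T w) :
    ∃ u : MR ι T, ∀ t ∈ Icc 0 T, pathOf hT u t = w t := by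
  refine ⟨⟨WithLp.toLp 1 (⟨(Icc 0 T).domRestrict w, hw.cont.domRestrict⟩, hw.memLp.toLp _), ?_⟩,
    fun t ht => ?_⟩
  · change ∀ᵐ t ∂timeMeasure T, ∀ ht : t ∈ Icc (0 : ℝ) T, ι (hw.memLp.toLp _ t) = w t
    filter_upwards [hw.memLp.coeFn_toLp, hw.ae_eq] with t h1 h2 _
    rw [h1, h2]
  · rw [pathOf_apply hT _ ht]
    rfl

theorem norm_le_of_pathOf (hι : Function.Injective ι) (hT : 0 ≤ T) (u : MR ι T) {K K' : ℝ}
    (hK : 0 ≤ K) (hK' : 0 ≤ K') (h : ∀ t ∈ Icc 0 T, ‖pathOf hT u t‖ ≤ K)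
    (h' : ∫ t, ‖lift ι (pathOf hT u t)‖ ^ 2 ∂segMeasure 0 T ≤ K' ^ 2) : ‖u‖ ≤ K + K' := by
  rw [mr_norm_eq]
  refine add_le_add ((ContinuousMap.norm_le _ hK).2 fun t => ?_) ?_
  · rw [← pathOf_apply hT u t.2]
    exact h t t.2
  · refine le_of_sq_le_sq ?_ hK'
    rw [Lp.norm_def, toReal_eLpNorm_two_sq (Lp.memLp (l2Part u))]
    refine le_trans (le_of_eq (integral_congr_ae ?_)) h'
    filter_upwards [(isPath_pathOf hι hT u).2] with t ht
    rw [ht]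

theorem eq_of_pathOf_eq (hι : Function.Injective ι) (hT : 0 ≤ T) {u w : MR ι T}
    (h : ∀ t ∈ Icc 0 T, pathOf hT u t = pathOf hT w t) : u = w := by
  have hl : lift ι (0 : H) = 0 := by simpa using lift_iota ι hι 0
  have h0 : ∀ t ∈ Icc 0 T, pathOf hT (u - w) t = 0 := fun t ht => by
    rw [pathOf_sub, h t ht, sub_self]
  have h2 : ∫ t, ‖lift ι (pathOf hT (u - w) t)‖ ^ 2 ∂segMeasure 0 T ≤ (0 : ℝ) ^ 2 := by
    rw [zero_pow two_ne_zero]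
    refine (integral_eq_zero_of_ae ?_).le
    filter_upwards [ae_restrict_mem measurableSet_Icc] with t ht
    rw [h0 t ht, hl, norm_zero, zero_pow two_ne_zero, Pi.zero_apply]
  have h1 := norm_le_of_pathOf hι hT (u - w) le_rfl le_rfl
    (fun t ht => (norm_eq_zero.2 (h0 t ht)).le) h2
  rw [add_zero] at h1
  exact sub_eq_zero.1 (norm_le_zero_iff.1 h1)

variable (V) in
/-- The Riesz isomorphism as a real linear operator. -/
def riesz : V →L[ℝ] StrongDual ℝ V := toDualV (ContinuousLinearMap.id ℝ V)

theorem riesz_apply (v w : V) : riesz V v w = inner ℝ v w := rfl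

theorem riesz_injective : Function.Injective (riesz V) := fun v w h =>
  ext_inner_right ℝ fun z => by rw [← riesz_apply, h, riesz_apply]

theorem riesz_emb (h : H) : riesz V (emb ι h) = toDualV ι h := by
  ext v
  rw [riesz_apply, inner_emb_left, toDualV_apply]

namespace Coefficients

variable {c : Coefficients V H U}

theorem skeleton_eq_riesz (ψ : ℝ → U) {t : ℝ} (ht : 0 ≤ t) (v : V) :
    c.A ι t v - toDualV ι ((c.B ι t v).toCLM (ψ t))
      = -riesz V (c.drift ι t v + emb ι (c.diffusion ι ψ t v)) := by
  ext w
  rw [sub_apply, toDualV_apply, neg_apply, riesz_apply, inner_add_left, inner_drift ht,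
    inner_emb_left, diffusion_eq ht]
  ring

variable [SecondCountableTopology V] [MeasurableSpace V] [BorelSpace V] [MeasurableSpace H]
  [BorelSpace H] [SecondCountableTopology H] [SecondCountableTopology U]

theorem isSkeletonSolution_iff (hι : Function.Injective ι) (hι' : DenseRange ι)
    (hc : c.IsCritical ι) (hT : 0 < T) (x : H) (ψ : Lp U 2 (timeMeasure T)) (u : MR ι T) :
    c.IsSkeletonSolution x ψ u ↔
      IsNSol ι 0 T (c.drift ι) (c.diffusion ι ψ) (pathOf hT.le u) ∧ pathOf hT.le u 0 = x := by
  have hP := nonlinearity hι hc hT (Lp.memLp ψ)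
  obtain ⟨hpath, hae⟩ := isPath_pathOf hι hT.le u
  have hα := hP.memLp 0 T _ le_rfl le_rfl hpath
  have hβ := hP.integrable 0 T _ le_rfl le_rfl hpath
  have hsrc := integrable_source (ι := ι) hα hβ
  have h0 : (0 : ℝ) ∈ Icc 0 T := left_mem_Icc.2 hT.le
  have hA : ∀ᵐ s ∂segMeasure 0 T,
      c.A ι s (l2Part u s) - toDualV ι ((c.B ι s (l2Part u s)).toCLM (ψ s))
      = -riesz V (c.drift ι s (lift ι (pathOf hT.le u s))
        + emb ι (c.diffusion ι ψ s (lift ι (pathOf hT.le u s)))) := by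
    filter_upwards [hae, ae_restrict_mem measurableSet_Icc] with s h1 h2
    rw [h1, skeleton_eq_riesz _ h2.1]
  have hint : ∀ t : Icc (0 : ℝ) T,
      toDualV ι x - ∫ s in (0 : ℝ)..t,
        (c.A ι s (l2Part u s) - toDualV ι ((c.B ι s (l2Part u s)).toCLM (ψ s)))
      = riesz V (emb ι x + ∫ s in (0 : ℝ)..t, (c.drift ι s (lift ι (pathOf hT.le u s))
        + emb ι (c.diffusion ι ψ s (lift ι (pathOf hT.le u s))))) := by
    intro t
    rw [map_add, riesz_emb, ← ContinuousLinearMap.intervalIntegral_comp_comm _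
      (intervalIntegrable_of_restrict hsrc h0 t.2), sub_eq_add_neg,
      ← intervalIntegral.integral_neg]
    congr 1
    refine intervalIntegral.integral_congr_ae ?_
    filter_upwards [(ae_restrict_iff' measurableSet_Icc).1 hA] with s h1 h2
    rw [uIoc_of_le t.2.1] at h2
    rw [h1 ⟨h2.1.le, h2.2.trans t.2.2⟩, neg_neg]
  constructor
  · intro h
    have key : ∀ t : Icc (0 : ℝ) T, emb ι (pathOf hT.le u t) = emb ι x
        + ∫ s in (0 : ℝ)..t, (c.drift ι s (lift ι (pathOf hT.le u s))
        + emb ι (c.diffusion ι ψ s (lift ι (pathOf hT.le u s)))) := by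
      intro t
      refine riesz_injective ?_
      rw [← hint t, riesz_emb, pathOf_apply hT.le u t.2]
      exact h.eq_integral t
    have hx : pathOf hT.le u 0 = x := by
      refine emb_injective ι hι' ?_
      simpa using key ⟨0, h0⟩
    refine ⟨⟨hpath, fun t ht => ?_⟩, hx⟩
    rw [hx]
    exact key ⟨t, ht⟩
  · rintro ⟨h, hx⟩
    refine ⟨⟨fun s => -riesz V (c.drift ι s (lift ι (pathOf hT.le u s))),
      fun s => -c.diffusion ι ψ s (lift ι (pathOf hT.le u s)),
      ((riesz V).comp_memLp' hα).neg, (memLp_one_iff_integrable.2 hβ).neg, ?_⟩, fun t => ?_⟩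
    · filter_upwards [hA] with s hs
      rw [hs, map_add, riesz_emb, map_neg, neg_add]
    · rw [hint t, ← pathOf_apply hT.le u t.2, ← riesz_emb, h.eq t t.2, hx]

/-- The a priori bound that follows from coercivity; it depends on the control only through its
norm in `L²(0, T; U)`. -/
theorem exists_apriori (hι : Function.Injective ι) (hι' : DenseRange ι)
    (hc : c.IsCritical ι) (hc' : c.IsCoercive ι) (hT : 0 < T) (x : H) (K : ℝ) :
    ∃ R, ∀ ψ : ℝ → U, MemLp ψ 2 (segMeasure 0 T) → ∫ t, ‖ψ t‖ ^ 2 ∂segMeasure 0 T ≤ K →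
      ∀ (b : ℝ) (u : ℝ → H), 0 ≤ b → b ≤ T → IsNSol ι 0 b (c.drift ι) (c.diffusion ι ψ) u →
      u 0 = x →
      (∀ t ∈ Icc 0 b, ‖u t‖ ≤ R) ∧ ∫ t, ‖lift ι (u t)‖ ^ 2 ∂segMeasure 0 b ≤ R := by
  obtain ⟨θ, M, φ, hθ, hM, hφ, hco⟩ := hc' T hT
  set Q : ℝ := (‖x‖ ^ 2 + 2 * ∫ t, φ t ^ 2 ∂segMeasure 0 T) * Real.exp (2 * M * T + K) with hQ
  have hφ0 : 0 ≤ ∫ t, φ t ^ 2 ∂segMeasure 0 T := integral_nonneg fun _ => sq_nonneg _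
  have hQ0 : 0 ≤ Q := by positivity
  refine ⟨√Q + Q / (2 * θ), fun ψ hψ hψK b u hb hbT hu hx => ?_⟩
  have hP := nonlinearity hι hc hT hψ
  have hle : segMeasure 0 b ≤ segMeasure 0 T :=
    Measure.restrict_mono (Icc_subset_Icc_right hbT) le_rfl
  have hψ2 : Integrable (fun t => ‖ψ t‖ ^ 2) (segMeasure 0 T) :=
    (memLp_two_iff_integrable_sq_norm hψ.1).1 hψ
  have hφ2 : Integrable (fun t => φ t ^ 2) (segMeasure 0 T) := hφ.integrable_sq
  have hα := hP.memLp 0 b u le_rfl hbT hu.isPath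
  have hβ := hP.integrable 0 b u le_rfl hbT hu.isPath
  have hmono : ∀ {f : ℝ → ℝ}, (∀ t, 0 ≤ f t) → Integrable f (segMeasure 0 T) → ∀ t ∈ Icc 0 T,
      ∫ s in (0 : ℝ)..t, f s ≤ ∫ s, f s ∂segMeasure 0 T := by
    intro f hf hfi t ht
    rw [integral_segMeasure hT.le]
    exact intervalIntegral.integral_mono_interval le_rfl ht.1 ht.2 (ae_of_all _ hf)
      (intervalIntegrable_of_restrict hfi (left_mem_Icc.2 hT.le) (right_mem_Icc.2 hT.le))
  have hE : ∀ t ∈ Icc 0 b, ‖u t‖ ^ 2 + 2 * θ * ∫ s in (0 : ℝ)..t, ‖lift ι (u s)‖ ^ 2 ≤ Q := by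
    intro t ht
    have h := IsSol.energy_le hι hι' hu hα hβ (ρ := fun t => 2 * M + ‖ψ t‖ ^ 2)
      (γ := fun t => 2 * φ t ^ 2) (Γ := 2 * ∫ t, φ t ^ 2 ∂segMeasure 0 T) hθ.le
      ((integrable_const _).add (hψ2.mono_measure hle)) (fun t _ => by positivity)
      ((hφ2.mono_measure hle).const_mul 2) (fun t ht => ?_) ?_ ht
    · refine h.trans ?_
      rw [hx, hQ]
      refine mul_le_mul_of_nonneg_left (Real.exp_le_exp.2 ?_) (by positivity)
      rw [intervalIntegral.integral_add intervalIntegrable_const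
        (intervalIntegrable_of_restrict hψ2 (left_mem_Icc.2 hT.le) ⟨hb, hbT⟩),
        intervalIntegral.integral_const, smul_eq_mul, sub_zero]
      have h1 := hmono (fun t => sq_nonneg ‖ψ t‖) hψ2 b ⟨hb, hbT⟩
      nlinarith
    · rw [intervalIntegral.integral_const_mul]
      have := hmono (fun t => sq_nonneg (φ t)) hφ2 t ⟨ht.1, ht.2.trans hbT⟩
      linarith
    · filter_upwards [hu.isPath.ae_eq, ae_restrict_mem measurableSet_Icc] with s h1 h2
      have h3 := hco (lift ι (u s)) s ⟨h2.1, h2.2.trans hbT⟩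
      rw [inner_drift h2.1, diffusion_eq h2.1]
      rw [h1, sq_abs] at h3
      have h4 := (real_inner_le_norm ((c.B ι s (lift ι (u s))).toCLM (ψ s)) (u s)).trans
        (mul_le_mul_of_nonneg_right (HilbertSchmidt.norm_apply_le _ _) (norm_nonneg _))
      -- half of `‖B‖²` absorbs `(B ψ, u)` up to half of `‖ψ‖² ‖u‖²`
      nlinarith [sq_nonneg (‖c.B ι s (lift ι (u s))‖ - ‖ψ s‖ * ‖u s‖)]
  have hint : ∀ t ∈ Icc 0 b, 0 ≤ ∫ s in (0 : ℝ)..t, ‖lift ι (u s)‖ ^ 2 := fun t ht =>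
    intervalIntegral.integral_nonneg ht.1 fun _ _ => by positivity
  constructor
  · intro t ht
    have h1 := hE t ht
    have h2 := mul_nonneg hθ.le (hint t ht)
    have h3 : ‖u t‖ ≤ √Q := Real.le_sqrt_of_sq_le (by linarith)
    have : 0 ≤ Q / (2 * θ) := by positivity
    linarith
  · have h1 := hE b (right_mem_Icc.2 hb)
    rw [integral_segMeasure hb]
    have h2 : ∫ s in (0 : ℝ)..b, ‖lift ι (u s)‖ ^ 2 ≤ Q / (2 * θ) := by
      rw [le_div_iff₀ (by positivity)]
      linarith [sq_nonneg ‖u b‖]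
    linarith [Real.sqrt_nonneg Q]

/-- Existence and uniqueness of strong solutions, expressed by a solution map. -/
theorem exists_solutionMap (hι : Function.Injective ι) (hι' : DenseRange ι)
    (hc : c.IsCritical ι) (hc' : c.IsCoercive ι) (hT : 0 < T) (x : H) :
    ∃ S : Lp U 2 (timeMeasure T) → MR ι T,
      ∀ (ψ : Lp U 2 (timeMeasure T)) (u : MR ι T), c.IsSkeletonSolution x ψ u ↔ u = S ψ := by
  have hex : ∀ ψ : Lp U 2 (timeMeasure T), ∃ u : MR ι T, c.IsSkeletonSolution x ψ u := by
    intro ψ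
    have hψ := Lp.memLp ψ
    obtain ⟨R, hR⟩ := exists_apriori hι hι' hc hc' hT x (∫ t, ‖ψ t‖ ^ 2 ∂segMeasure 0 T)
    have hP := nonlinearity hι hc hT hψ
    obtain ⟨w, hw, hwx⟩ := hP.exists_global hι hι' hT x fun b u h1 h2 h3 h4 =>
      hR ψ hψ le_rfl b u h1 h2 h3 h4
    obtain ⟨u, hu⟩ := exists_pathOf_eq hT.le hw.isPath
    refine ⟨u, (isSkeletonSolution_iff hι hι' hc hT x ψ u).2
      ⟨hw.eqOn fun t ht => (hu t ht).symm, ?_⟩⟩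
    rw [hu 0 (left_mem_Icc.2 hT.le), hwx]
  choose S hS using hex
  refine ⟨S, fun ψ u => ⟨fun h => ?_, fun h => h ▸ hS ψ⟩⟩
  have h1 := (isSkeletonSolution_iff hι hι' hc hT x ψ u).1 h
  have h2 := (isSkeletonSolution_iff hι hι' hc hT x ψ (S ψ)).1 (hS ψ)
  exact eq_of_pathOf_eq hι hT.le fun t ht =>
    (nonlinearity hι hc hT (Lp.memLp ψ)).unique hι hι' le_rfl le_rfl h1.1 h2.1
      (h1.2.trans h2.2.symm) ht

end Coefficients

end SkeletonSolutions

/-! ### Finite rank approximation of families of Hilbert-Schmidt operators -/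

section HilbertSchmidtApproximation

open Filter Topology

variable {V H U : Type*} [NormedAddCommGroup V] [InnerProductSpace ℝ V] [CompleteSpace V]
  [NormedAddCommGroup H] [InnerProductSpace ℝ H] [CompleteSpace H]
  [NormedAddCommGroup U] [InnerProductSpace ℝ U] [CompleteSpace U]
  {ι : V →L[ℝ] H} {T : ℝ}

theorem countable_hsIndex [SecondCountableTopology U] : Countable (hsIndex U) := by
  have hdisj : (univ : Set (hsIndex U)).PairwiseDisjoint
      fun i => Metric.ball (hsBasis U i) (1 / 2) := by
    intro i _ j _ hij
    refine Metric.ball_disjoint_ball ?_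
    have h1 : ‖hsBasis U i - hsBasis U j‖ ^ 2 = 2 := by
      rw [norm_sub_sq_real, (hsBasis U).orthonormal.norm_eq_one,
        (hsBasis U).orthonormal.norm_eq_one, (hsBasis U).orthonormal.inner_eq_zero hij]
      norm_num
    rw [dist_eq_norm]
    nlinarith [norm_nonneg (hsBasis U i - hsBasis U j)]
  refine countable_univ_iff.1 (hdisj.countable_of_isOpen (fun _ _ => Metric.isOpen_ball)
    fun i _ => Metric.nonempty_ball.2 (by norm_num))

/-- The composition `D S` of a bounded operator `D` with a Hilbert-Schmidt operator `S`. -/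
def HilbertSchmidt.postcomp (D : H →L[ℝ] H) (S : HilbertSchmidt U H) : HilbertSchmidt U H :=
  ⟨D.comp S.toCLM, by
    refine memℓp_gen ?_
    simp only [ENNReal.toReal_ofNat, Real.rpow_ofNat]
    refine (S.hasSum_norm_sq.summable.mul_left (‖D‖ ^ 2)).of_nonneg_of_le
      (fun i => sq_nonneg _) fun i => ?_
    rw [← mul_pow]
    exact pow_le_pow_left₀ (norm_nonneg _) (D.le_opNorm _) 2⟩

theorem HilbertSchmidt.toCLM_postcomp (D : H →L[ℝ] H) (S : HilbertSchmidt U H) (y : U) :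
    (S.postcomp D).toCLM y = D (S.toCLM y) := rfl

theorem HilbertSchmidt.norm_postcomp_le (D : H →L[ℝ] H) (S : HilbertSchmidt U H) :
    ‖S.postcomp D‖ ≤ ‖D‖ * ‖S‖ := by
  have h := hasSum_le (fun i => ?_) (S.postcomp D).hasSum_norm_sq
    (S.hasSum_norm_sq.mul_left (‖D‖ ^ 2))
  · rw [← mul_pow] at h
    exact le_of_sq_le_sq h (by positivity)
  · rw [← mul_pow, toCLM_postcomp]
    exact pow_le_pow_left₀ (norm_nonneg _) (D.le_opNorm _) 2

theorem HilbertSchmidt.tendsto_postcomp {X : Type*} {l : Filter X} {D : X → H →L[ℝ] H} {M : ℝ}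
    (hM : ∀ x, ‖D x‖ ≤ M) (hD : ∀ h, Tendsto (fun x => D x h) l (𝓝 0)) (S : HilbertSchmidt U H) :
    Tendsto (fun x => ‖S.postcomp (D x)‖ ^ 2) l (𝓝 0) := by
  have e : ∀ x, ‖S.postcomp (D x)‖ ^ 2 = ∑' i, ‖D x (S.toCLM (hsBasis U i))‖ ^ 2 := fun x =>
    (S.postcomp (D x)).hasSum_norm_sq.tsum_eq.symm
  simp_rw [e]
  have h := tendsto_tsum_of_dominated_convergence (𝓕 := l)
    (f := fun x i => ‖D x (S.toCLM (hsBasis U i))‖ ^ 2) (g := fun _ => (0 : ℝ))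
    (S.hasSum_norm_sq.summable.mul_left (M ^ 2)) (fun i => ?_) (Eventually.of_forall fun x i => ?_)
  · simpa using h
  · simpa using (hD (S.toCLM (hsBasis U i))).norm.pow 2
  · rw [norm_pow, norm_norm, ← mul_pow]
    exact pow_le_pow_left₀ (norm_nonneg _) ((D x).le_of_opNorm_le (hM x) _) 2

variable (ι) in
/-- Operators `H → V` of finite rank: a spectral truncation followed by the regularization
`(ι† ι + ε)⁻¹ ι†`. -/
def finiteRank (p : ℕ × Finset (hsIndex H)) : H →L[ℝ] V :=
  ∑ k ∈ p.2, (innerSL ℝ (hsBasis H k)).smulRight (resolv ι (epsSeq p.1) (emb ι (hsBasis H k)))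

theorem finiteRank_apply (p : ℕ × Finset (hsIndex H)) (h : H) :
    finiteRank ι p h = ∑ k ∈ p.2,
      inner ℝ (hsBasis H k) h • resolv ι (epsSeq p.1) (emb ι (hsBasis H k)) := by
  simp [finiteRank]

theorem finiteRank_eq (p : ℕ × Finset (hsIndex H)) (h : H) :
    finiteRank ι p h = resolv ι (epsSeq p.1) (emb ι (∑ k ∈ p.2,
      inner ℝ (hsBasis H k) h • hsBasis H k)) := by
  simp [finiteRank_apply, map_sum, map_smul]

theorem norm_truncation_le (s : Finset (hsIndex H)) (h : H) :
    ‖∑ k ∈ s, inner ℝ (hsBasis H k) h • hsBasis H k‖ ≤ ‖h‖ := by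
  refine le_of_sq_le_sq ?_ (norm_nonneg _)
  rw [← real_inner_self_eq_norm_sq, (hsBasis H).orthonormal.inner_sum]
  refine le_trans (le_of_eq (Finset.sum_congr rfl fun k _ => ?_))
    ((hsBasis H).orthonormal.sum_inner_products_le h (s := s))
  simp [sq]

theorem norm_sub_finiteRank_le (p : ℕ × Finset (hsIndex H)) :
    ‖ContinuousLinearMap.id ℝ H - ι.comp (finiteRank ι p)‖ ≤ 2 := by
  refine ContinuousLinearMap.opNorm_le_bound _ zero_le_two fun h => ?_
  have h1 : ‖ι (finiteRank ι p h)‖ ≤ ‖h‖ := by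
    rw [finiteRank_eq]
    exact (norm_iota_resolv_emb_le ι (epsSeq_pos _) _).trans (norm_truncation_le _ _)
  have h2 := norm_sub_le h (ι (finiteRank ι p h))
  change ‖h - ι (finiteRank ι p h)‖ ≤ _
  linarith

theorem tendsto_sub_finiteRank (hι : Function.Injective ι) (hι' : DenseRange ι) (h : H) :
    Tendsto (fun p => (ContinuousLinearMap.id ℝ H - ι.comp (finiteRank ι p)) h) atTop (𝓝 0) := by
  have h1 : Tendsto (fun s : Finset (hsIndex H) =>
      ‖h - ∑ k ∈ s, inner ℝ (hsBasis H k) h • hsBasis H k‖) atTop (𝓝 0) := by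
    have h2 : Tendsto (fun s : Finset (hsIndex H) =>
        ∑ k ∈ s, inner ℝ (hsBasis H k) h • hsBasis H k) atTop (𝓝 h) := by
      have := (hsBasis H).hasSum_repr h
      simpa [HasSum, HilbertBasis.repr_apply_apply] using this
    simpa using (h2.const_sub h).norm
  have h3 : Tendsto (fun n => ‖h - ι (resolv ι (epsSeq n) (emb ι h))‖) atTop (𝓝 0) := by
    simpa using ((tendsto_iota_resolv_emb ι hι hι' h).const_sub h).norm
  rw [← prod_atTop_atTop_eq]
  refine squeeze_zero_norm (fun p => ?_) (by
    simpa using (h3.comp tendsto_fst).add (h1.comp tendsto_snd))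
  change ‖h - ι (finiteRank ι p h)‖ ≤ _
  rw [finiteRank_eq]
  set P := ∑ k ∈ p.2, inner ℝ (hsBasis H k) h • hsBasis H k with hP
  have e : h - ι (resolv ι (epsSeq p.1) (emb ι P))
      = (h - ι (resolv ι (epsSeq p.1) (emb ι h)))
        + ι (resolv ι (epsSeq p.1) (emb ι (h - P))) := by
    simp only [map_sub]; abel
  rw [e]
  exact (norm_add_le _ _).trans (add_le_add le_rfl (norm_iota_resolv_emb_le ι (epsSeq_pos _) _))

/-- A family of Hilbert-Schmidt operators on `[0, T]` that is measurable, in the sense that it maps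
measurable functions to measurable functions, and bounded by `m ∈ L²(0, T)`. -/
structure SquareIntegrableFamily (T : ℝ) (b : ℝ → HilbertSchmidt U H) (m : ℝ → ℝ) : Prop where
  measurable : ∀ ψ : ℝ → U, AEStronglyMeasurable ψ (segMeasure 0 T) →
    AEStronglyMeasurable (fun t => (b t).toCLM (ψ t)) (segMeasure 0 T)
  memLp : MemLp m 2 (segMeasure 0 T)
  bound : ∀ᵐ t ∂segMeasure 0 T, ‖b t‖ ≤ m t

variable {b : ℝ → HilbertSchmidt U H} {m : ℝ → ℝ}

/-- The Hilbert-Schmidt norm is a countable sum of measurable functions, even though measurability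
of `b` in the Hilbert-Schmidt norm is not assumed. -/
theorem SquareIntegrableFamily.aestronglyMeasurable_norm_postcomp [SecondCountableTopology U]
    (hb : SquareIntegrableFamily T b m) (D : H →L[ℝ] H) :
    AEStronglyMeasurable (fun t => ‖(b t).postcomp D‖ ^ 2) (segMeasure 0 T) := by
  have := countable_hsIndex (U := U)
  have e : ∀ t, ‖(b t).postcomp D‖ ^ 2 = (∑' i, ENNReal.ofReal
      (‖D ((b t).toCLM (hsBasis U i))‖ ^ 2)).toReal := fun t => by
    have h : HasSum (fun i => ‖D ((b t).toCLM (hsBasis U i))‖ ^ 2) (‖(b t).postcomp D‖ ^ 2) :=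
      ((b t).postcomp D).hasSum_norm_sq
    rw [← ENNReal.ofReal_tsum_of_nonneg (fun i => sq_nonneg _) h.summable,
      ENNReal.toReal_ofReal (tsum_nonneg fun i => sq_nonneg _)]
    exact h.tsum_eq.symm
  simp_rw [e]
  refine (AEMeasurable.tsum fun i => ?_).ennreal_toReal.aestronglyMeasurable
  exact (((D.continuous.comp_aestronglyMeasurable
    (hb.measurable (fun _ => hsBasis U i) aestronglyMeasurable_const)).norm.aemeasurable).pow_const
      2).ennreal_ofReal

/-- Up to a small error in `L²(0, T)`, the form `(b(t) y, w)` is a finite sum of products, with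
coefficients `v k` in `V`: the operators `1 - ι ∘ finiteRank` are bounded and tend to zero
pointwise, so that `(1 - ι ∘ finiteRank) b(t)` tends to zero in the Hilbert-Schmidt norm. -/
theorem SquareIntegrableFamily.exists_finiteRank [SecondCountableTopology U]
    [SecondCountableTopology H] (hb : SquareIntegrableFamily T b m) (hι : Function.Injective ι)
    (hι' : DenseRange ι) {ε : ℝ} (hε : 0 < ε) :
    ∃ (s : Finset (hsIndex H)) (v : hsIndex H → V) (d : ℝ → ℝ),
      MemLp d 2 (segMeasure 0 T) ∧ ∫ t, d t ^ 2 ∂segMeasure 0 T ≤ ε ∧ ∀ t y w,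
        |inner ℝ ((b t).toCLM y) w
          - ∑ k ∈ s, inner ℝ (hsBasis H k) ((b t).toCLM y) * inner ℝ (ι (v k)) w|
          ≤ d t * ‖y‖ * ‖w‖ := by
  have := countable_hsIndex (U := H)
  set D : ℕ × Finset (hsIndex H) → H →L[ℝ] H := fun p =>
    ContinuousLinearMap.id ℝ H - ι.comp (finiteRank ι p) with hD
  have hm2 : Integrable (fun t => 4 * m t ^ 2) (segMeasure 0 T) :=
    hb.memLp.integrable_sq.const_mul 4
  have hle : ∀ p, ∀ᵐ t ∂segMeasure 0 T, ‖‖(b t).postcomp (D p)‖ ^ 2‖ ≤ 4 * m t ^ 2 := fun p => by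
    filter_upwards [hb.bound] with t ht
    rw [norm_pow, norm_norm]
    have h1 : ‖(b t).postcomp (D p)‖ ≤ 2 * m t :=
      ((b t).norm_postcomp_le (D p)).trans
        (mul_le_mul (norm_sub_finiteRank_le p) ht (norm_nonneg _) zero_le_two)
    have h2 := pow_le_pow_left₀ (norm_nonneg _) h1 2
    linarith [mul_pow 2 (m t) 2]
  have hlim : Tendsto (fun p => ∫ t, ‖(b t).postcomp (D p)‖ ^ 2 ∂segMeasure 0 T) atTop (𝓝 0) := by
    have h := tendsto_integral_filter_of_dominated_convergence (μ := segMeasure 0 T)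
      (l := (atTop : Filter (ℕ × Finset (hsIndex H))))
      (F := fun p t => ‖(b t).postcomp (D p)‖ ^ 2) (f := fun _ => (0 : ℝ)) (fun t => 4 * m t ^ 2)
      (Eventually.of_forall fun p => hb.aestronglyMeasurable_norm_postcomp (D p))
      (Eventually.of_forall hle) hm2
      (ae_of_all _ fun t => HilbertSchmidt.tendsto_postcomp norm_sub_finiteRank_le
        (tendsto_sub_finiteRank hι hι') (b t))
    simpa using h
  have : (atTop : Filter (ℕ × Finset (hsIndex H))).NeBot := by
    classical
    rw [← prod_atTop_atTop_eq]
    infer_instance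
  obtain ⟨p, hp⟩ := (hlim.eventually (gt_mem_nhds hε)).exists
  have hdm : AEStronglyMeasurable (fun t => ‖(b t).postcomp (D p)‖) (segMeasure 0 T) := by
    have h := Real.continuous_sqrt.comp_aestronglyMeasurable
      (hb.aestronglyMeasurable_norm_postcomp (D p))
    simpa only [Real.sqrt_sq (norm_nonneg _)] using h
  refine ⟨p.2, fun k => resolv ι (epsSeq p.1) (emb ι (hsBasis H k)),
    fun t => ‖(b t).postcomp (D p)‖, (memLp_two_iff_integrable_sq hdm).2
      (hm2.mono' (hb.aestronglyMeasurable_norm_postcomp (D p)) (hle p)), hp.le, fun t y w => ?_⟩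
  have e : inner ℝ ((b t).toCLM y) w
      - ∑ k ∈ p.2, inner ℝ (hsBasis H k) ((b t).toCLM y)
        * inner ℝ (ι (resolv ι (epsSeq p.1) (emb ι (hsBasis H k)))) w
      = inner ℝ (((b t).postcomp (D p)).toCLM y) w := by
    rw [HilbertSchmidt.toCLM_postcomp]
    change _ = inner ℝ ((b t).toCLM y - ι (finiteRank ι p ((b t).toCLM y))) w
    rw [inner_sub_left, finiteRank_apply, map_sum, sum_inner]
    simp only [map_smul, real_inner_smul_left]
  rw [e]
  exact (abs_real_inner_le_norm _ _).trans
    (mul_le_mul_of_nonneg_right (HilbertSchmidt.norm_apply_le _ _) (norm_nonneg _))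

end HilbertSchmidtApproximation

/-! ### Weakly convergent controls -/

section WeakControls

open Filter Topology

variable {V H U : Type*} [NormedAddCommGroup V] [InnerProductSpace ℝ V] [CompleteSpace V]
  [NormedAddCommGroup H] [InnerProductSpace ℝ H] [CompleteSpace H]
  [NormedAddCommGroup U] [InnerProductSpace ℝ U] [CompleteSpace U]
  {ι : V →L[ℝ] H} {T : ℝ} {b : ℝ → HilbertSchmidt U H} {m : ℝ → ℝ}

theorem integral_mul_le_sqrt {μ : Measure ℝ} {f g : ℝ → ℝ} (hf : MemLp f 2 μ) (hg : MemLp g 2 μ) :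
    ∫ t, |f t| * |g t| ∂μ ≤ √(∫ t, f t ^ 2 ∂μ) * √(∫ t, g t ^ 2 ∂μ) := by
  have h := integral_mul_le_Lp_mul_Lq_of_nonneg (μ := μ) (p := 2) (q := 2) (f := fun t => |f t|)
    (g := fun t => |g t|) Real.HolderConjugate.two_two (ae_of_all _ fun _ => abs_nonneg _)
    (ae_of_all _ fun _ => abs_nonneg _) (by simpa using hf.norm) (by simpa using hg.norm)
  simpa [Real.sqrt_eq_rpow] using h

theorem norm_sq_eq_integral (η : Lp U 2 (timeMeasure T)) :
    ‖η‖ ^ 2 = ∫ t, ‖η t‖ ^ 2 ∂segMeasure 0 T := by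
  rw [Lp.norm_def, toReal_eLpNorm_two_sq (Lp.memLp η)]

namespace SquareIntegrableFamily

theorem integrable (hb : SquareIntegrableFamily T b m) (η : Lp U 2 (timeMeasure T)) :
    Integrable (fun t => (b t).toCLM (η t)) (segMeasure 0 T) := by
  refine (hb.memLp.integrable_mul (Lp.memLp η).norm).mono' (hb.measurable _ (Lp.memLp η).1) ?_
  filter_upwards [hb.bound] with t ht
  exact (HilbertSchmidt.norm_apply_le _ _).trans (mul_le_mul_of_nonneg_right ht (norm_nonneg _))

theorem abs_integral_inner_le (hb : SquareIntegrableFamily T b m) (η : Lp U 2 (timeMeasure T))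
    (h : H) {s t : ℝ} (hs : 0 ≤ s) (hst : s ≤ t) (ht : t ≤ T) :
    |∫ r in s..t, inner ℝ h ((b r).toCLM (η r))| ≤ ‖h‖ * (√(∫ r in s..t, m r ^ 2) * ‖η‖) := by
  have hle : segMeasure s t ≤ segMeasure 0 T :=
    Measure.restrict_mono (Icc_subset_Icc hs ht) le_rfl
  have hm := hb.memLp.mono_measure hle
  have hη := (Lp.memLp η).mono_measure hle
  have hη2 : ∫ r, ‖η r‖ ^ 2 ∂segMeasure s t ≤ ‖η‖ ^ 2 := by
    rw [norm_sq_eq_integral]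
    exact integral_mono_measure hle (ae_of_all _ fun _ => sq_nonneg _)
      ((memLp_two_iff_integrable_sq_norm (Lp.memLp η).1).1 (Lp.memLp η))
  rw [← integral_segMeasure hst, ← integral_segMeasure hst, ← Real.norm_eq_abs]
  calc ‖∫ r, inner ℝ h ((b r).toCLM (η r)) ∂segMeasure s t‖
      ≤ ∫ r, ‖h‖ * (|m r| * |‖η r‖|) ∂segMeasure s t := by
        refine norm_integral_le_of_norm_le
          (Integrable.const_mul (hm.norm.integrable_mul hη.norm.norm) _) ?_
        filter_upwards [ae_mono hle hb.bound] with r hr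
        refine (norm_inner_le_norm _ _).trans (mul_le_mul_of_nonneg_left ?_ (norm_nonneg _))
        rw [abs_norm]
        exact (HilbertSchmidt.norm_apply_le _ _).trans
          (mul_le_mul_of_nonneg_right (hr.trans (le_abs_self _)) (norm_nonneg _))
    _ ≤ _ := by
        rw [integral_const_mul]
        refine mul_le_mul_of_nonneg_left ((integral_mul_le_sqrt hm hη.norm).trans ?_)
          (norm_nonneg _)
        refine mul_le_mul_of_nonneg_left ?_ (Real.sqrt_nonneg _)
        exact Real.sqrt_le_iff.2 ⟨norm_nonneg _, hη2⟩

theorem exists_functional (hb : SquareIntegrableFamily T b m) (h : H) {τ : ℝ} (hτ : τ ∈ Icc 0 T) :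
    ∃ Λ : Lp U 2 (timeMeasure T) →L[ℝ] ℝ, ∀ η : Lp U 2 (timeMeasure T),
      Λ η = ∫ r in (0 : ℝ)..τ, inner ℝ h ((b r).toCLM (η r)) := by
  have h0 : (0 : ℝ) ∈ Icc 0 T := left_mem_Icc.2 (hτ.1.trans hτ.2)
  have hi : ∀ η : Lp U 2 (timeMeasure T), IntervalIntegrable
      (fun r => inner ℝ h ((b r).toCLM (η r))) volume 0 τ := fun η =>
    intervalIntegrable_of_restrict ((hb.integrable η).const_inner h) h0 hτ
  have hcongr : ∀ f g : ℝ → ℝ, (∀ᵐ r ∂segMeasure 0 T, f r = g r) →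
      ∫ r in (0 : ℝ)..τ, f r = ∫ r in (0 : ℝ)..τ, g r := fun f g hfg => by
    refine intervalIntegral.integral_congr_ae ?_
    filter_upwards [(ae_restrict_iff' measurableSet_Icc).1 hfg] with r h1 h2
    rw [uIoc_of_le hτ.1] at h2
    exact h1 ⟨h2.1.le, h2.2.trans hτ.2⟩
  refine ⟨LinearMap.mkContinuous
    { toFun := fun η => ∫ r in (0 : ℝ)..τ, inner ℝ h ((b r).toCLM (η r))
      map_add' := fun η ξ => ?_
      map_smul' := fun a η => ?_ } (‖h‖ * √(∫ r in (0 : ℝ)..τ, m r ^ 2)) fun η => ?_, fun η => rfl⟩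
  · rw [← intervalIntegral.integral_add (hi η) (hi ξ)]
    refine hcongr _ _ ?_
    filter_upwards [Lp.coeFn_add η ξ] with r hr
    rw [hr, Pi.add_apply, map_add, inner_add_right]
  · rw [RingHom.id_apply, smul_eq_mul, ← intervalIntegral.integral_const_mul]
    refine hcongr _ _ ?_
    filter_upwards [Lp.coeFn_smul a η] with r hr
    rw [hr, Pi.smul_apply, map_smul, real_inner_smul_right]
  · rw [mul_assoc]
    exact hb.abs_integral_inner_le η h le_rfl hτ.1 hτ.2

variable {X : Type*} {l : Filter X} {η : X → Lp U 2 (timeMeasure T)} {K : ℝ}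

/-- If bounded controls `η` converge weakly to zero, then the primitives of `(h, b η)` converge to
zero uniformly in time: they do so at each time, and they are equicontinuous. -/
theorem eventually_abs_integral_inner_le (hb : SquareIntegrableFamily T b m)
    (hK : ∀ᶠ x in l, ‖η x‖ ≤ K)
    (hη : ∀ Λ : Lp U 2 (timeMeasure T) →L[ℝ] ℝ, Tendsto (fun x => Λ (η x)) l (𝓝 0)) (h : H)
    {ε : ℝ} (hε : 0 < ε) :
    ∀ᶠ x in l, ∀ t ∈ Icc 0 T, |∫ r in (0 : ℝ)..t, inner ℝ h ((b r).toCLM (η x r))| ≤ ε := by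
  rcases lt_or_ge T 0 with hT | hT
  · exact Eventually.of_forall fun x t ht => absurd (ht.1.trans ht.2) (not_le.2 hT)
  have h0 : (0 : ℝ) ∈ Icc 0 T := left_mem_Icc.2 hT
  have hm2 : Integrable (fun t => m t ^ 2) (segMeasure 0 T) := hb.memLp.integrable_sq
  have hi : ∀ s ∈ Icc 0 T, ∀ t ∈ Icc 0 T, IntervalIntegrable (fun t => m t ^ 2) volume s t :=
    fun s hs t ht => intervalIntegrable_of_restrict hm2 hs ht
  have huc := isCompact_Icc.uniformContinuousOn_of_continuous (continuousOn_integral hm2)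
  set μ : ℝ := ε / (2 * (‖h‖ + 1) * (|K| + 1)) with hμ
  have hμ0 : 0 < μ := by positivity
  have hμ1 : ‖h‖ * (μ * |K|) ≤ ε / 2 := by
    have e : (‖h‖ + 1) * (μ * (|K| + 1)) = ε / 2 := by rw [hμ]; field_simp
    rw [← e]
    gcongr <;> linarith
  obtain ⟨δ, hδ, hβ⟩ := Metric.uniformContinuousOn_iff.1 huc (μ ^ 2) (by positivity)
  obtain ⟨τ, hτ, hτf, hcov⟩ := Metric.finite_approx_of_totallyBounded
    (isCompact_Icc (a := (0 : ℝ)) (b := T)).totallyBounded δ hδ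
  have hev : ∀ᶠ x in l, ∀ s ∈ τ, |∫ r in (0 : ℝ)..s, inner ℝ h ((b r).toCLM (η x r))| ≤ ε / 2 := by
    refine (eventually_all_finite hτf).2 fun s hs => ?_
    obtain ⟨Λ, hΛ⟩ := hb.exists_functional h (hτ hs)
    have h1 := (hη Λ).abs
    rw [abs_zero] at h1
    filter_upwards [h1.eventually (gt_mem_nhds (show (0 : ℝ) < ε / 2 by positivity))] with x hx
    rw [← hΛ]
    exact hx.le
  filter_upwards [hev, hK] with x hx hxK t ht
  obtain ⟨s, hs, hst⟩ := mem_iUnion₂.1 (hcov ht)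
  have hs' := hτ hs
  have hint : ∀ p ∈ Icc 0 T, ∀ q ∈ Icc 0 T, IntervalIntegrable
      (fun r => inner ℝ h ((b r).toCLM (η x r))) volume p q := fun p hp q hq =>
    intervalIntegrable_of_restrict ((hb.integrable (η x)).const_inner h) hp hq
  have hcl := hβ t ht s hs' hst
  rw [Real.dist_eq, intervalIntegral.integral_interval_sub_left (hi 0 h0 t ht) (hi 0 h0 s hs')]
    at hcl
  have key : ∀ p q, 0 ≤ p → p ≤ q → q ≤ T → |∫ r in p..q, m r ^ 2| < μ ^ 2 →
      |∫ r in p..q, inner ℝ h ((b r).toCLM (η x r))| ≤ ε / 2 := by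
    intro p q hp hpq hq hm
    refine (hb.abs_integral_inner_le (η x) h hp hpq hq).trans (le_trans ?_ hμ1)
    have h1 : √(∫ r in p..q, m r ^ 2) ≤ μ :=
      Real.sqrt_le_iff.2 ⟨hμ0.le, (le_abs_self _).trans hm.le⟩
    have h2 := hxK.trans (le_abs_self K)
    gcongr
  have hdiff : |∫ r in s..t, inner ℝ h ((b r).toCLM (η x r))| ≤ ε / 2 := by
    rcases le_total s t with h1 | h1
    · exact key s t hs'.1 h1 ht.2 hcl
    · rw [intervalIntegral.integral_symm, abs_neg] at hcl ⊢
      exact key t s ht.1 h1 hs'.2 hcl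
  rw [← intervalIntegral.integral_add_adjacent_intervals (hint 0 h0 s hs') (hint s hs' t ht)]
  refine (abs_add_le _ _).trans ?_
  linarith [hx s hs]

variable {α : X → ℝ → V} {β w : X → ℝ → H} {R P : ℝ}

/-- Products of weakly convergent controls with bounded solutions: for one product of functionals
this follows by integration by parts. -/
theorem eventually_abs_integral_mul_le (hb : SquareIntegrableFamily T b m) (hR : 0 ≤ R) (hP : 0 ≤ P)
    (hK : ∀ᶠ x in l, ‖η x‖ ≤ K)
    (hη : ∀ Λ : Lp U 2 (timeMeasure T) →L[ℝ] ℝ, Tendsto (fun x => Λ (η x)) l (𝓝 0))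
    (hw : ∀ᶠ x in l, IsSol ι 0 T (α x) (β x) (w x) ∧ MemLp (α x) 2 (segMeasure 0 T) ∧
      Integrable (β x) (segMeasure 0 T) ∧ (∀ t ∈ Icc 0 T, ‖w x t‖ ≤ R) ∧
      ∫ t, ‖α x t + emb ι (β x t)‖ ∂segMeasure 0 T ≤ P) (h : H) (v : V)
    {ε : ℝ} (hε : 0 < ε) :
    ∀ᶠ x in l, ∀ t ∈ Icc 0 T,
      |∫ r in (0 : ℝ)..t, inner ℝ h ((b r).toCLM (η x r)) * inner ℝ (ι v) (w x r)| ≤ ε := by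
  set ε' := ε / (‖ι v‖ * R + ‖v‖ * P + 1) with hε'
  have hε'0 : 0 < ε' := by positivity
  have hε'1 : ε' * (‖ι v‖ * R + ‖v‖ * P) ≤ ε := by
    have e : ε' * (‖ι v‖ * R + ‖v‖ * P + 1) = ε := by
      rw [hε']; field_simp
    linarith
  filter_upwards [hb.eventually_abs_integral_inner_le hK hη h hε'0, hw] with x hx hxw t ht
  obtain ⟨hsol, hα, hβ, hwR, hP'⟩ := hxw
  have h0 : (0 : ℝ) ∈ Icc 0 T := left_mem_Icc.2 (ht.1.trans ht.2)
  have hle : segMeasure 0 t ≤ segMeasure 0 T :=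
    Measure.restrict_mono (Icc_subset_Icc_right ht.2) le_rfl
  have hsrc := integrable_source (ι := ι) hα hβ
  have hπ : Integrable (fun s => inner ℝ h ((b s).toCLM (η x s))) (segMeasure 0 T) :=
    (hb.integrable (η x)).const_inner h
  have hκ : Integrable (fun s => inner ℝ v (α x s + emb ι (β x s))) (segMeasure 0 T) :=
    hsrc.const_inner v
  have hq : ∀ s ∈ Icc 0 t, inner ℝ v (emb ι (w x 0))
      + ∫ r in (0 : ℝ)..s, inner ℝ v (α x r + emb ι (β x r)) = inner ℝ (ι v) (w x s) := by
    intro s hs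
    have hs' : s ∈ Icc 0 T := ⟨hs.1, hs.2.trans ht.2⟩
    have e : ∫ r in (0 : ℝ)..s, inner ℝ v (α x r + emb ι (β x r))
        = inner ℝ v (∫ r in (0 : ℝ)..s, (α x r + emb ι (β x r))) :=
      (innerSL ℝ v).intervalIntegral_comp_comm (intervalIntegrable_of_restrict hsrc h0 hs')
    rw [e, ← inner_add_right, ← hsol.eq s hs', inner_emb_right]
  have hbil := bilin_integral_eq (ContinuousLinearMap.mul ℝ ℝ) ht.1
    (hπ.mono_measure hle) (hκ.mono_measure hle) 0 (inner ℝ v (emb ι (w x 0)))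
  simp only [ContinuousLinearMap.mul_apply', zero_add, zero_mul] at hbil
  rw [hq t (right_mem_Icc.2 ht.1)] at hbil
  have hqc : ContinuousOn (fun s => inner ℝ (ι v) (w x s)) (uIcc 0 t) := by
    rw [uIcc_of_le ht.1]
    exact continuousOn_const.inner (hsol.cont.mono (Icc_subset_Icc_right ht.2))
  have hac : ContinuousOn (fun s => ∫ r in (0 : ℝ)..s, inner ℝ h ((b r).toCLM (η x r)))
      (uIcc 0 t) := by
    rw [uIcc_of_le ht.1]
    exact (continuousOn_integral hπ).mono (Icc_subset_Icc_right ht.2)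
  have i1 := (intervalIntegrable_of_restrict hπ h0 ht).mul_continuousOn hqc
  have i2 := (intervalIntegrable_of_restrict hκ h0 ht).continuousOn_mul hac
  have hsplit : ∫ s in (0 : ℝ)..t, (inner ℝ h ((b s).toCLM (η x s))
        * (inner ℝ v (emb ι (w x 0)) + ∫ r in (0 : ℝ)..s, inner ℝ v (α x r + emb ι (β x r)))
        + (∫ r in (0 : ℝ)..s, inner ℝ h ((b r).toCLM (η x r)))
          * inner ℝ v (α x s + emb ι (β x s)))
      = (∫ r in (0 : ℝ)..t, inner ℝ h ((b r).toCLM (η x r)) * inner ℝ (ι v) (w x r))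
        + ∫ s in (0 : ℝ)..t, (∫ r in (0 : ℝ)..s, inner ℝ h ((b r).toCLM (η x r)))
          * inner ℝ v (α x s + emb ι (β x s)) := by
    rw [← intervalIntegral.integral_add i1 i2]
    refine intervalIntegral.integral_congr fun s hs => ?_
    rw [uIcc_of_le ht.1] at hs
    simp only [hq s hs]
  rw [hsplit] at hbil
  have b1 : |(∫ r in (0 : ℝ)..t, inner ℝ h ((b r).toCLM (η x r))) * inner ℝ (ι v) (w x t)|
      ≤ ε' * (‖ι v‖ * R) := by
    rw [abs_mul]
    refine mul_le_mul (hx t ht) ((abs_real_inner_le_norm _ _).trans ?_) (abs_nonneg _) hε'0.le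
    exact mul_le_mul_of_nonneg_left (hwR t ht) (norm_nonneg _)
  have b2 : |∫ s in (0 : ℝ)..t, (∫ r in (0 : ℝ)..s, inner ℝ h ((b r).toCLM (η x r)))
          * inner ℝ v (α x s + emb ι (β x s))| ≤ ε' * (‖v‖ * P) := by
    rw [← integral_segMeasure ht.1, ← Real.norm_eq_abs]
    calc _ ≤ ∫ s, ε' * (‖v‖ * ‖α x s + emb ι (β x s)‖) ∂segMeasure 0 t := by
          refine norm_integral_le_of_norm_le
            (((hsrc.mono_measure hle).norm.const_mul _).const_mul _) ?_
          filter_upwards [ae_restrict_mem measurableSet_Icc] with s hs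
          rw [norm_mul]
          exact mul_le_mul (hx s ⟨hs.1, hs.2.trans ht.2⟩) (norm_inner_le_norm _ _)
            (norm_nonneg _) hε'0.le
      _ ≤ ε' * (‖v‖ * P) := by
          rw [integral_const_mul, integral_const_mul]
          have := (integral_mono_measure hle (ae_of_all _ fun s => norm_nonneg _)
            hsrc.norm).trans hP'
          gcongr
  rw [← sub_eq_iff_eq_add] at hbil
  rw [← hbil]
  refine (abs_sub _ _).trans ?_
  linarith

/-- If bounded controls `η` converge weakly to zero, then the primitives of `(b η, w)` converge to
zero uniformly in time, for solutions `w` that are bounded together with their derivatives. -/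
theorem eventually_abs_integral_le [SecondCountableTopology U] [SecondCountableTopology H]
    (hb : SquareIntegrableFamily T b m) (hι : Function.Injective ι) (hι' : DenseRange ι)
    (hR : 0 ≤ R) (hP : 0 ≤ P) (hK : ∀ᶠ x in l, ‖η x‖ ≤ K)
    (hη : ∀ Λ : Lp U 2 (timeMeasure T) →L[ℝ] ℝ, Tendsto (fun x => Λ (η x)) l (𝓝 0))
    (hw : ∀ᶠ x in l, IsSol ι 0 T (α x) (β x) (w x) ∧ MemLp (α x) 2 (segMeasure 0 T) ∧
      Integrable (β x) (segMeasure 0 T) ∧ (∀ t ∈ Icc 0 T, ‖w x t‖ ≤ R) ∧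
      ∫ t, ‖α x t + emb ι (β x t)‖ ∂segMeasure 0 T ≤ P) {ε : ℝ} (hε : 0 < ε) :
    ∀ᶠ x in l, ∀ t ∈ Icc 0 T,
      |∫ r in (0 : ℝ)..t, inner ℝ ((b r).toCLM (η x r)) (w x r)| ≤ ε := by
  set μ := ε / (2 * (|K| + 1) * (R + 1)) with hμ
  have hμ0 : 0 < μ := by positivity
  have hμ1 : R * (μ * |K|) ≤ ε / 2 := by
    have e : (R + 1) * (μ * (|K| + 1)) = ε / 2 := by rw [hμ]; field_simp
    rw [← e]
    gcongr <;> linarith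
  obtain ⟨s, v, d, hd2, hdμ, hd⟩ := hb.exists_finiteRank hι hι' (ε := μ ^ 2) (by positivity)
  have hev : ∀ᶠ x in l, ∀ k ∈ s, ∀ t ∈ Icc 0 T, |∫ r in (0 : ℝ)..t,
      inner ℝ (hsBasis H k) ((b r).toCLM (η x r)) * inner ℝ (ι (v k)) (w x r)|
      ≤ ε / (2 * (s.card + 1)) :=
    (Filter.eventually_all_finset s).2 fun k _ =>
      hb.eventually_abs_integral_mul_le hR hP hK hη hw (hsBasis H k) (v k) (by positivity)
  filter_upwards [hev, hK, hw] with x hx hxK hxw t ht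
  obtain ⟨hsol, -, -, hwR, -⟩ := hxw
  have h0 : (0 : ℝ) ∈ Icc 0 T := left_mem_Icc.2 (ht.1.trans ht.2)
  have hle : segMeasure 0 t ≤ segMeasure 0 T :=
    Measure.restrict_mono (Icc_subset_Icc_right ht.2) le_rfl
  have hdt := hd2.mono_measure hle
  have hηt := (Lp.memLp (η x)).mono_measure hle
  have i0 : IntervalIntegrable (fun r => inner ℝ ((b r).toCLM (η x r)) (w x r)) volume 0 t :=
    intervalIntegrable_of_restrict
      (integrable_inner_of_continuousOn (hb.integrable (η x)) hsol.cont) h0 ht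
  have ik : ∀ k ∈ s, IntervalIntegrable (fun r =>
      inner ℝ (hsBasis H k) ((b r).toCLM (η x r)) * inner ℝ (ι (v k)) (w x r)) volume 0 t := by
    intro k _
    have hπ : Integrable (fun r => inner ℝ (hsBasis H k) ((b r).toCLM (η x r)))
      (segMeasure 0 T) := (hb.integrable (η x)).const_inner _
    refine (intervalIntegrable_of_restrict hπ h0 ht).mul_continuousOn ?_
    rw [uIcc_of_le ht.1]
    exact continuousOn_const.inner (hsol.cont.mono (Icc_subset_Icc_right ht.2))
  have hsum : IntervalIntegrable (fun r => ∑ k ∈ s,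
      inner ℝ (hsBasis H k) ((b r).toCLM (η x r)) * inner ℝ (ι (v k)) (w x r)) volume 0 t := by
    simpa only [Finset.sum_fn] using IntervalIntegrable.sum s ik
  have e : ∫ r in (0 : ℝ)..t, inner ℝ ((b r).toCLM (η x r)) (w x r)
      = (∫ r in (0 : ℝ)..t, (inner ℝ ((b r).toCLM (η x r)) (w x r) - ∑ k ∈ s,
        inner ℝ (hsBasis H k) ((b r).toCLM (η x r)) * inner ℝ (ι (v k)) (w x r)))
        + ∑ k ∈ s, ∫ r in (0 : ℝ)..t,
          inner ℝ (hsBasis H k) ((b r).toCLM (η x r)) * inner ℝ (ι (v k)) (w x r) := by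
    rw [intervalIntegral.integral_sub i0 hsum, intervalIntegral.integral_finsetSum ik,
      sub_add_cancel]
  have b1 : |∫ r in (0 : ℝ)..t, (inner ℝ ((b r).toCLM (η x r)) (w x r) - ∑ k ∈ s,
        inner ℝ (hsBasis H k) ((b r).toCLM (η x r)) * inner ℝ (ι (v k)) (w x r))| ≤ ε / 2 := by
    refine le_trans ?_ hμ1
    rw [← integral_segMeasure ht.1, ← Real.norm_eq_abs]
    calc _ ≤ ∫ r, R * (|d r| * |‖η x r‖|) ∂segMeasure 0 t := by
          refine norm_integral_le_of_norm_le
            (Integrable.const_mul (hdt.norm.integrable_mul hηt.norm.norm) _) ?_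
          filter_upwards [ae_restrict_mem measurableSet_Icc] with r hr
          refine (hd r (η x r) (w x r)).trans ?_
          rw [abs_norm, mul_comm R]
          have := hwR r ⟨hr.1, hr.2.trans ht.2⟩
          have := le_abs_self (d r)
          gcongr
      _ ≤ R * (μ * |K|) := by
          rw [integral_const_mul]
          refine mul_le_mul_of_nonneg_left ((integral_mul_le_sqrt hdt hηt.norm).trans ?_) hR
          refine mul_le_mul (Real.sqrt_le_iff.2 ⟨hμ0.le, ?_⟩) (Real.sqrt_le_iff.2
            ⟨abs_nonneg _, ?_⟩) (Real.sqrt_nonneg _) hμ0.le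
          · exact (integral_mono_measure hle (ae_of_all _ fun _ => sq_nonneg _)
              hd2.integrable_sq).trans hdμ
          · refine (integral_mono_measure hle (ae_of_all _ fun _ => sq_nonneg _)
              (Lp.memLp (η x)).norm.integrable_sq).trans ?_
            rw [← norm_sq_eq_integral]
            exact pow_le_pow_left₀ (norm_nonneg _) (hxK.trans (le_abs_self K)) 2
  have b2 : |∑ k ∈ s, ∫ r in (0 : ℝ)..t,
      inner ℝ (hsBasis H k) ((b r).toCLM (η x r)) * inner ℝ (ι (v k)) (w x r)| ≤ ε / 2 := by
    refine (Finset.abs_sum_le_sum_abs _ _).trans ((Finset.sum_le_sum fun k hk => hx k hk t ht).trans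
      ?_)
    rw [Finset.sum_const, nsmul_eq_mul, mul_div_assoc', div_le_div_iff₀ (by positivity) two_pos]
    nlinarith
  rw [e]
  refine (abs_add_le _ _).trans ?_
  linarith

end SquareIntegrableFamily

end WeakControls

/-! ### Continuous dependence on the control -/

section Stability

open Filter Topology

variable {V H U : Type*} [NormedAddCommGroup V] [InnerProductSpace ℝ V] [CompleteSpace V]
  [NormedAddCommGroup H] [InnerProductSpace ℝ H] [CompleteSpace H]
  [NormedAddCommGroup U] [InnerProductSpace ℝ U] [CompleteSpace U]
  {ι : V →L[ℝ] H} {T : ℝ} {c : Coefficients V H U}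
  [SecondCountableTopology V] [MeasurableSpace V] [BorelSpace V] [MeasurableSpace H]
  [BorelSpace H] [SecondCountableTopology H] [SecondCountableTopology U]

namespace Coefficients

theorem integral_norm_sq_le_of_bound {K : ℝ} {φ : Lp U 2 (timeMeasure T)} (hφ : ‖φ‖ ≤ K) :
    ∫ t, ‖φ t‖ ^ 2 ∂segMeasure 0 T ≤ K ^ 2 := by
  rw [← norm_sq_eq_integral]
  exact pow_le_pow_left₀ (norm_nonneg _) hφ 2

theorem integrable_norm_sq (φ : Lp U 2 (timeMeasure T)) :
    Integrable (fun t => ‖φ t‖ ^ 2) (segMeasure 0 T) :=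
  (memLp_two_iff_integrable_sq_norm (Lp.memLp φ).1).1 (Lp.memLp φ)

/-- The time derivatives of bounded solutions are bounded in `L¹(0, T; V*)`. -/
theorem exists_source_bound (hι : Function.Injective ι) (hc : c.IsCritical ι) (hT : 0 < T)
    (R K : ℝ) : ∃ P, 0 ≤ P ∧ ∀ (φ : Lp U 2 (timeMeasure T)) (u : ℝ → H), ‖φ‖ ≤ K →
      IsPath ι 0 T u → (∀ t ∈ Icc 0 T, ‖u t‖ ≤ R) →
      ∫ t, ‖lift ι (u t)‖ ^ 2 ∂segMeasure 0 T ≤ R →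
      ∫ t, ‖c.drift ι t (lift ι (u t)) + emb ι (c.diffusion ι φ t (lift ι (u t)))‖
        ∂segMeasure 0 T ≤ P := by
  obtain ⟨C, hC⟩ := exists_coefficientBounds hι hc hT (le_max_right R 0)
  have hC0 := hC.nonneg
  have hf2 : Integrable (fun t => ‖c.f t‖ ^ 2) (segMeasure 0 T) :=
    (memLp_two_iff_integrable_sq_norm (hc.memLp_f T hT).1).1 (hc.memLp_f T hT)
  have hg2 : Integrable (fun t => ‖c.g t‖ ^ 2) (segMeasure 0 T) :=
    (memLp_two_iff_integrable_sq_norm (hc.memLp_g T hT).1).1 (hc.memLp_g T hT)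
  set E : ℝ := ‖emb ι‖
  set κ : ℝ := C + E * (16 * C ^ 2) with hκ
  set G : ℝ → ℝ := fun t => (2 * C + 1 + E * (4 * C ^ 2)) + ‖c.f t‖ ^ 2 + 2 * E * ‖c.g t‖ ^ 2
    with hG
  have hGi : Integrable G (segMeasure 0 T) :=
    ((integrable_const _).add hf2).add (hg2.const_mul _)
  have hG0 : 0 ≤ ∫ t, G t ∂segMeasure 0 T := integral_nonneg fun t => by
    simp only [hG, Pi.zero_apply]; positivity
  refine ⟨(∫ t, G t ∂segMeasure 0 T) + κ * |R| + E * K ^ 2, by positivity,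
    fun φ u hφ hu hR hR' => ?_⟩
  have hu2 := hu.integrable_sq
  have hφ2 := integrable_norm_sq φ
  have hsum : Integrable (fun t => G t + κ * ‖lift ι (u t)‖ ^ 2 + E * ‖φ t‖ ^ 2)
      (segMeasure 0 T) := (hGi.add (hu2.const_mul _)).add (hφ2.const_mul _)
  calc _ ≤ ∫ t, (G t + κ * ‖lift ι (u t)‖ ^ 2 + E * ‖φ t‖ ^ 2) ∂segMeasure 0 T := by
        refine integral_mono_of_nonneg (ae_of_all _ fun t => norm_nonneg _) hsum ?_
        filter_upwards [hu.ae_norm_lift_le hR, ae_restrict_mem measurableSet_Icc] with t h1 h2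
        have h3 := norm_drift_le hC h2 (h1.trans (le_max_left R 0))
        have h4 := norm_B_le hC h2 (h1.trans (le_max_left R 0))
        have h5 := (c.B ι t (lift ι (u t))).norm_apply_le (φ t)
        have h6 := (emb ι).le_opNorm (c.diffusion ι φ t (lift ι (u t)))
        rw [diffusion_eq h2.1] at h6 ⊢
        set x := ‖lift ι (u t)‖
        set p := ‖φ t‖
        set y := ‖c.g t‖
        set N := ‖c.B ι t (lift ι (u t))‖
        have hN : N * p ≤ 4 * C ^ 2 + 16 * C ^ 2 * x ^ 2 + 2 * y ^ 2 + p ^ 2 := by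
          have q1 : N ^ 2 ≤ (C * x + C * (1 + x) + y) ^ 2 :=
            pow_le_pow_left₀ (norm_nonneg _) h4 2
          nlinarith [sq_nonneg (N - p), sq_nonneg (C * x + C * (1 + x) - y), sq_nonneg N,
            sq_nonneg (C - 2 * C * x), sq_nonneg p]
        have h7 := h6.trans (mul_le_mul_of_nonneg_left (h5.trans hN) (norm_nonneg _))
        refine (norm_add_le _ _).trans ((add_le_add h3 h7).trans ?_)
        simp only [hG, hκ]
        have q2 : C * (2 * x) ≤ C * (1 + x ^ 2) :=
          mul_le_mul_of_nonneg_left (by nlinarith [sq_nonneg (x - 1)]) hC0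
        nlinarith [sq_nonneg (‖c.f t‖ - 1), sq_nonneg ‖c.f t‖]
    _ ≤ _ := by
        have h1 : ∫ t, (G t + κ * ‖lift ι (u t)‖ ^ 2 + E * ‖φ t‖ ^ 2) ∂segMeasure 0 T
            = (∫ t, G t ∂segMeasure 0 T) + κ * ∫ t, ‖lift ι (u t)‖ ^ 2 ∂segMeasure 0 T
              + E * ∫ t, ‖φ t‖ ^ 2 ∂segMeasure 0 T := by
          have e1 : Integrable (fun t => G t + κ * ‖lift ι (u t)‖ ^ 2) (segMeasure 0 T) :=
            hGi.add (hu2.const_mul _)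
          rw [integral_add e1 (hφ2.const_mul _), integral_add hGi (hu2.const_mul _),
            integral_const_mul, integral_const_mul]
        rw [h1]
        have h2 := integral_norm_sq_le_of_bound hφ
        have h3 := hR'.trans (le_abs_self R)
        gcongr

/-- Along a solution, `B` is a square integrable family of Hilbert-Schmidt operators. -/
theorem exists_squareIntegrableFamily (hι : Function.Injective ι) (hc : c.IsCritical ι)
    (hT : 0 < T) {u : ℝ → H} (hu : IsPath ι 0 T u) :
    ∃ m, SquareIntegrableFamily T (fun t => c.B ι (t.toNNReal : ℝ) (lift ι (u t))) m := by
  obtain ⟨n, hn⟩ := hu.exists_bound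
  obtain ⟨C, hC⟩ := exists_coefficientBounds hι hc hT (le_max_right n 0)
  refine ⟨_, fun ψ hψ => aestronglyMeasurable_diffusion hc hψ hu.memLp.1,
    memLp_affine hu.memLp (hc.memLp_g T hT) C, ?_⟩
  filter_upwards [hu.ae_norm_lift_le hn, ae_restrict_mem measurableSet_Icc] with t h1 h2
  rw [Real.coe_toNNReal t h2.1]
  exact norm_B_le hC h2 (h1.trans (le_max_left n 0))

/-- Stability: the difference of two solutions is controlled by the work that the difference of
the controls does on it. The constants depend only on bounds for the solutions and for one of the
controls. -/
theorem exists_stability (hι : Function.Injective ι) (hι' : DenseRange ι) (hc : c.IsCritical ι)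
    (hT : 0 < T) (R K : ℝ) : ∃ θ P, 0 < θ ∧ ∀ (φ ψ : Lp U 2 (timeMeasure T)) (w u : ℝ → H),
      ‖φ‖ ≤ K → IsNSol ι 0 T (c.drift ι) (c.diffusion ι φ) w →
      IsNSol ι 0 T (c.drift ι) (c.diffusion ι ψ) u → w 0 = u 0 →
      (∀ t ∈ Icc 0 T, ‖w t‖ ≤ R) → ∫ t, ‖lift ι (w t)‖ ^ 2 ∂segMeasure 0 T ≤ R →
      (∀ t ∈ Icc 0 T, ‖u t‖ ≤ R) → ∫ t, ‖lift ι (u t)‖ ^ 2 ∂segMeasure 0 T ≤ R →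
      ∀ δ : ℝ, 0 ≤ δ → (∀ t ∈ Icc 0 T, |∫ s in (0 : ℝ)..t, inner ℝ
        ((c.B ι (s.toNNReal : ℝ) (lift ι (u s))).toCLM ((φ - ψ) s)) (w s - u s)| ≤ δ) →
      ∀ t ∈ Icc 0 T, ‖w t - u t‖ ^ 2 + 2 * θ * ∫ s in (0 : ℝ)..t, ‖lift ι (w s - u s)‖ ^ 2
        ≤ 2 * δ * Real.exp P := by
  obtain ⟨θ, D, hθ, hD, hmon⟩ := exists_monotone hι hc hT R
  refine ⟨θ, 2 * D * (T + K ^ 2 + 2 * R), hθ,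
    fun φ ψ w u hφ hw hu h0 hwR hwR' huR huR' δ hδ hint t ht => ?_⟩
  have hφP := nonlinearity hι hc hT (Lp.memLp φ)
  have hψP := nonlinearity hι hc hT (Lp.memLp ψ)
  have hα := hφP.memLp 0 T w le_rfl le_rfl hw.isPath
  have hβ := hφP.integrable 0 T w le_rfl le_rfl hw.isPath
  have hα' := hψP.memLp 0 T u le_rfl le_rfl hu.isPath
  have hβ' := hψP.integrable 0 T u le_rfl le_rfl hu.isPath
  have hsol := IsSol.sub hι hw hu hα hβ hα' hβ'
  obtain ⟨hpath, hlift⟩ := hw.isPath.sub hι hu.isPath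
  obtain ⟨m, hb⟩ := exists_squareIntegrableFamily hι hc hT hu.isPath
  have hw2 := hw.isPath.integrable_sq
  have hu2 := hu.isPath.integrable_sq
  have hφ2 := integrable_norm_sq φ
  have i1 : Integrable (fun t => 1 + ‖φ t‖ ^ 2) (segMeasure 0 T) := (integrable_const _).add hφ2
  have i2 : Integrable (fun t => ‖lift ι (w t)‖ ^ 2 + ‖lift ι (u t)‖ ^ 2) (segMeasure 0 T) :=
    hw2.add hu2
  have h := IsSol.energy_le hι hι' hsol (hα.sub hα') (hβ.sub hβ')
    (ρ := fun t => 2 * D * (1 + ‖φ t‖ ^ 2 + (‖lift ι (w t)‖ ^ 2 + ‖lift ι (u t)‖ ^ 2)))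
    (γ := fun s => 2 * inner ℝ
      ((c.B ι (s.toNNReal : ℝ) (lift ι (u s))).toCLM ((φ - ψ) s)) (w s - u s))
    (Γ := 2 * δ) hθ.le ((i1.add i2).const_mul _)
    (fun t _ => by positivity)
    ((integrable_inner_of_continuousOn (hb.integrable (φ - ψ)) hpath.cont).const_mul 2)
    (fun t ht => ?_) ?_ ht
  · refine h.trans ?_
    rw [h0, sub_self, norm_zero, zero_pow two_ne_zero, zero_add, ← integral_segMeasure hT.le,
      integral_const_mul, integral_add i1 i2, integral_add (integrable_const _) hφ2,
      integral_add hw2 hu2]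
    refine mul_le_mul_of_nonneg_left (Real.exp_le_exp.2 ?_) (by positivity)
    refine mul_le_mul_of_nonneg_left ?_ (by positivity)
    have h1 := integral_norm_sq_le_of_bound hφ
    have h2 : ∫ _, (1 : ℝ) ∂segMeasure 0 T = T := by
      rw [integral_segMeasure hT.le]; simp
    linarith
  · rw [intervalIntegral.integral_const_mul]
    linarith [(abs_le.1 (hint t ht)).2]
  · filter_upwards [hlift, hw.isPath.ae_eq, hu.isPath.ae_eq, hw.isPath.ae_norm_lift_le hwR,
      hu.isPath.ae_norm_lift_le huR, ae_restrict_mem measurableSet_Icc, Lp.coeFn_sub φ ψ]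
      with s h1 h2 h3 h4 h5 h6 h7
    have h8 := hmon φ s h6 _ _ h4 h5
    rw [h2, h3] at h8
    rw [h1, h7]
    have e : c.diffusion ι φ s (lift ι (w s)) - c.diffusion ι ψ s (lift ι (u s))
        = (c.diffusion ι φ s (lift ι (w s)) - c.diffusion ι φ s (lift ι (u s)))
          + (c.B ι (s.toNNReal : ℝ) (lift ι (u s))).toCLM ((⇑φ - ⇑ψ) s) := by
      rw [Pi.sub_apply, map_sub]
      simp only [diffusion]
      abel
    rw [e, inner_add_left]
    linarith

variable {S : Lp U 2 (timeMeasure T) → MR ι T} {x : H}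

/-- The solution map takes bounded weakly convergent controls to solutions that converge in
`MR(0, T)`: the difference of the solutions is controlled by the work of the difference of the
controls, and this work tends to zero uniformly in time. -/
theorem tendsto_solutionMap (hι : Function.Injective ι) (hι' : DenseRange ι)
    (hc : c.IsCritical ι) (hc' : c.IsCoercive ι) (hT : 0 < T)
    (hS : ∀ ψ u, c.IsSkeletonSolution x ψ u ↔ u = S ψ) {X : Type*} {l : Filter X}
    {φ : X → Lp U 2 (timeMeasure T)} {ψ : Lp U 2 (timeMeasure T)} {K : ℝ}
    (hφ : ∀ᶠ y in l, ‖φ y‖ ≤ K) (hψ : ‖ψ‖ ≤ K)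
    (hφψ : ∀ Λ : Lp U 2 (timeMeasure T) →L[ℝ] ℝ, Tendsto (fun y => Λ (φ y)) l (𝓝 (Λ ψ))) :
    Tendsto (fun y => S (φ y)) l (𝓝 (S ψ)) := by
  have hsol : ∀ ξ : Lp U 2 (timeMeasure T),
      IsNSol ι 0 T (c.drift ι) (c.diffusion ι ξ) (pathOf hT.le (S ξ)) ∧
      pathOf hT.le (S ξ) 0 = x := fun ξ =>
    (isSkeletonSolution_iff hι hι' hc hT x ξ (S ξ)).1 ((hS ξ (S ξ)).2 rfl)
  obtain ⟨R, hR⟩ := exists_apriori hι hι' hc hc' hT x (K ^ 2)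
  have hbd : ∀ ξ : Lp U 2 (timeMeasure T), ‖ξ‖ ≤ K →
      (∀ t ∈ Icc 0 T, ‖pathOf hT.le (S ξ) t‖ ≤ R) ∧
      ∫ t, ‖lift ι (pathOf hT.le (S ξ) t)‖ ^ 2 ∂segMeasure 0 T ≤ R := fun ξ hξ =>
    hR ξ (Lp.memLp ξ) (integral_norm_sq_le_of_bound hξ) T _ hT.le le_rfl (hsol ξ).1 (hsol ξ).2
  obtain ⟨P, hP0, hP⟩ := exists_source_bound hι hc hT R K
  obtain ⟨θ, Q, hθ, hst⟩ := exists_stability hι hι' hc hT R K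
  obtain ⟨m, hb⟩ := exists_squareIntegrableFamily hι hc hT (hsol ψ).1.isPath
  have hR0 : 0 ≤ R := (norm_nonneg _).trans ((hbd ψ hψ).1 0 (left_mem_Icc.2 hT.le))
  have hη : ∀ Λ : Lp U 2 (timeMeasure T) →L[ℝ] ℝ, Tendsto (fun y => Λ (φ y - ψ)) l (𝓝 0) := by
    intro Λ
    simpa using (hφψ Λ).sub_const (Λ ψ)
  have hηK : ∀ᶠ y in l, ‖φ y - ψ‖ ≤ K + K :=
    hφ.mono fun y hy => (norm_sub_le _ _).trans (add_le_add hy hψ)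
  have hsub : ∀ᶠ y in l, IsSol ι 0 T
      (fun t => c.drift ι t (lift ι (pathOf hT.le (S (φ y)) t))
        - c.drift ι t (lift ι (pathOf hT.le (S ψ) t)))
      (fun t => c.diffusion ι (φ y) t (lift ι (pathOf hT.le (S (φ y)) t))
        - c.diffusion ι ψ t (lift ι (pathOf hT.le (S ψ) t)))
      (fun t => pathOf hT.le (S (φ y)) t - pathOf hT.le (S ψ) t) ∧
      MemLp (fun t => c.drift ι t (lift ι (pathOf hT.le (S (φ y)) t))
        - c.drift ι t (lift ι (pathOf hT.le (S ψ) t))) 2 (segMeasure 0 T) ∧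
      Integrable (fun t => c.diffusion ι (φ y) t (lift ι (pathOf hT.le (S (φ y)) t))
        - c.diffusion ι ψ t (lift ι (pathOf hT.le (S ψ) t))) (segMeasure 0 T) ∧
      (∀ t ∈ Icc 0 T, ‖pathOf hT.le (S (φ y)) t - pathOf hT.le (S ψ) t‖ ≤ R + R) ∧
      ∫ t, ‖c.drift ι t (lift ι (pathOf hT.le (S (φ y)) t))
        - c.drift ι t (lift ι (pathOf hT.le (S ψ) t))
        + emb ι (c.diffusion ι (φ y) t (lift ι (pathOf hT.le (S (φ y)) t))
        - c.diffusion ι ψ t (lift ι (pathOf hT.le (S ψ) t)))‖ ∂segMeasure 0 T ≤ P + P := by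
    filter_upwards [hφ] with y hy
    have hw := (hsol (φ y)).1
    have hu := (hsol ψ).1
    have hφP := nonlinearity hι hc hT (Lp.memLp (φ y))
    have hψP := nonlinearity hι hc hT (Lp.memLp ψ)
    have hα := hφP.memLp 0 T _ le_rfl le_rfl hw.isPath
    have hβ := hφP.integrable 0 T _ le_rfl le_rfl hw.isPath
    have hα' := hψP.memLp 0 T _ le_rfl le_rfl hu.isPath
    have hβ' := hψP.integrable 0 T _ le_rfl le_rfl hu.isPath
    refine ⟨IsSol.sub hι hw hu hα hβ hα' hβ', hα.sub hα', hβ.sub hβ', fun t ht =>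
      (norm_sub_le _ _).trans (add_le_add ((hbd _ hy).1 t ht) ((hbd _ hψ).1 t ht)), ?_⟩
    have s1 := (integrable_source (ι := ι) hα hβ).norm
    have s2 := (integrable_source (ι := ι) hα' hβ').norm
    refine (integral_mono_of_nonneg (ae_of_all _ fun t => norm_nonneg _) (s1.add s2)
      (ae_of_all _ fun t => ?_)).trans ((integral_add s1 s2).trans_le (add_le_add
      (hP (φ y) _ hy hw.isPath (hbd _ hy).1 (hbd _ hy).2)
      (hP ψ _ hψ hu.isPath (hbd _ hψ).1 (hbd _ hψ).2)))
    refine le_trans (le_of_eq ?_) (norm_sub_le _ _)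
    beta_reduce
    rw [map_sub]
    congr 1
    abel
  refine Metric.tendsto_nhds.2 fun ε hε => ?_
  -- the two parts of the norm of `MR(0, T)` are at most `κ` and `κ √(1 / (2 θ))`
  set q : ℝ := √(1 / (2 * θ)) with hq
  have hq0 : 0 ≤ q := Real.sqrt_nonneg _
  set κ : ℝ := ε / (2 * (1 + q)) with hκ
  have hκ0 : 0 < κ := by positivity
  set δ : ℝ := κ ^ 2 / (2 * Real.exp Q) with hδ
  have hδ0 : 0 < δ := by positivity
  have hδκ : 2 * δ * Real.exp Q = κ ^ 2 := by rw [hδ]; field_simp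
  filter_upwards [hb.eventually_abs_integral_le hι hι' (add_nonneg hR0 hR0) (add_nonneg hP0 hP0)
    hηK hη hsub hδ0, hφ] with y hy hyK
  have h := hst (φ y) ψ _ _ hyK (hsol (φ y)).1 (hsol ψ).1 ((hsol (φ y)).2.trans (hsol ψ).2.symm)
    (hbd _ hyK).1 (hbd _ hyK).2 (hbd _ hψ).1 (hbd _ hψ).2 δ hδ0.le hy
  rw [hδκ] at h
  rw [dist_eq_norm]
  have hpos : ∀ t ∈ Icc 0 T, 0 ≤ 2 * θ * ∫ s in (0 : ℝ)..t,
      ‖lift ι (pathOf hT.le (S (φ y)) s - pathOf hT.le (S ψ) s)‖ ^ 2 := fun t ht =>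
    mul_nonneg (by positivity) (intervalIntegral.integral_nonneg ht.1 fun _ _ => by positivity)
  have hle : ‖S (φ y) - S ψ‖ ≤ κ + κ * q := by
    refine norm_le_of_pathOf hι hT.le _ hκ0.le (by positivity) (fun t ht => ?_) ?_
    · rw [pathOf_sub]
      exact le_of_sq_le_sq (by linarith [h t ht, hpos t ht]) hκ0.le
    · have h1 := h T (right_mem_Icc.2 hT.le)
      rw [mul_pow, hq, Real.sq_sqrt (by positivity), integral_segMeasure hT.le, mul_one_div,
        le_div_iff₀ (by positivity)]
      simp only [pathOf_sub]
      linarith [sq_nonneg ‖pathOf hT.le (S (φ y)) T - pathOf hT.le (S ψ) T‖]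
  refine hle.trans_lt ?_
  have e : κ + κ * q = ε / 2 := by rw [hκ]; field_simp
  rw [e]
  linarith

end Coefficients

end Stability

/-! ### Weak compactness and the rate function -/

section Rate

open Filter Topology

/-- Bounded balls of a Hilbert space are weakly compact. -/
theorem isCompact_setOf_norm_le (E : Type*) [NormedAddCommGroup E] [InnerProductSpace ℝ E]
    [CompleteSpace E] (K : ℝ) :
    IsCompact {x : WeakSpace ℝ E | ‖(toWeakSpace ℝ E).symm x‖ ≤ K} := by
  set J : WeakDual ℝ E → WeakSpace ℝ E := fun f =>
    toWeakSpace ℝ E ((InnerProductSpace.toDual ℝ E).symm (WeakDual.toStrongDual f)) with hJ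
  have hJc : Continuous J := by
    refine WeakBilin.continuous_of_continuous_eval _ fun Λ => ?_
    have e : ∀ f : WeakDual ℝ E, Λ ((InnerProductSpace.toDual ℝ E).symm (WeakDual.toStrongDual f))
        = f ((InnerProductSpace.toDual ℝ E).symm Λ) := fun f => by
      rw [← InnerProductSpace.toDual_symm_apply (y := Λ), real_inner_comm,
        InnerProductSpace.toDual_symm_apply]
      rfl
    exact (WeakDual.eval_continuous ((InnerProductSpace.toDual ℝ E).symm Λ)).congr
      fun f => (e f).symm
  have himg : {x : WeakSpace ℝ E | ‖(toWeakSpace ℝ E).symm x‖ ≤ K}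
      = J '' (WeakDual.toStrongDual ⁻¹' Metric.closedBall 0 K) := by
    ext x
    simp only [mem_ofPred_eq, mem_image, mem_preimage, mem_closedBall_zero_iff]
    constructor
    · intro hx
      refine ⟨StrongDual.toWeakDual (InnerProductSpace.toDual ℝ E ((toWeakSpace ℝ E).symm x)),
        ?_, ?_⟩
      · exact ((InnerProductSpace.toDual ℝ E).norm_map _).trans_le hx
      · change toWeakSpace ℝ E ((InnerProductSpace.toDual ℝ E).symm
          (InnerProductSpace.toDual ℝ E ((toWeakSpace ℝ E).symm x))) = x
        rw [LinearIsometryEquiv.symm_apply_apply, LinearEquiv.apply_symm_apply]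
    · rintro ⟨f, hf, rfl⟩
      simpa only [hJ, LinearEquiv.symm_apply_apply, LinearIsometryEquiv.norm_map] using hf
  rw [himg]
  exact (WeakDual.isCompact_closedBall 0 K).image hJc

theorem tendsto_weakSpace {E : Type*} [NormedAddCommGroup E] [NormedSpace ℝ E]
    (ψ : WeakSpace ℝ E) (Λ : E →L[ℝ] ℝ) :
    Tendsto (fun x : WeakSpace ℝ E => Λ ((toWeakSpace ℝ E).symm x)) (𝓝 ψ)
      (𝓝 (Λ ((toWeakSpace ℝ E).symm ψ))) :=
  (WeakBilin.eval_continuous (topDualPairing ℝ E).flip Λ).tendsto ψ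

variable {V H U : Type*} [NormedAddCommGroup V] [InnerProductSpace ℝ V]
  [NormedAddCommGroup H] [InnerProductSpace ℝ H]
  [NormedAddCommGroup U] [InnerProductSpace ℝ U] [CompleteSpace U]
  {ι : V →L[ℝ] H} {T : ℝ} {c : Coefficients V H U} {S : Lp U 2 (timeMeasure T) → MR ι T} {x : H}

theorem lintegral_enorm_sq (ψ : Lp U 2 (timeMeasure T)) :
    ∫⁻ s, ‖ψ s‖ₑ ^ 2 ∂timeMeasure T = ENNReal.ofReal (‖ψ‖ ^ 2) := by
  rw [norm_sq_eq_integral, ofReal_integral_eq_lintegral_ofReal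
    ((memLp_two_iff_integrable_sq_norm (Lp.memLp ψ).1).1 (Lp.memLp ψ))
    (ae_of_all _ fun _ => sq_nonneg _)]
  refine lintegral_congr fun s => ?_
  rw [ENNReal.ofReal_pow (norm_nonneg _), ofReal_norm]

namespace Coefficients

/-- The sublevel sets of the rate function are intersections of images of balls: the infimum need
not be attained a priori. -/
theorem rate_le_iff (hS : ∀ ψ u, c.IsSkeletonSolution x ψ u ↔ u = S ψ) (z : MR ι T) (r : ℝ≥0) :
    c.rate x z ≤ r ↔ ∀ s : ℝ, r < s → z ∈ S '' {ψ | ‖ψ‖ ≤ √(2 * s)} := by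
  have h2 : (2 : ℝ≥0∞) ≠ 0 := two_ne_zero
  have h2' : (2 : ℝ≥0∞) ≠ ⊤ := ENNReal.ofNat_ne_top
  have hrate : ∀ ψ, z = S ψ → c.rate x z ≤ 2⁻¹ * ENNReal.ofReal (‖ψ‖ ^ 2) := fun ψ hψ => by
    rw [rate, ← lintegral_enorm_sq]
    gcongr
    exact iInf₂_le ψ ((hS ψ z).2 hψ)
  constructor
  · intro hz s hs
    have hs0 : 0 ≤ s := r.2.trans hs.le
    have h1 : c.rate x z < ENNReal.ofReal s := by
      refine hz.trans_lt ?_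
      rw [← ENNReal.ofReal_coe_nnreal]
      exact (ENNReal.ofReal_lt_ofReal_iff (r.2.trans_lt hs)).2 hs
    rw [rate, mul_comm, ← div_eq_mul_inv, ENNReal.div_lt_iff (Or.inl h2) (Or.inl h2')] at h1
    simp only [iInf_lt_iff] at h1
    obtain ⟨ψ, hψ, h3⟩ := h1
    have h5 : ENNReal.ofReal (2 * s) = ENNReal.ofReal s * 2 := by
      rw [ENNReal.ofReal_mul two_pos.le, ENNReal.ofReal_ofNat, mul_comm]
    rw [lintegral_enorm_sq, ← h5] at h3
    have h4 := (ENNReal.ofReal_lt_ofReal_iff_of_nonneg (sq_nonneg _)).1 h3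
    exact ⟨ψ, Real.le_sqrt_of_sq_le h4.le, ((hS ψ z).1 hψ).symm⟩
  · intro h
    refine ENNReal.le_of_forall_pos_le_add fun ε hε _ => ?_
    obtain ⟨ψ, hψ, rfl⟩ := h (r + ε) (lt_add_of_pos_right _ hε)
    have h0 : (0 : ℝ) ≤ 2 * (r + ε) := by positivity
    refine (hrate ψ rfl).trans ?_
    have h3 : ‖ψ‖ ^ 2 ≤ 2 * (r + ε) := (Real.le_sqrt (norm_nonneg _) h0).1 hψ
    calc 2⁻¹ * ENNReal.ofReal (‖ψ‖ ^ 2) ≤ 2⁻¹ * ENNReal.ofReal (2 * (r + ε)) := by gcongr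
      _ = 2⁻¹ * (2 * (r + ε)) := by
          rw [ENNReal.ofReal_mul two_pos.le, ENNReal.ofReal_ofNat,
            ENNReal.ofReal_add r.coe_nonneg ε.coe_nonneg, ENNReal.ofReal_coe_nnreal,
            ENNReal.ofReal_coe_nnreal]
      _ = r + ε := by rw [← mul_assoc, ENNReal.inv_mul_cancel h2 h2', one_mul]

/-- If the solution map is continuous on balls in the weak topology, the rate function has compact
sublevel sets, since these balls are weakly compact. -/
theorem isCompact_rate_le (hS : ∀ ψ u, c.IsSkeletonSolution x ψ u ↔ u = S ψ)
    (hcont : ∀ K : ℝ, 0 ≤ K → ContinuousOn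
      (fun ψ : WeakSpace ℝ (Lp U 2 (timeMeasure T)) =>
        S ((toWeakSpace ℝ (Lp U 2 (timeMeasure T))).symm ψ))
      {ψ | ‖(toWeakSpace ℝ (Lp U 2 (timeMeasure T))).symm ψ‖ ≤ K}) (r : ℝ≥0) :
    IsCompact {z : MR ι T | c.rate x z ≤ r} := by
  have himg : ∀ K : ℝ, 0 ≤ K → IsCompact (S '' {ψ | ‖ψ‖ ≤ K}) := fun K hK => by
    have h := (isCompact_setOf_norm_le (Lp U 2 (timeMeasure T)) K).image_of_continuousOn
      (hcont K hK)
    convert h using 1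
    ext z
    constructor
    · rintro ⟨ψ, hψ, rfl⟩
      exact ⟨toWeakSpace ℝ _ ψ, by simpa using hψ, by simp⟩
    · rintro ⟨ψ, hψ, rfl⟩
      exact ⟨(toWeakSpace ℝ _).symm ψ, hψ, rfl⟩
  have hset : {z : MR ι T | c.rate x z ≤ r}
      = ⋂ (s : ℝ) (_ : r < s), S '' {ψ | ‖ψ‖ ≤ √(2 * s)} := by
    ext z
    simp only [mem_ofPred_eq, mem_iInter]
    exact rate_le_iff hS z r
  rw [hset]
  refine (himg (√(2 * (r + 1))) (Real.sqrt_nonneg _)).of_isClosed_subset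
    (isClosed_biInter fun s _ => (himg _ (Real.sqrt_nonneg _)).isClosed)
    (biInter_subset_of_mem (show (r : ℝ) < r + 1 by linarith))

end Coefficients

end Rate

end SkeletonEq

end

theorem proposition4p8 {V H U : Type*}
    [NormedAddCommGroup V] [InnerProductSpace ℝ V] [CompleteSpace V]
    [TopologicalSpace.SeparableSpace V] [MeasurableSpace V] [BorelSpace V]
    [NormedAddCommGroup H] [InnerProductSpace ℝ H] [CompleteSpace H]
    [TopologicalSpace.SeparableSpace H] [MeasurableSpace H] [BorelSpace H]
    [NormedAddCommGroup U] [InnerProductSpace ℝ U] [CompleteSpace U]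
    [TopologicalSpace.SeparableSpace U]
    (ι : V →L[ℝ] H) (hι : Function.Injective ι) (hι' : DenseRange ι)
    (c : SkeletonEq.Coefficients V H U) (hc : c.IsCritical ι) (hc' : c.IsCoercive ι)
    (x : H) (T : ℝ) (hT : 0 < T) :
    ∃ S : Lp U 2 (SkeletonEq.timeMeasure T) → SkeletonEq.MR ι T,
      (∀ (ψ : Lp U 2 (SkeletonEq.timeMeasure T)) (u : SkeletonEq.MR ι T),
        c.IsSkeletonSolution x ψ u ↔ u = S ψ) ∧
      (∀ K : ℝ, 0 ≤ K →
        ContinuousOn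
          (fun ψ : WeakSpace ℝ (Lp U 2 (SkeletonEq.timeMeasure T)) =>
            S ((toWeakSpace ℝ (Lp U 2 (SkeletonEq.timeMeasure T))).symm ψ))
          {ψ | ‖(toWeakSpace ℝ (Lp U 2 (SkeletonEq.timeMeasure T))).symm ψ‖ ≤ K}) ∧
      ∀ r : ℝ≥0, IsCompact {z : SkeletonEq.MR ι T | c.rate x z ≤ r} := by
  have : SecondCountableTopology V := UniformSpace.secondCountable_of_separable V
  have : SecondCountableTopology H := UniformSpace.secondCountable_of_separable H
  have : SecondCountableTopology U := UniformSpace.secondCountable_of_separable U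
  obtain ⟨S, hS⟩ := SkeletonEq.Coefficients.exists_solutionMap hι hι' hc hc' hT x
  have hcont : ∀ K : ℝ, 0 ≤ K → ContinuousOn
      (fun ψ : WeakSpace ℝ (Lp U 2 (SkeletonEq.timeMeasure T)) =>
        S ((toWeakSpace ℝ (Lp U 2 (SkeletonEq.timeMeasure T))).symm ψ))
      {ψ | ‖(toWeakSpace ℝ (Lp U 2 (SkeletonEq.timeMeasure T))).symm ψ‖ ≤ K} :=
    fun K _ ψ hψ => SkeletonEq.Coefficients.tendsto_solutionMap hι hι' hc hc' hT hS
      self_mem_nhdsWithin hψ fun Λ =>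
        (SkeletonEq.tendsto_weakSpace ψ Λ).mono_left nhdsWithin_le_nhds
  exact ⟨S, hS, hcont, SkeletonEq.Coefficients.isCompact_rate_le hS hcont⟩
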